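/- Let $F_\varepsilon(x,y)$ be an analytic (or $C^\infty$, or formal) family of area-preserving orientation-reversing maps of the plane, defined for $(x,y,\varepsilon)$ in a neighbourhood of the origin of $\mathbb R^3$, that is, $\det DF_\varepsilon=-1$, where $D$ is the derivative in $(x,y)$. Assume that $F_0(0)=0$ and that $DF_0(0)$ has the eigenvalues $-1$ and $1$. An analytic or $C^\infty$ family is identified with its Taylor series at the origin, an individual map is regarded as a family that does not depend on $\varepsilon$, and all equalities below are equalities of formal power series in $(x,y,\varepsilon)$. Notation. Let $R=\mathrm{Diag}(-1,1)$. A canonical formal change of variables $\phi_\varepsilon$ is a pair of formal power series in $(x,y,\varepsilon)$ without constant term with $\det D\phi_\varepsilon=1$. Assign the orders $1,1,3$ to $x,y,\varepsilon$. For a formal Hamiltonian $h$ all of whose monomials have order at least $3$, let $\Phi^1_h=(\exp(L_h)x,\exp(L_h)y)$ be its formal time-one map, where $L_hg=\partial_xg\,\partial_yh-\partial_yg\,\partial_xh$. A Takens Hamiltonian of $F_\varepsilon$ is a formal Hamiltonian $h$ that is odd in $x$, has only monomials of order at least $3$, and satisfies $F_\varepsilon=\phi_\varepsilon^{-1}\circ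 R\circ\Phi^1_h\circ\phi_\varepsilon$ for some canonical formal change of variables $\phi_\varepsilon$; at $\varepsilon=0$ its leading order is $bxy^2+ax^3$. Assume that the leading order of the normal form is non-degenerate, i.e., $b\neq0$ (for every Takens Hamiltonian of $F_\varepsilon$). Then there exists a canonical formal change of variables $\phi_\varepsilon$ such that $$F_\varepsilon=\phi_\varepsilon^{-1}\circ \mathrm{Diag}(-1,1)\circ\Phi^1_{h_\varepsilon}\circ\phi_\varepsilon,$$ where $$h_\varepsilon(x,y)=xy^2+ax^3+A(x,\varepsilon)+y\,B(xy^2,\varepsilon),$$ $a\in\mathbb R$, and $A$ and $B$ are real formal series of the form $$A(x,\varepsilon)=\sum_{\substack{k\ge1,\ m\ge0\\ (2k-1)+3m\ge4}}a_{mk}\,x^{2k-1}\varepsilon^m,\qquad B(xy^2,\varepsilon)=\sum_{k\ge1,\ m\ge0}b_{mk}\,(xy^2)^{2k-1}\varepsilon^m .$$ The number $a$ and all the coefficients $a_{mk}$, $b_{mk}$ are defined uniquely by the family $F_\varepsilon$ (they do not depend on the choice of $\phi_\varepsilon$). -/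

import Mathlib

namespace ReversingMaps

open MvPowerSeries

noncomputable section

/-! ### Formal families of planar maps

The variables with indices `0`, `1`, `2` are `x`, `y` and the parameter `ε`. -/

/-- Real formal power series in `x, y, ε`. -/
abbrev FSeries := MvPowerSeries (Fin 3) ℝ

/-- A formal family `F_ε` of maps of the plane: its two components. -/
abbrev FormalMap := Fin 2 → FSeries

/-- The exponent of the monomial `x^k y^l ε^m`. -/
def expo (k l m : ℕ) : Fin 3 →₀ ℕ := Finsupp.equivFunOnFinite.symm ![k, l, m]

/-- The composition `F_ε ∘ G_ε`, that is `F(G₁, G₂, ε)` (for `G` without constant term). -/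
def comp (F G : FormalMap) : FormalMap :=
  fun i => subst (![G 0, G 1, X 2] : Fin 3 → FSeries) (F i)

/-- The identity family. -/
def idMap : FormalMap := ![X 0, X 1]

/-- The linear map `Diag(-1, 1)`. -/
def reflection : FormalMap := ![-X 0, X 1]

/-- The Jacobian determinant of `F_ε` with respect to `(x, y)`. -/
def jacDet (F : FormalMap) : FSeries :=
  pderiv ℝ 0 (F 0) * pderiv ℝ 1 (F 1) - pderiv ℝ 1 (F 0) * pderiv ℝ 0 (F 1)

/-- `F_0(0) = 0`. -/
def FixesOrigin (F : FormalMap) : Prop := ∀ i, constantCoeff (F i) = 0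

/-- The matrix `DF_0(0)` of first derivatives in `(x, y)`. -/
def linearPart (F : FormalMap) : Matrix (Fin 2) (Fin 2) ℝ :=
  Matrix.of fun i j => coeff (Finsupp.single j.castSucc 1) (F i)

/-- The numbers `-1` and `1` are eigenvalues of the matrix `J`. -/
def HasEigenvaluesNegOneOne (J : Matrix (Fin 2) (Fin 2) ℝ) : Prop :=
  Module.End.HasEigenvalue (Matrix.toLin' J) (-1) ∧
    Module.End.HasEigenvalue (Matrix.toLin' J) 1

/-- A canonical formal change of the variables `(x, y)`, depending on `ε`. -/
structure IsCanonical (φ : FormalMap) : Prop where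
  fixesOrigin : FixesOrigin φ
  jacDet_eq : jacDet φ = 1

/-! ### Time-one maps of formal Hamiltonians -/

/-- The Poisson bracket `{g, χ} = ∂g/∂x ∂χ/∂y - ∂g/∂y ∂χ/∂x`. -/
def bracket (g χ : FSeries) : FSeries :=
  pderiv ℝ 0 g * pderiv ℝ 1 χ - pderiv ℝ 1 g * pderiv ℝ 0 χ

/-- The Lie derivative `L_χ g = {g, χ}`. -/
def lieD (χ g : FSeries) : FSeries := bracket g χ

/-- `exp(L_χ) g = ∑ₖ L_χ^k g / k!`, summed coefficient by coefficient. When `χ` has order at least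
three, as defined below, only finitely many `k` contribute to each coefficient. -/
def expLie (χ g : FSeries) : FSeries :=
  fun d => ∑ᶠ k : ℕ, ((k.factorial : ℝ))⁻¹ * coeff d ((lieD χ)^[k] g)

/-- The time-one map `Φ¹_χ = (exp(L_χ) x, exp(L_χ) y)`. -/
def timeOne (χ : FSeries) : FormalMap := ![expLie χ (X 0), expLie χ (X 1)]

/-- All monomials of `h` have order at least three, where `x`, `y`, `ε` have orders `1, 1, 3`. -/
def OrderAtLeastThree (h : FSeries) : Prop :=
  ∀ d : Fin 3 →₀ ℕ, coeff d h ≠ 0 → 3 ≤ d 0 + d 1 + 3 * d 2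

/-- `h(-x, y, ε) = -h(x, y, ε)`. -/
def OddInX (h : FSeries) : Prop := ∀ d : Fin 3 →₀ ℕ, coeff d h ≠ 0 → Odd (d 0)

/-- `F = φ⁻¹ ∘ Diag(-1, 1) ∘ Φ¹_h ∘ φ` for some canonical formal change of variables `φ`;
here `ψ` is `φ⁻¹`. -/
def ConjToReflectedFlow (F : FormalMap) (h : FSeries) : Prop :=
  ∃ φ ψ : FormalMap, IsCanonical φ ∧ IsCanonical ψ ∧
    comp φ ψ = idMap ∧ comp ψ φ = idMap ∧
    F = comp ψ (comp reflection (comp (timeOne h) φ))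

/-- `h` is the Hamiltonian of a Takens normal form vector field of `F`: it is odd in `x`, starts
with cubic terms, and `F` is canonically conjugate to `Diag(-1, 1) ∘ Φ¹_h`. At `ε = 0` its leading
part is `b x y² + a x³`. -/
def IsTakensHamiltonian (F : FormalMap) (h : FSeries) : Prop :=
  OddInX h ∧ OrderAtLeastThree h ∧ ConjToReflectedFlow F h

/-- The leading order `b x y² + a x³` of the Takens normal form is non-degenerate: `b ≠ 0`. The
number `b` is determined by `F` up to a non-zero factor, which depends on the scaling of the
normalising coordinates; the condition is required of every choice. -/
def NondegenerateLeadingOrder (F : FormalMap) : Prop :=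
  ∀ h : FSeries, IsTakensHamiltonian F h → coeff (expo 1 2 0) h ≠ 0

/-! ### The simplified Hamiltonian -/

/-- `A(u, ε)` is a sum of terms `a_{mk} u^(2k-1) ε^m` with `k ≥ 1` and `(2k-1) + 3m ≥ 4`. -/
def AdmissibleA (A : MvPowerSeries (Fin 2) ℝ) : Prop :=
  ∀ d : Fin 2 →₀ ℕ, coeff d A ≠ 0 → Odd (d 0) ∧ 4 ≤ d 0 + 3 * d 1

/-- `B(u, ε)` is a sum of terms `b_{mk} u^(2k-1) ε^m` with `k ≥ 1` and `m ≥ 0`. -/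
def AdmissibleB (B : MvPowerSeries (Fin 2) ℝ) : Prop :=
  ∀ d : Fin 2 →₀ ℕ, coeff d B ≠ 0 → Odd (d 0)

/-- `h = x y² + a x³ + A(x, ε) + y B(x y², ε)`. -/
def normalHam (a : ℝ) (A B : MvPowerSeries (Fin 2) ℝ) : FSeries :=
  X 0 * X 1 ^ 2 + C a * X 0 ^ 3 + subst (![X 0, X 2] : Fin 2 → FSeries) A +
    X 1 * subst (![X 0 * X 1 ^ 2, X 2] : Fin 2 → FSeries) B

/-! ### The classes of families -/

/-- A formal family of area-preserving, orientation-reversing maps with `F_0(0) = 0` such that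
`DF_0(0)` has the eigenvalues `-1` and `1`. -/
structure IsFormalReversingFamily (F : FormalMap) : Prop where
  jacDet_eq : jacDet F = -1
  fixesOrigin : FixesOrigin F
  eigenvalues : HasEigenvaluesNegOneOne (linearPart F)

/-- The matrix of first derivatives of `F_ε` in `(x, y)` at the point `p = (x, y, ε)`. -/
def jacobian (F : (Fin 3 → ℝ) → Fin 2 → ℝ) (p : Fin 3 → ℝ) : Matrix (Fin 2) (Fin 2) ℝ :=
  Matrix.of fun i j => fderiv ℝ F p (Pi.single j.castSucc 1) i

/-- A family `(x, y, ε) ↦ F_ε(x, y)` of area-preserving, orientation-reversing maps of class `C^r`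
on a neighbourhood `U` of the origin, with `F_0(0) = 0`, such that `DF_0(0)` has the eigenvalues
`-1` and `1`. -/
structure IsReversingFamilyOn (r : WithTop ℕ∞) (U : Set (Fin 3 → ℝ))
    (F : (Fin 3 → ℝ) → Fin 2 → ℝ) : Prop where
  isOpen : IsOpen U
  zero_mem : (0 : Fin 3 → ℝ) ∈ U
  contDiffOn : ContDiffOn ℝ r F U
  det_jacobian : ∀ p ∈ U, (jacobian F p).det = -1
  map_zero : F 0 = 0
  eigenvalues : HasEigenvaluesNegOneOne (jacobian F 0)

/-- The partial derivative with respect to the `i`-th variable. -/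
def partialD (i : Fin 3) (f : (Fin 3 → ℝ) → ℝ) : (Fin 3 → ℝ) → ℝ :=
  fun p => fderiv ℝ f p (Pi.single i 1)

/-- The Taylor series of a function at the origin. -/
def taylorSeries (f : (Fin 3 → ℝ) → ℝ) : FSeries := fun d =>
  ((partialD 0)^[d 0] ((partialD 1)^[d 1] ((partialD 2)^[d 2] f))) 0 /
    ((d 0).factorial * (d 1).factorial * (d 2).factorial : ℝ)

/-- The Taylor series of a family of maps at the origin. -/
def taylorMap (F : (Fin 3 → ℝ) → Fin 2 → ℝ) : FormalMap :=
  fun i => taylorSeries fun p => F p i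

end

end ReversingMaps

/-! Families of maps act on power series by pull-back, so that canonical changes of variables become
algebra automorphisms preserving the Poisson bracket, and all constructions proceed order by order
with respect to the weights `1, 1, 3` of `x, y, ε`. Let `R = Diag(-1, 1)`.

* Conjugating `R ∘ Φ¹_h` by the flow of a Hamiltonian `χ` that is even in `x` changes `h` by `2 χ`
  to leading order, while an odd `χ` changes `h` by the bracket `{h, χ}`. Even terms are therefore
  removable, which gives a Takens Hamiltonian; a diagonal change of variables turns its leading part
  into `L = x y² + a x³`.
* The operator `{L, ·}` is triangular with non-zero diagonal off the monomials `x^k y^(2k) ε^m`.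
  Solving the homological equation order by order leaves exactly the monomials `x^k ε^m` and
  `x^k y^(2k+1) ε^m` with odd `k`, which are those of `A(x, ε)` and `y B(x y², ε)`.
* The square of `R ∘ Φ¹_h` is `Φ¹_{2h}`, and a flow determines its Hamiltonian up to a function of
  `ε`. Two normal forms `g`, `g'` of one family are thus related by `g' = δ g`, where `δ` is a
  canonical automorphism commuting with `R`, and comparing the coefficients of `x y²` shows that the
  linear part of `δ` is the identity. If `δ` agrees with the identity up to some order, then the
  leading part of its generating Hamiltonian is a combination of the products `L^s ε^m`. The flow of
  the same combination of the products `g^s ε^m` preserves `g`; splitting it off improves the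
  agreement, and in the limit `g' = g`. -/

namespace ReversingMaps

open MvPowerSeries Finset.HasAntidiagonal
open scoped Matrix

noncomputable section

/-! ### The weight filtration -/

section WeightFiltration

variable {σ R : Type*} [CommRing R] {w : σ → ℕ}

/-- The ideal of power series all of whose monomials have weight at least `n`, where the variable
`X i` has weight `w i`. -/
def weightIdeal (w : σ → ℕ) (n : ℕ) : Ideal (MvPowerSeries σ R) where
  carrier := {f | (n : ℕ∞) ≤ f.weightedOrder w}
  add_mem' hf hg := (le_min hf hg).trans (min_weightedOrder_le_add w)
  zero_mem' := by simp
  smul_mem' _ _ hf := hf.trans (le_add_self.trans (le_weightedOrder_mul w))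

lemma mem_weightIdeal_iff {n : ℕ} {f : MvPowerSeries σ R} :
    f ∈ weightIdeal w n ↔ ∀ d, Finsupp.weight w d < n → coeff d f = 0 :=
  ⟨fun h _ hd => coeff_eq_zero_of_lt_weightedOrder w
    ((Nat.cast_lt.2 hd).trans_le h), nat_le_weightedOrder w⟩

lemma mem_weightIdeal_of_le {m n : ℕ} {f : MvPowerSeries σ R} (hf : f ∈ weightIdeal w n)
    (h : m ≤ n) : f ∈ weightIdeal w m :=
  show (m : ℕ∞) ≤ _ from (Nat.cast_le.2 h).trans hf

@[simp] lemma mem_weightIdeal_zero (f : MvPowerSeries σ R) : f ∈ weightIdeal w 0 :=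
  show ((0 : ℕ) : ℕ∞) ≤ _ by simp

lemma mul_mem_weightIdeal {m n : ℕ} {f g : MvPowerSeries σ R} (hf : f ∈ weightIdeal w m)
    (hg : g ∈ weightIdeal w n) : f * g ∈ weightIdeal w (m + n) := by
  change ((m + n : ℕ) : ℕ∞) ≤ _
  rw [Nat.cast_add]
  exact (add_le_add hf hg).trans (le_weightedOrder_mul w)

lemma pow_mem_weightIdeal {n : ℕ} {f : MvPowerSeries σ R} (hf : f ∈ weightIdeal w n) (k : ℕ) :
    f ^ k ∈ weightIdeal w (k * n) := by
  change ((k * n : ℕ) : ℕ∞) ≤ _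
  rw [Nat.cast_mul, ← nsmul_eq_mul]
  exact (nsmul_le_nsmul_right hf k).trans (le_weightedOrder_pow w k)

lemma eq_zero_of_forall_mem_weightIdeal {f : MvPowerSeries σ R}
    (h : ∀ n, f ∈ weightIdeal w n) : f = 0 :=
  (weightedOrder_eq_top_iff w).1 (ENat.eq_top_iff_forall_ge.2 h)

lemma eq_of_forall_sub_mem_weightIdeal {f g : MvPowerSeries σ R}
    (h : ∀ n, f - g ∈ weightIdeal w n) : f = g :=
  sub_eq_zero.1 (eq_zero_of_forall_mem_weightIdeal h)

lemma monomial_mem_weightIdeal (d : σ →₀ ℕ) (a : R) :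
    monomial d a ∈ weightIdeal w (Finsupp.weight w d) := by
  classical
  refine mem_weightIdeal_iff.2 fun e he => ?_
  rw [coeff_monomial, if_neg]
  rintro rfl
  exact he.false

lemma X_mem_weightIdeal (i : σ) : (X i : MvPowerSeries σ R) ∈ weightIdeal w (w i) := by
  simpa [X_def, Finsupp.weight_single] using
    monomial_mem_weightIdeal (w := w) (Finsupp.single i 1) (1 : R)

lemma mem_weightIdeal_one_iff (hw : ∀ i, w i ≠ 0) {f : MvPowerSeries σ R} :
    f ∈ weightIdeal w 1 ↔ constantCoeff f = 0 := by
  simp only [mem_weightIdeal_iff, Nat.lt_one_iff]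
  have : Finsupp.NonTorsionWeight ℕ w := Finsupp.nonTorsionWeight_of (R := ℕ) (hw := hw)
  refine ⟨fun h => h 0 (map_zero _), fun h d hd => ?_⟩
  rwa [(Finsupp.weight_eq_zero_iff_eq_zero w).1 hd]

lemma C_mem_weightIdeal {n : ℕ} {f : MvPowerSeries σ R} (hf : f ∈ weightIdeal w n) :
    C (constantCoeff f) ∈ weightIdeal w n := by
  classical
  refine mem_weightIdeal_iff.2 fun d hd => ?_
  rw [coeff_C]
  split_ifs with h
  · subst h
    exact mem_weightIdeal_iff.1 hf 0 hd
  · rfl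

lemma pderiv_mem_weightIdeal (i : σ) {n : ℕ} {f : MvPowerSeries σ R} (hf : f ∈ weightIdeal w n) :
    pderiv R i f ∈ weightIdeal w (n - w i) := by
  refine mem_weightIdeal_iff.2 fun d hd => ?_
  rw [coeff_pderiv, mem_weightIdeal_iff.1 hf, zero_mul]
  rw [map_add, Finsupp.weight_single, one_smul]
  omega

/-- Hadamard's lemma: the monomial of exponent `d ≠ 0` is assigned to one of the variables that
divide it. -/
lemma exists_eq_C_add_sum_X_mul [Fintype σ] {n : ℕ} {f : MvPowerSeries σ R}
    (hf : f ∈ weightIdeal w n) :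
    ∃ g : σ → MvPowerSeries σ R, f = C (constantCoeff f) + ∑ i, X i * g i ∧
      ∀ i, g i ∈ weightIdeal w (n - w i) := by
  classical
  have hsupp : ∀ d : σ →₀ ℕ, d ≠ 0 → ∃ i, d i ≠ 0 := fun d hd => DFunLike.ne_iff.1 hd
  choose pick hpick using hsupp
  have hne : ∀ (d : σ →₀ ℕ) i, d + Finsupp.single i 1 ≠ 0 := fun d i h => by
    simpa using DFunLike.congr_fun h i
  let g : σ → MvPowerSeries σ R :=
    fun i d => if pick _ (hne d i) = i then coeff (d + Finsupp.single i 1) f else 0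
  have hg : ∀ i d, coeff d (g i) =
    if pick _ (hne d i) = i then coeff (d + Finsupp.single i 1) f else 0 := fun _ _ => rfl
  refine ⟨g, ?_, fun i => mem_weightIdeal_iff.2 fun d hd => ?_⟩
  · ext d
    simp only [map_add, map_sum, X_def, coeff_monomial_mul, one_mul, coeff_C]
    rcases eq_or_ne d 0 with rfl | hd
    · simp
    have hle : ∀ i, Finsupp.single i 1 ≤ d ↔ d i ≠ 0 := fun i => by
      rw [Finsupp.single_le_iff, Nat.one_le_iff_ne_zero]
    rw [if_neg hd, zero_add, Finset.sum_eq_single (pick d hd)]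
    · rw [if_pos ((hle _).2 (hpick d hd)), hg]
      simp only [tsub_add_cancel_of_le ((hle _).2 (hpick d hd)), if_true]
    · intro i _ hi
      split_ifs with h
      · rw [hg]
        simp only [tsub_add_cancel_of_le h, if_neg hi.symm]
      · rfl
    · simp
  · rw [hg]
    split_ifs
    · refine mem_weightIdeal_iff.1 hf _ ?_
      rw [map_add, Finsupp.weight_single, one_smul]
      omega
    · rfl

/-- A map of power series that raises the order of every series by at least `k`. -/
def RaisesOrder (w : σ → ℕ) (k : ℕ) (D : MvPowerSeries σ R → MvPowerSeries σ R) : Prop :=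
  ∀ ⦃n f⦄, f ∈ weightIdeal w n → D f ∈ weightIdeal w (n + k)

/-- The case `j = n + k` of the induction on the precision `j`, which Hadamard's lemma drives. -/
lemma raisesOrder_of_X_mul [Finite σ] {k : ℕ} {D : MvPowerSeries σ R →+ MvPowerSeries σ R}
    (hC : ∀ n c, C c ∈ weightIdeal w n → D (C c) ∈ weightIdeal w (n + k))
    (hX : ∀ i j n g, g ∈ weightIdeal w n → D g ∈ weightIdeal w (min j (n + k)) →
      D (X i * g) ∈ weightIdeal w (min (j + 1) (w i + n + k))) :
    RaisesOrder w k D := by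
  cases nonempty_fintype σ
  have hprecision : ∀ j n f, f ∈ weightIdeal w n → D f ∈ weightIdeal w (min j (n + k)) := by
    intro j
    induction j with
    | zero => simp
    | succ j ih =>
      intro n f hf
      obtain ⟨g, hfg, hg⟩ := exists_eq_C_add_sum_X_mul hf
      rw [hfg, map_add, map_sum]
      refine add_mem (mem_weightIdeal_of_le (hC n _ (C_mem_weightIdeal hf)) (by omega))
        (sum_mem fun i _ => mem_weightIdeal_of_le (hX i j _ _ (hg i) (ih _ _ (hg i))) (by omega))
  intro n f hf
  simpa using hprecision (n + k) n f hf

end WeightFiltration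

/-! ### Filtered endomorphisms -/

section FilteredEndomorphisms

variable {σ R : Type*} [CommRing R] {w : σ → ℕ}
  {α β γ α' β' : MvPowerSeries σ R →ₐ[R] MvPowerSeries σ R}

/-- The endomorphisms of the algebra of power series that respect the weight filtration. -/
structure IsFiltered (w : σ → ℕ) (α : MvPowerSeries σ R →ₐ[R] MvPowerSeries σ R) : Prop where
  mem : ∀ ⦃n f⦄, f ∈ weightIdeal w n → α f ∈ weightIdeal w n

/-- Congruence of endomorphisms: the difference `α - β` raises the order by at least `k`. -/
def Cong (w : σ → ℕ) (k : ℕ) (α β : MvPowerSeries σ R →ₐ[R] MvPowerSeries σ R) : Prop :=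
  RaisesOrder w k fun f => α f - β f

lemma Cong.refl (w : σ → ℕ) (k : ℕ) (α : MvPowerSeries σ R →ₐ[R] MvPowerSeries σ R) :
    Cong w k α α := fun n f _ => by simp

lemma Cong.symm {k : ℕ} (h : Cong w k α β) : Cong w k β α := fun n f hf => by
  simpa only [neg_sub] using neg_mem (h hf)

lemma Cong.trans {k : ℕ} (h : Cong w k α β) (h' : Cong w k β γ) : Cong w k α γ :=
  fun n f hf => by simpa only [sub_add_sub_cancel] using add_mem (h hf) (h' hf)

lemma Cong.mono {j k : ℕ} (h : Cong w k α β) (hjk : j ≤ k) : Cong w j α β :=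
  fun _ _ hf => mem_weightIdeal_of_le (h hf) (by omega)

lemma Cong.mul_left {k : ℕ} (h : Cong w k α β) (hγ : IsFiltered w γ) :
    Cong w k (γ * α) (γ * β) := fun n f hf => by
  simpa only [AlgHom.mul_apply, ← map_sub] using hγ.mem (h hf)

lemma Cong.mul_right {k : ℕ} (h : Cong w k α β) (hγ : IsFiltered w γ) :
    Cong w k (α * γ) (β * γ) := fun _ _ hf => h (hγ.mem hf)

lemma Cong.mul {k : ℕ} (h : Cong w k α β) (h' : Cong w k α' β') (hβ : IsFiltered w β)
    (hα' : IsFiltered w α') : Cong w k (α * α') (β * β') :=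
  (h.mul_right hα').trans (h'.mul_left hβ)

lemma Cong.isFiltered {k : ℕ} (h : Cong w k α β) (hβ : IsFiltered w β) : IsFiltered w α :=
  ⟨fun n f hf => by
    simpa using add_mem (mem_weightIdeal_of_le (h hf) (Nat.le_add_right n k)) (hβ.mem hf)⟩

lemma eq_of_forall_cong (h : ∀ k, Cong w k α β) : α = β := by
  ext1 f
  exact eq_of_forall_sub_mem_weightIdeal fun n => by simpa using h n (mem_weightIdeal_zero f)

lemma isFiltered_of_X [Finite σ] (hw : ∀ i, w i ≠ 0)
    (h : ∀ i, α (X i) ∈ weightIdeal w (w i)) : IsFiltered w α := by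
  have hraises : RaisesOrder w 0 (α : MvPowerSeries σ R →+ MvPowerSeries σ R) := by
    refine raisesOrder_of_X_mul (fun n c hc => ?_) fun i j n g _ ih => ?_
    · exact (α.commutes c).symm ▸ hc
    · have := Nat.pos_of_ne_zero (hw i)
      rw [AddMonoidHom.coe_coe, map_mul]
      exact mem_weightIdeal_of_le (mul_mem_weightIdeal (h i) ih) (by omega)
  exact ⟨hraises⟩

lemma cong_of_X [Finite σ] (hw : ∀ i, w i ≠ 0) {k : ℕ} (hα : IsFiltered w α)
    (hβ : IsFiltered w β) (h : ∀ i, α (X i) - β (X i) ∈ weightIdeal w (w i + k)) :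
    Cong w k α β := by
  let D : MvPowerSeries σ R →+ MvPowerSeries σ R := α.toLinearMap - β.toLinearMap
  have hD : ∀ f, D f = α f - β f := fun _ => rfl
  refine raisesOrder_of_X_mul (D := D) (fun n c _ => ?_) fun i j n g hg ih => ?_
  · have hc : α (C c) = β (C c) := (α.commutes c).trans (β.commutes c).symm
    simp [hD, hc]
  · have hi := Nat.pos_of_ne_zero (hw i)
    have hsplit : D (X i * g) = (α (X i) - β (X i)) * α g + β (X i) * D g := by
      simp only [hD, map_mul]; ring
    rw [hsplit]
    exact add_mem (mem_weightIdeal_of_le (mul_mem_weightIdeal (h i) (hα.mem hg)) (by omega))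
      (mem_weightIdeal_of_le (mul_mem_weightIdeal (hβ.mem (X_mem_weightIdeal i)) ih) (by omega))

lemma eq_zero_of_leibniz_of_X [Finite σ] (hw : ∀ i, w i ≠ 0) (hα : IsFiltered w α)
    {D : MvPowerSeries σ R →ₗ[R] MvPowerSeries σ R}
    (hmul : ∀ f g, D (f * g) = α f * D g + D f * α g) (hX : ∀ i, D (X i) = 0) : D = 0 := by
  have hone : D 1 = 0 := by simpa using hmul 1 1
  have hC : ∀ c, D (C c) = 0 := fun c => by
    rw [← mul_one (C c), ← smul_eq_C_mul, map_smul, hone, smul_zero]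
  have hraises : ∀ k, RaisesOrder w k (D : MvPowerSeries σ R →+ MvPowerSeries σ R) := fun k =>
    raisesOrder_of_X_mul (fun n c _ => by simp [hC]) fun i j n g _ ih => by
      have hi := Nat.pos_of_ne_zero (hw i)
      rw [AddMonoidHom.coe_coe] at ih ⊢
      rw [hmul, hX, zero_mul, add_zero]
      exact mem_weightIdeal_of_le (mul_mem_weightIdeal (hα.mem (X_mem_weightIdeal i)) ih)
        (by omega)
  ext1 f
  exact eq_zero_of_forall_mem_weightIdeal fun n => by simpa using hraises n (mem_weightIdeal_zero f)

lemma pderiv_algHom [Fintype σ] (hw : ∀ i, w i ≠ 0) (hα : IsFiltered w α) (i : σ)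
    (f : MvPowerSeries σ R) :
    pderiv R i (α f) = ∑ j, α (pderiv R j f) * pderiv R i (α (X j)) := by
  classical
  let D : MvPowerSeries σ R →ₗ[R] MvPowerSeries σ R :=
    (pderiv R i).toLinearMap ∘ₗ α.toLinearMap - ∑ j, LinearMap.mulRight R (pderiv R i (α (X j))) ∘ₗ
      α.toLinearMap ∘ₗ (pderiv R j).toLinearMap
  have hD : ∀ f, D f = pderiv R i (α f) - ∑ j, α (pderiv R j f) * pderiv R i (α (X j)) :=
    fun f => by simp [D, LinearMap.sum_apply]
  have hD0 : D = 0 := by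
    refine eq_zero_of_leibniz_of_X hw hα (fun f g => ?_) fun j => ?_
    · simp only [hD, Derivation.leibniz, smul_eq_mul, map_add, map_mul, add_mul,
        Finset.sum_add_distrib, mul_sub, sub_mul, Finset.mul_sum, Finset.sum_mul]
      simp only [mul_comm, mul_left_comm]
      ring
    · rw [hD, Finset.sum_eq_single j (fun b _ hb => by
        rw [pderiv_X_of_ne hb.symm, map_zero, zero_mul]) (by simp), pderiv_X_self, map_one, one_mul,
        sub_self]
  exact sub_eq_zero.1 ((hD f).symm.trans (LinearMap.congr_fun hD0 f))

lemma exists_forall_sub_mem_weightIdeal {f : ℕ → MvPowerSeries σ R}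
    (h : ∀ n, f (n + 1) - f n ∈ weightIdeal w n) :
    ∃ g, ∀ n, g - f n ∈ weightIdeal w n := by
  have hcauchy : ∀ {m n}, m ≤ n → f n - f m ∈ weightIdeal w m := by
    intro m n hmn
    induction n, hmn using Nat.le_induction with
    | base => simp
    | succ n hn ih =>
      simpa only [sub_add_sub_cancel] using add_mem (mem_weightIdeal_of_le (h n) hn) ih
  let g : MvPowerSeries σ R := fun d => coeff d (f (Finsupp.weight w d + 1))
  have hg : ∀ d, coeff d g = coeff d (f (Finsupp.weight w d + 1)) := fun _ => rfl
  refine ⟨g, fun n => mem_weightIdeal_iff.2 fun d hd => ?_⟩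
  have hstable := mem_weightIdeal_iff.1 (hcauchy (n := n) hd) d (Nat.lt_succ_self _)
  rw [map_sub, sub_eq_zero] at hstable
  rw [map_sub, hg, hstable, sub_self]

lemma cong_of_le {α : ℕ → MvPowerSeries σ R →ₐ[R] MvPowerSeries σ R}
    (h : ∀ n, Cong w n (α (n + 1)) (α n)) {m n : ℕ} (hmn : m ≤ n) : Cong w m (α n) (α m) := by
  induction n, hmn using Nat.le_induction with
  | base => exact Cong.refl _ _ _
  | succ n hn ih => exact ((h n).mono hn).trans ih

lemma exists_forall_cong {α : ℕ → MvPowerSeries σ R →ₐ[R] MvPowerSeries σ R}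
    (h : ∀ n, Cong w n (α (n + 1)) (α n)) :
    ∃ β : MvPowerSeries σ R →ₐ[R] MvPowerSeries σ R, ∀ n, Cong w n β (α n) := by
  have hstep : ∀ f n, α (n + 1) f - α n f ∈ weightIdeal w n := fun f n => by
    simpa using h n (mem_weightIdeal_zero f)
  choose b hb using fun f =>
    exists_forall_sub_mem_weightIdeal (w := w) (f := fun n => α n f) (hstep f)
  have hb' : ∀ f c, (∀ N, c - α N f ∈ weightIdeal w N) → b f = c := fun f c hc =>
    eq_of_forall_sub_mem_weightIdeal (w := w) fun N => by
      simpa only [sub_sub_sub_cancel_right] using sub_mem (hb f N) (hc N)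
  let β : MvPowerSeries σ R →ₐ[R] MvPowerSeries σ R :=
    { toFun := b
      map_one' := hb' _ _ fun N => by simp
      map_zero' := hb' _ _ fun N => by simp
      map_mul' := fun f g => hb' _ _ fun N => by
        rw [map_mul, show b f * b g - α N f * α N g =
          (b f - α N f) * b g + α N f * (b g - α N g) by ring]
        exact add_mem (Ideal.mul_mem_right _ _ (hb f N)) (Ideal.mul_mem_left _ _ (hb g N))
      map_add' := fun f g => hb' _ _ fun N => by
        rw [map_add, add_sub_add_comm]; exact add_mem (hb f N) (hb g N)
      commutes' := fun r => hb' _ _ fun N => by simp }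
  refine ⟨β, fun n m f hf => ?_⟩
  have hβ : β f - α (m + n) f ∈ weightIdeal w (m + n) := hb f (m + n)
  simpa only [sub_add_sub_cancel] using add_mem hβ (cong_of_le h (Nat.le_add_left n m) hf)

end FilteredEndomorphisms

/-! ### Exponentials of operators that raise the order -/

section Exponential

variable {σ K : Type*} [Field K] {w : σ → ℕ} {k m n : ℕ}
  {D E : Module.End K (MvPowerSeries σ K)} {f g : MvPowerSeries σ K}

lemma smul_mem_weightIdeal (c : K) (hf : f ∈ weightIdeal w n) : c • f ∈ weightIdeal w n := by
  rw [smul_eq_C_mul]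
  exact Ideal.mul_mem_left _ _ hf

lemma RaisesOrder.mono (hD : RaisesOrder w k D) (h : m ≤ k) : RaisesOrder w m D :=
  fun _ _ hf => mem_weightIdeal_of_le (hD hf) (by omega)

lemma RaisesOrder.add (hD : RaisesOrder w k D) (hE : RaisesOrder w k E) :
    RaisesOrder w k (D + E : Module.End K (MvPowerSeries σ K)) :=
  fun _ _ hf => add_mem (hD hf) (hE hf)

lemma RaisesOrder.pow (hD : RaisesOrder w k D) (j : ℕ) :
    RaisesOrder w (j * k) (D ^ j : Module.End K (MvPowerSeries σ K)) := fun n f hf => by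
  induction j with
  | zero => simpa using hf
  | succ j ih =>
    rw [pow_succ', Module.End.mul_apply]
    exact mem_weightIdeal_of_le (hD ih) (by rw [Nat.succ_mul]; omega)

/-- The divided power `D^k / k!` of an operator. -/
def dividedPow (k : ℕ) (D : Module.End K (MvPowerSeries σ K)) :
    Module.End K (MvPowerSeries σ K) :=
  (k.factorial : K)⁻¹ • D ^ k

/-- The partial sums of the exponential series of an operator. -/
def expSum (N : ℕ) (D : Module.End K (MvPowerSeries σ K)) :
    Module.End K (MvPowerSeries σ K) :=
  ∑ k ∈ Finset.range N, dividedPow k D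

/-- The exponential of an operator, summed coefficient by coefficient. It has its intended meaning
for operators that raise the order. -/
def expOp (D : Module.End K (MvPowerSeries σ K)) (f : MvPowerSeries σ K) : MvPowerSeries σ K :=
  fun d => ∑ᶠ k, coeff d (dividedPow k D f)

@[simp] lemma dividedPow_zero (D : Module.End K (MvPowerSeries σ K)) : dividedPow 0 D = 1 := by
  simp [dividedPow]

@[simp] lemma dividedPow_one (D : Module.End K (MvPowerSeries σ K)) : dividedPow 1 D = D := by
  simp [dividedPow]

lemma expSum_apply (N : ℕ) (D : Module.End K (MvPowerSeries σ K)) (f : MvPowerSeries σ K) :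
    expSum N D f = ∑ k ∈ Finset.range N, dividedPow k D f :=
  LinearMap.sum_apply _ _ _

lemma RaisesOrder.dividedPow (hD : RaisesOrder w k D) (j : ℕ) :
    RaisesOrder w (j * k) (dividedPow j D) :=
  fun _ _ hf => smul_mem_weightIdeal _ (hD.pow j hf)

lemma map_dividedPow (α : Module.End K (MvPowerSeries σ K)) (h : ∀ f, α (D f) = E (α f)) (k : ℕ)
    (f : MvPowerSeries σ K) : α (dividedPow k D f) = dividedPow k E (α f) := by
  have hpow : α ((D ^ k) f) = (E ^ k) (α f) := by
    induction k with
    | zero => rfl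
    | succ k ih => rw [pow_succ', pow_succ', Module.End.mul_apply, Module.End.mul_apply, h, ih]
  simp only [dividedPow, LinearMap.smul_apply, map_smul, hpow]

lemma expOp_sub_expSum_mem (hD : RaisesOrder w k D) (hf : f ∈ weightIdeal w n) (N : ℕ) :
    expOp D f - expSum N D f ∈ weightIdeal w (n + N * k) := by
  refine mem_weightIdeal_iff.2 fun d hd => ?_
  have hzero : ∀ j, N ≤ j → coeff d (dividedPow j D f) = 0 := fun j hj =>
    mem_weightIdeal_iff.1 (hD.dividedPow j hf) d (hd.trans_le (by gcongr))
  have hsum : coeff d (expOp D f) = ∑ j ∈ Finset.range N, coeff d (dividedPow j D f) := by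
    refine finsum_eq_sum_of_support_subset _ fun j hj => ?_
    rw [Finset.coe_range, Set.mem_Iio]
    by_contra hlt
    exact hj (hzero j (not_lt.1 hlt))
  rw [map_sub, hsum, expSum_apply, map_sum, sub_self]

lemma expOp_sub_self_mem (hD : RaisesOrder w k D) (hf : f ∈ weightIdeal w n) :
    expOp D f - f ∈ weightIdeal w (n + k) := by
  simpa [expSum_apply] using expOp_sub_expSum_mem hD hf 1

lemma expOp_sub_self_sub_mem (hD : RaisesOrder w k D) (hf : f ∈ weightIdeal w n) :
    expOp D f - f - D f ∈ weightIdeal w (n + 2 * k) := by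
  simpa [expSum_apply, Finset.sum_range_succ, sub_add_eq_sub_sub] using
    expOp_sub_expSum_mem hD hf 2

lemma RaisesOrder.expOp_mem (hD : RaisesOrder w k D) (hf : f ∈ weightIdeal w n) :
    expOp D f ∈ weightIdeal w n := by
  simpa using add_mem (mem_weightIdeal_of_le (expOp_sub_self_mem hD hf) (Nat.le_add_right n k)) hf

lemma expOp_eq_of_forall (hD : RaisesOrder w 1 D) (r : ℕ)
    (h : ∀ N, g - expSum N D f ∈ weightIdeal w (N - r)) : expOp D f = g := by
  refine eq_of_forall_sub_mem_weightIdeal (w := w) fun N => ?_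
  have hexp := expOp_sub_expSum_mem hD (mem_weightIdeal_zero f) (N + r)
  have hg := h (N + r)
  rw [← sub_sub_sub_cancel_right _ _ (expSum (N + r) D f)]
  exact sub_mem (mem_weightIdeal_of_le hexp (by omega)) (mem_weightIdeal_of_le hg (by omega))

lemma expOp_apply_of_apply_eq_zero (h : D f = 0) : expOp D f = f := by
  ext d
  refine (finsum_eq_single _ 0 fun j hj => ?_).trans (by simp)
  obtain ⟨i, rfl⟩ := Nat.exists_eq_succ_of_ne_zero hj
  simp [dividedPow, pow_succ, h]

lemma map_expOp {α : Module.End K (MvPowerSeries σ K)} (hα : RaisesOrder w 0 α)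
    (hD : RaisesOrder w 1 D) (hE : RaisesOrder w 1 E) (h : ∀ f, α (D f) = E (α f))
    (f : MvPowerSeries σ K) : α (expOp D f) = expOp E (α f) := by
  refine (expOp_eq_of_forall hE 0 fun N => ?_).symm
  have hsum : expSum N E (α f) = α (expSum N D f) := by
    simp only [expSum_apply, map_sum, map_dividedPow α h]
  rw [hsum, ← map_sub]
  simpa using hα (expOp_sub_expSum_mem hD (mem_weightIdeal_zero f) N)

lemma expOp_add (hD : RaisesOrder w 1 D) (f g : MvPowerSeries σ K) :
    expOp D (f + g) = expOp D f + expOp D g := by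
  refine expOp_eq_of_forall hD 0 fun N => ?_
  rw [map_add, add_sub_add_comm]
  simpa using add_mem (expOp_sub_expSum_mem hD (mem_weightIdeal_zero f) N)
    (expOp_sub_expSum_mem hD (mem_weightIdeal_zero g) N)

lemma dividedPow_add_sub_mem (hD : RaisesOrder w 1 D) (hE : RaisesOrder w k E) (hk : 1 ≤ k)
    (hf : f ∈ weightIdeal w n) (j : ℕ) :
    dividedPow (j + 1) (D + E) f - dividedPow (j + 1) D f ∈ weightIdeal w (n + k + j) := by
  have hpow : ((D + E) ^ (j + 1)) f - (D ^ (j + 1)) f ∈ weightIdeal w (n + k + j) := by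
    induction j with
    | zero => simpa using hE hf
    | succ j ih =>
      have hsplit : ((D + E) ^ (j + 2)) f - (D ^ (j + 2)) f =
          (D + E) (((D + E) ^ (j + 1)) f - (D ^ (j + 1)) f) + E ((D ^ (j + 1)) f) := by
        rw [pow_succ', pow_succ' D, Module.End.mul_apply, Module.End.mul_apply, map_sub,
          LinearMap.add_apply, LinearMap.add_apply]
        abel
      rw [hsplit]
      exact add_mem (hD.add (hE.mono hk) ih)
        (mem_weightIdeal_of_le (hE (hD.pow (j + 1) hf)) (by omega))
  rw [dividedPow, dividedPow, LinearMap.smul_apply, LinearMap.smul_apply, ← smul_sub]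
  exact smul_mem_weightIdeal _ hpow

lemma expOp_add_operator_sub_mem (hD : RaisesOrder w 1 D) (hE : RaisesOrder w k E) (hk : 1 ≤ k)
    (hf : f ∈ weightIdeal w n) :
    expOp (D + E) f - expOp D f - E f ∈ weightIdeal w (n + k + 1) := by
  have hsum : expSum (k + 2) (D + E) f - expSum (k + 2) D f - E f ∈
      weightIdeal w (n + k + 1) := by
    have hsplit : expSum (k + 2) (D + E) f - expSum (k + 2) D f - E f =
        ∑ j ∈ Finset.range k, (dividedPow (j + 2) (D + E) f - dividedPow (j + 2) D f) := by
      simp only [expSum_apply, Finset.sum_range_succ', Finset.sum_sub_distrib, zero_add,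
        dividedPow_zero, dividedPow_one, LinearMap.add_apply]
      abel
    rw [hsplit]
    exact sum_mem fun j _ => mem_weightIdeal_of_le
      (dividedPow_add_sub_mem hD hE hk hf (j + 1)) (by omega)
  have hDE := expOp_sub_expSum_mem (hD.add (hE.mono hk)) hf (k + 2)
  have hD' := expOp_sub_expSum_mem hD hf (k + 2)
  have hsplit : expOp (D + E) f - expOp D f - E f =
      (expOp (D + E) f - expSum (k + 2) (D + E) f) - (expOp D f - expSum (k + 2) D f) +
        (expSum (k + 2) (D + E) f - expSum (k + 2) D f - E f) := by abel
  rw [hsplit]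
  exact add_mem (sub_mem (mem_weightIdeal_of_le hDE (by omega))
    (mem_weightIdeal_of_le hD' (by omega))) hsum

lemma expOp_expOp_sub_mem (hD : RaisesOrder w 1 D) (hE : RaisesOrder w k E) (hk : 1 ≤ k)
    (hf : f ∈ weightIdeal w n) :
    expOp D (expOp E f) - expOp (D + E) f ∈ weightIdeal w (n + k + 1) := by
  have hsplit : expOp D (expOp E f) - expOp (D + E) f =
      expOp D (expOp E f - f - E f) + (expOp D (E f) - E f) -
        (expOp (D + E) f - expOp D f - E f) := by
    have hadd : expOp D (expOp E f) =
        expOp D (expOp E f - f - E f) + expOp D f + expOp D (E f) := by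
      rw [← expOp_add hD, ← expOp_add hD]
      congr 1
      abel
    rw [hadd]
    abel
  rw [hsplit]
  exact sub_mem (add_mem
    (mem_weightIdeal_of_le (hD.expOp_mem (expOp_sub_self_sub_mem hE hf)) (by omega))
    (expOp_sub_self_mem hD (hE hf))) (expOp_add_operator_sub_mem hD hE hk hf)

section CharZero

variable [CharZero K]

lemma apply_dividedPow (D : Module.End K (MvPowerSeries σ K)) (k : ℕ) (f : MvPowerSeries σ K) :
    D (dividedPow k D f) = (k + 1) • dividedPow (k + 1) D f := by
  have hk : ((k + 1 : ℕ) : K) ≠ 0 := Nat.cast_ne_zero.2 k.succ_ne_zero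
  rw [dividedPow, dividedPow, LinearMap.smul_apply, LinearMap.smul_apply, map_smul,
    ← Module.End.mul_apply, ← pow_succ', ← Nat.cast_smul_eq_nsmul K, smul_smul, Nat.factorial_succ,
    Nat.cast_mul, mul_inv, mul_inv_cancel_left₀ hk]

lemma dividedPow_eq_sum_antidiagonal {c : ℕ → ℕ → MvPowerSeries σ K}
    (hc : ∀ i j, D (c i j) = (i + 1) • c (i + 1) j + (j + 1) • c i (j + 1)) (k : ℕ) :
    dividedPow k D (c 0 0) = ∑ p ∈ antidiagonal k, c p.1 p.2 := by
  induction k with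
  | zero => simp
  | succ k ih =>
    have hleft : ∑ p ∈ antidiagonal (k + 1), p.1 • c p.1 p.2 =
        ∑ p ∈ antidiagonal k, (p.1 + 1) • c (p.1 + 1) p.2 := by
      rw [Finset.Nat.sum_antidiagonal_succ]; simp
    have hright : ∑ p ∈ antidiagonal (k + 1), p.2 • c p.1 p.2 =
        ∑ p ∈ antidiagonal k, (p.2 + 1) • c p.1 (p.2 + 1) := by
      rw [Finset.Nat.sum_antidiagonal_succ']; simp
    have htotal : (k + 1) • ∑ p ∈ antidiagonal (k + 1), c p.1 p.2 =
        ∑ p ∈ antidiagonal (k + 1), p.1 • c p.1 p.2 +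
          ∑ p ∈ antidiagonal (k + 1), p.2 • c p.1 p.2 := by
      rw [Finset.smul_sum, ← Finset.sum_add_distrib]
      exact Finset.sum_congr rfl fun p hp => by rw [← add_smul, mem_antidiagonal.1 hp]
    refine smul_right_injective _ (Nat.cast_ne_zero (R := K).2 k.succ_ne_zero) ?_
    simp only [Nat.cast_smul_eq_nsmul]
    rw [← apply_dividedPow, ih, map_sum, Nat.succ_eq_add_one, htotal, hleft, hright,
      ← Finset.sum_add_distrib]
    exact Finset.sum_congr rfl fun p _ => hc _ _

/-- The partial sums of the exponential series are triangular partial sums of the double series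
`c`; they differ from the square ones by terms of high order. -/
lemma expOp_eq_of_doubleSum (hD : RaisesOrder w 1 D) {c : ℕ → ℕ → MvPowerSeries σ K}
    (hf : c 0 0 = f)
    (hc : ∀ i j, D (c i j) = (i + 1) • c (i + 1) j + (j + 1) • c i (j + 1)) (r : ℕ)
    (hmem : ∀ i j, c i j ∈ weightIdeal w (i + j - r))
    (hg : ∀ N, g - ∑ i ∈ Finset.range N, ∑ j ∈ Finset.range N, c i j ∈ weightIdeal w (N - r)) :
    expOp D f = g := by
  subst hf
  refine expOp_eq_of_forall hD r fun N => ?_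
  have htriangle : expSum N D (c 0 0) =
      ∑ i ∈ Finset.range N, ∑ j ∈ Finset.range (N - i), c i j := by
    rw [← Finset.sum_range_diag_flip, expSum_apply]
    refine Finset.sum_congr rfl fun k _ => ?_
    rw [dividedPow_eq_sum_antidiagonal hc, Finset.Nat.sum_antidiagonal_eq_sum_range_succ]
  have hdiff : ∑ i ∈ Finset.range N, ∑ j ∈ Finset.range N, c i j - expSum N D (c 0 0) ∈
      weightIdeal w (N - r) := by
    rw [htriangle, ← Finset.sum_sub_distrib]
    refine sum_mem fun i _ => ?_
    rw [← Finset.sum_range_add_sum_Ico (c i) (Nat.sub_le N i), add_sub_cancel_left]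
    refine sum_mem fun j hj => mem_weightIdeal_of_le (hmem i j) ?_
    have := (Finset.mem_Ico.1 hj).1
    omega
  simpa only [sub_add_sub_cancel] using add_mem (hg N) hdiff

lemma expOp_bilinear (hD : RaisesOrder w 1 D)
    (μ : MvPowerSeries σ K →ₗ[K] MvPowerSeries σ K →ₗ[K] MvPowerSeries σ K)
    (hμ : ∀ f g, D (μ f g) = μ (D f) g + μ f (D g)) {r : ℕ}
    (hmem : ∀ m n f g, f ∈ weightIdeal w m → g ∈ weightIdeal w n →
      μ f g ∈ weightIdeal w (m + n - r)) (f g : MvPowerSeries σ K) :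
    expOp D (μ f g) = μ (expOp D f) (expOp D g) := by
  have hpow : ∀ i f, dividedPow i D f ∈ weightIdeal w i := fun i f => by
    simpa using hD.dividedPow i (mem_weightIdeal_zero f)
  have hexp : ∀ N f, expOp D f - expSum N D f ∈ weightIdeal w N := fun N f => by
    simpa using expOp_sub_expSum_mem hD (mem_weightIdeal_zero f) N
  refine expOp_eq_of_doubleSum (c := fun i j => μ (dividedPow i D f) (dividedPow j D g)) hD
    (by simp) (fun i j => ?_) r (fun i j => hmem _ _ _ _ (hpow i f) (hpow j g)) fun N => ?_
  · simp only [hμ, apply_dividedPow, map_nsmul, LinearMap.smul_apply]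
  · have hsquare : ∑ i ∈ Finset.range N, ∑ j ∈ Finset.range N,
        μ (dividedPow i D f) (dividedPow j D g) = μ (expSum N D f) (expSum N D g) := by
      simp only [expSum_apply, map_sum, LinearMap.sum_apply]
      exact Finset.sum_comm
    have hsplit : μ (expOp D f) (expOp D g) - μ (expSum N D f) (expSum N D g) =
        μ (expOp D f - expSum N D f) (expOp D g) +
          μ (expSum N D f) (expOp D g - expSum N D g) := by
      simp only [map_sub, LinearMap.sub_apply]; abel
    rw [hsquare, hsplit]
    exact add_mem (by simpa using hmem _ _ _ _ (hexp N f) (mem_weightIdeal_zero _))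
      (by simpa using hmem _ _ _ _ (mem_weightIdeal_zero _) (hexp N g))

lemma expOp_add_of_commute (hD : RaisesOrder w 1 D) (hE : RaisesOrder w 1 E) (h : Commute D E)
    (f : MvPowerSeries σ K) : expOp (D + E) f = expOp D (expOp E f) := by
  have hDE : ∀ f, E (D f) = D (E f) := fun f => (LinearMap.congr_fun h.eq f).symm
  refine expOp_eq_of_doubleSum (c := fun i j => dividedPow i D (dividedPow j E f)) (hD.add hE)
    (by simp) (fun i j => ?_) 0 (fun i j => ?_) fun N => ?_
  · rw [LinearMap.add_apply, apply_dividedPow, map_dividedPow E hDE, apply_dividedPow, map_nsmul]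
  · exact mem_weightIdeal_of_le
      (hD.dividedPow i (hE.dividedPow j (mem_weightIdeal_zero f))) (by omega)
  · have hsquare : ∑ i ∈ Finset.range N, ∑ j ∈ Finset.range N, dividedPow i D (dividedPow j E f) =
        expSum N D (expSum N E f) := by
      simp only [expSum_apply, map_sum]
      exact Finset.sum_comm
    have hsplit : expOp D (expOp E f) - expSum N D (expSum N E f) =
        expOp D (expOp E f - expSum N E f) +
          (expOp D (expSum N E f) - expSum N D (expSum N E f)) := by
      rw [← add_sub_assoc, ← expOp_add hD, sub_add_cancel]
    rw [hsquare, hsplit]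
    have hexpE := expOp_sub_expSum_mem hE (mem_weightIdeal_zero f) N
    have hexpD := expOp_sub_expSum_mem hD (mem_weightIdeal_zero (expSum N E f)) N
    exact add_mem (mem_weightIdeal_of_le (hD.expOp_mem hexpE) (by omega))
      (mem_weightIdeal_of_le hexpD (by omega))

/-- The exponential of a derivation that raises the order, as an endomorphism of the algebra of
power series. -/
def expHom (D : Derivation K (MvPowerSeries σ K) (MvPowerSeries σ K)) (hD : RaisesOrder w 1 D) :
    MvPowerSeries σ K →ₐ[K] MvPowerSeries σ K :=
  have hD' : RaisesOrder w 1 (D : Module.End K (MvPowerSeries σ K)) := hD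
  { toFun := expOp (D : Module.End K (MvPowerSeries σ K))
    map_one' := expOp_apply_of_apply_eq_zero D.map_one_eq_zero
    map_zero' := expOp_apply_of_apply_eq_zero (map_zero D)
    map_mul' := expOp_bilinear (r := 0) hD' (LinearMap.mul K (MvPowerSeries σ K))
      (fun f g => by simp [mul_comm, add_comm]) fun _ _ _ _ => mul_mem_weightIdeal
    map_add' := expOp_add hD'
    commutes' := fun r => expOp_apply_of_apply_eq_zero (D.map_algebraMap r) }

lemma expHom_apply (D : Derivation K (MvPowerSeries σ K) (MvPowerSeries σ K))
    (hD : RaisesOrder w 1 D) (f : MvPowerSeries σ K) :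
    expHom D hD f = expOp (D : Module.End K (MvPowerSeries σ K)) f := rfl

end CharZero

end Exponential

/-! ### Coefficients of families -/

section Coefficients

variable {k l m k' l' m' n : ℕ} {f : FSeries}

@[simp] lemma expo_apply_zero (k l m : ℕ) : expo k l m 0 = k := rfl
@[simp] lemma expo_apply_one (k l m : ℕ) : expo k l m 1 = l := rfl
@[simp] lemma expo_apply_two (k l m : ℕ) : expo k l m 2 = m := rfl

lemma expo_eta (d : Fin 3 →₀ ℕ) : expo (d 0) (d 1) (d 2) = d := by
  ext i; fin_cases i <;> rfl

lemma expo_zero : expo 0 0 0 = 0 := expo_eta 0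

lemma expo_add_expo : expo k l m + expo k' l' m' = expo (k + k') (l + l') (m + m') := by
  ext i; fin_cases i <;> rfl

lemma expo_inj : expo k l m = expo k' l' m' ↔ k = k' ∧ l = l' ∧ m = m' := by
  refine ⟨fun h => ⟨?_, ?_, ?_⟩, ?_⟩
  · simpa using DFunLike.congr_fun h 0
  · simpa using DFunLike.congr_fun h 1
  · simpa using DFunLike.congr_fun h 2
  · rintro ⟨rfl, rfl, rfl⟩; rfl

lemma single_zero_eq_expo (n : ℕ) : Finsupp.single 0 n = expo n 0 0 := by
  ext i; fin_cases i <;> simp [expo]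

lemma single_one_eq_expo (n : ℕ) : Finsupp.single 1 n = expo 0 n 0 := by
  ext i; fin_cases i <;> simp [expo]

lemma single_two_eq_expo (n : ℕ) : Finsupp.single 2 n = expo 0 0 n := by
  ext i; fin_cases i <;> simp [expo]

lemma series_ext {f g : FSeries} (h : ∀ k l m, coeff (expo k l m) f = coeff (expo k l m) g) :
    f = g := by
  ext d
  rw [← expo_eta d]
  exact h _ _ _

/-- The series `∑ c k l m x^k y^l ε^m`. -/
def ofCoeffs (c : ℕ → ℕ → ℕ → ℝ) : FSeries := fun d => c (d 0) (d 1) (d 2)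

@[simp] lemma coeff_ofCoeffs (c : ℕ → ℕ → ℕ → ℝ) (k l m : ℕ) :
    coeff (expo k l m) (ofCoeffs c) = c k l m := rfl

lemma coeff_pderiv_zero (f : FSeries) (k l m : ℕ) :
    coeff (expo k l m) (pderiv ℝ 0 f) = coeff (expo (k + 1) l m) f * (k + 1) := by
  rw [coeff_pderiv, single_zero_eq_expo, expo_add_expo, expo_apply_zero, add_zero, add_zero]

lemma coeff_pderiv_one (f : FSeries) (k l m : ℕ) :
    coeff (expo k l m) (pderiv ℝ 1 f) = coeff (expo k (l + 1) m) f * (l + 1) := by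
  rw [coeff_pderiv, single_one_eq_expo, expo_add_expo, expo_apply_one, add_zero, add_zero]

lemma coeff_monomial_mul_expo (i j n : ℕ) (a : ℝ) (f : FSeries) (k l m : ℕ) :
    coeff (expo k l m) (monomial (expo i j n) a * f) =
      if i ≤ k ∧ j ≤ l ∧ n ≤ m then a * coeff (expo (k - i) (l - j) (m - n)) f else 0 := by
  classical
  have hle : expo i j n ≤ expo k l m ↔ i ≤ k ∧ j ≤ l ∧ n ≤ m := by
    simp [Finsupp.le_def, Fin.forall_fin_succ, expo]
  have hsub : expo k l m - expo i j n = expo (k - i) (l - j) (m - n) := by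
    ext p; fin_cases p <;> rfl
  rw [coeff_monomial_mul, hsub]
  simp only [hle]

lemma X_zero_eq_monomial : (X 0 : FSeries) = monomial (expo 1 0 0) 1 := by
  rw [X_def, single_zero_eq_expo]

lemma X_one_eq_monomial : (X 1 : FSeries) = monomial (expo 0 1 0) 1 := by
  rw [X_def, single_one_eq_expo]

/-- The orders of `x`, `y` and `ε`. -/
abbrev famWeight : Fin 3 → ℕ := ![1, 1, 3]

/-- The ideal of series all of whose monomials have order at least `n`. -/
abbrev ordIdeal (n : ℕ) : Ideal FSeries := weightIdeal famWeight n

lemma famWeight_ne_zero : ∀ i, famWeight i ≠ 0 := by decide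

lemma weight_famWeight (d : Fin 3 →₀ ℕ) : Finsupp.weight famWeight d = d 0 + d 1 + 3 * d 2 := by
  simp [Finsupp.weight_eq_sum, Fin.sum_univ_three, mul_comm]

lemma mem_ordIdeal_iff :
    f ∈ ordIdeal n ↔ ∀ k l m, k + l + 3 * m < n → coeff (expo k l m) f = 0 := by
  simp only [mem_weightIdeal_iff, weight_famWeight]
  refine ⟨fun h k l m hd => h _ hd, fun h d hd => ?_⟩
  rw [← expo_eta d]
  exact h _ _ _ hd

lemma orderAtLeastThree_iff {h : FSeries} : OrderAtLeastThree h ↔ h ∈ ordIdeal 3 := by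
  simp only [mem_weightIdeal_iff, weight_famWeight, OrderAtLeastThree, ← not_lt, not_imp_not]

lemma monomial_expo_mem (k l m : ℕ) (a : ℝ) :
    (monomial (expo k l m) a : FSeries) ∈ ordIdeal (k + l + 3 * m) := by
  simpa only [weight_famWeight, expo_apply_zero, expo_apply_one, expo_apply_two] using
    monomial_mem_weightIdeal (w := famWeight) (expo k l m) a

lemma X_zero_mem : (X 0 : FSeries) ∈ ordIdeal 1 := X_mem_weightIdeal 0
lemma X_one_mem : (X 1 : FSeries) ∈ ordIdeal 1 := X_mem_weightIdeal 1
lemma X_two_mem : (X 2 : FSeries) ∈ ordIdeal 3 := X_mem_weightIdeal 2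

lemma pderiv_zero_mem (hf : f ∈ ordIdeal n) : pderiv ℝ 0 f ∈ ordIdeal (n - 1) :=
  pderiv_mem_weightIdeal 0 hf

lemma pderiv_one_mem (hf : f ∈ ordIdeal n) : pderiv ℝ 1 f ∈ ordIdeal (n - 1) :=
  pderiv_mem_weightIdeal 1 hf

end Coefficients

/-! ### The Poisson bracket -/

section PoissonBracket

variable {k m n : ℕ} {f g h : FSeries}

lemma pderiv_comm (f : FSeries) :
    pderiv ℝ 0 (pderiv ℝ 1 f) = pderiv ℝ 1 (pderiv ℝ 0 f) := by
  refine series_ext fun k l m => ?_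
  simp only [coeff_pderiv_zero, coeff_pderiv_one]
  ring

/-- The Poisson bracket as a bilinear map. -/
def bracketBilin : FSeries →ₗ[ℝ] FSeries →ₗ[ℝ] FSeries :=
  LinearMap.mk₂ ℝ bracket
    (fun f g h => by simp only [bracket, map_add]; ring)
    (fun r f g => by simp only [bracket, Derivation.map_smul, smul_mul_assoc, smul_sub])
    (fun f g h => by simp only [bracket, map_add]; ring)
    (fun r f g => by simp only [bracket, Derivation.map_smul, mul_smul_comm, smul_sub])

lemma bracket_sub_left (f g h : FSeries) : bracket (f - g) h = bracket f h - bracket g h :=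
  LinearMap.map_sub₂ bracketBilin f g h

lemma bracket_sub_right (f g h : FSeries) : bracket f (g - h) = bracket f g - bracket f h :=
  map_sub (bracketBilin f) g h

lemma bracket_antisymm (f g : FSeries) : bracket f g = -bracket g f := by
  simp only [bracket]; ring

lemma bracket_self (f : FSeries) : bracket f f = 0 := by
  simp only [bracket]; ring

lemma bracket_X_zero (h : FSeries) : bracket (X 0) h = pderiv ℝ 1 h := by
  simp [bracket, pderiv_X_of_ne (show (0 : Fin 3) ≠ 1 by decide)]

lemma bracket_X_one (h : FSeries) : bracket (X 1) h = -pderiv ℝ 0 h := by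
  simp [bracket, pderiv_X_of_ne (show (1 : Fin 3) ≠ 0 by decide)]

lemma bracket_X_two (h : FSeries) : bracket (X 2) h = 0 := by
  simp [bracket, pderiv_X_of_ne (show (2 : Fin 3) ≠ 0 by decide),
    pderiv_X_of_ne (show (2 : Fin 3) ≠ 1 by decide)]

lemma bracket_mem (hf : f ∈ ordIdeal m) (hg : g ∈ ordIdeal n) :
    bracket f g ∈ ordIdeal (m + n - 2) :=
  sub_mem
    (mem_weightIdeal_of_le (mul_mem_weightIdeal (pderiv_zero_mem hf) (pderiv_one_mem hg))
      (by omega))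
    (mem_weightIdeal_of_le (mul_mem_weightIdeal (pderiv_one_mem hf) (pderiv_zero_mem hg))
      (by omega))

/-- The derivation `f ↦ {f, h}` along the Hamiltonian vector field of `h`. -/
def hamDer (h : FSeries) : Derivation ℝ FSeries FSeries :=
  pderiv ℝ 1 h • pderiv ℝ 0 - pderiv ℝ 0 h • pderiv ℝ 1

lemma hamDer_apply (h f : FSeries) : hamDer h f = bracket f h := by
  simp only [hamDer, Derivation.sub_apply, Derivation.smul_apply, smul_eq_mul, bracket]
  ring

lemma lieD_eq_hamDer (h : FSeries) : lieD h = hamDer h := funext fun f => (hamDer_apply h f).symm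

lemma hamDer_add (g h : FSeries) : hamDer (g + h) = hamDer g + hamDer h := by
  simp only [hamDer, map_add, add_smul]
  abel

lemma hamDer_smul (r : ℝ) (h : FSeries) : hamDer (r • h) = r • hamDer h := by
  simp only [hamDer, Derivation.map_smul, smul_assoc, smul_sub]

lemma hamDer_bracket (h f g : FSeries) :
    hamDer h (bracket f g) = bracket (hamDer h f) g + bracket f (hamDer h g) := by
  simp only [hamDer_apply, bracket, Derivation.leibniz, smul_eq_mul, map_sub, pderiv_comm]
  ring

lemma raisesOrder_hamDer (hh : h ∈ ordIdeal (k + 2)) : RaisesOrder famWeight k (hamDer h) :=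
  fun n f hf => by
    rw [hamDer_apply]
    exact mem_weightIdeal_of_le (bracket_mem hf hh) (by omega)

end PoissonBracket

/-! ### Canonical automorphisms -/

section CanonicalAutomorphisms

/-- The endomorphisms of the algebra of series in `x`, `y`, `ε`; families of maps act by
pull-back. -/
abbrev SeriesEnd := FSeries →ₐ[ℝ] FSeries

/-- The endomorphisms that come from families of maps: they respect the weight filtration and fix
the parameter. -/
structure IsFamilyEnd (α : SeriesEnd) : Prop extends IsFiltered famWeight α where
  X_two : α (X 2) = X 2

variable {k : ℕ} {s t : ℝ} {α β : SeriesEnd}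

lemma IsFamilyEnd.one : IsFamilyEnd 1 := ⟨⟨fun _ _ h => h⟩, rfl⟩

lemma IsFamilyEnd.mul (hα : IsFamilyEnd α) (hβ : IsFamilyEnd β) : IsFamilyEnd (α * β) :=
  ⟨⟨fun _ _ h => hα.mem (hβ.mem h)⟩, by rw [AlgHom.mul_apply, hβ.X_two, hα.X_two]⟩

lemma isFamilyEnd_of_X (h0 : α (X 0) ∈ ordIdeal 1) (h1 : α (X 1) ∈ ordIdeal 1)
    (h2 : α (X 2) = X 2) : IsFamilyEnd α :=
  ⟨isFiltered_of_X famWeight_ne_zero (Fin.forall_fin_succ.2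
    ⟨h0, Fin.forall_fin_succ.2 ⟨h1, Fin.forall_fin_one.2 (h2.symm ▸ X_two_mem)⟩⟩), h2⟩

lemma IsFamilyEnd.cong_of_X (hα : IsFamilyEnd α) (hβ : IsFamilyEnd β)
    (h0 : α (X 0) - β (X 0) ∈ ordIdeal (1 + k)) (h1 : α (X 1) - β (X 1) ∈ ordIdeal (1 + k)) :
    Cong famWeight k α β :=
  ReversingMaps.cong_of_X famWeight_ne_zero hα.toIsFiltered hβ.toIsFiltered (Fin.forall_fin_succ.2
    ⟨h0, Fin.forall_fin_succ.2 ⟨h1, Fin.forall_fin_one.2 (by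
      change α (X 2) - β (X 2) ∈ _
      simp [hα.X_two, hβ.X_two])⟩⟩)

lemma IsFamilyEnd.eq_of_X (hα : IsFamilyEnd α) (hβ : IsFamilyEnd β) (h0 : α (X 0) = β (X 0))
    (h1 : α (X 1) = β (X 1)) : α = β :=
  eq_of_forall_cong fun _ => hα.cong_of_X hβ (by simp [h0]) (by simp [h1])

/-- `α` multiplies the Poisson bracket by the constant `s`. -/
def ScalesBracket (s : ℝ) (α : SeriesEnd) : Prop :=
  ∀ f g, bracket (α f) (α g) = s • α (bracket f g)

lemma ScalesBracket.mul (hα : ScalesBracket s α) (hβ : ScalesBracket t β) :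
    ScalesBracket (s * t) (α * β) := fun f g => by
  simp only [AlgHom.mul_apply, hα (β f), hβ f, map_smul, smul_smul]

lemma ScalesBracket.of_cong {α : ℕ → SeriesEnd} (hα : ∀ n, ScalesBracket s (α n))
    (h : ∀ n, Cong famWeight n β (α n)) : ScalesBracket s β := by
  refine fun f g => eq_of_forall_sub_mem_weightIdeal (w := famWeight) fun n => ?_
  have hlim : ∀ p, β p - α (n + 2) p ∈ ordIdeal (n + 2) := fun p => by
    simpa using h (n + 2) (mem_weightIdeal_zero p)
  have hsplit : bracket (β f) (β g) - s • β (bracket f g) =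
      bracket (β f - α (n + 2) f) (β g) + bracket (α (n + 2) f) (β g - α (n + 2) g)
        - s • (β (bracket f g) - α (n + 2) (bracket f g)) := by
    rw [bracket_sub_left, bracket_sub_right, hα (n + 2) f g, smul_sub]; ring
  rw [hsplit]
  refine sub_mem (add_mem ?_ ?_)
    (smul_mem_weightIdeal _ (mem_weightIdeal_of_le (hlim _) (by omega)))
  · simpa using bracket_mem (hlim f) (mem_weightIdeal_zero (β g))
  · simpa using bracket_mem (mem_weightIdeal_zero (α (n + 2) f)) (hlim g)

/-- The automorphisms induced by canonical changes of variables. -/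
structure IsCanonicalAut (β : SeriesEndˣ) : Prop where
  isFamilyEnd : IsFamilyEnd (β : SeriesEnd)
  isFamilyEnd_inv : IsFamilyEnd (↑β⁻¹ : SeriesEnd)
  scalesBracket : ScalesBracket 1 (β : SeriesEnd)

lemma units_inv_apply (β : SeriesEndˣ) (f : FSeries) :
    (↑β⁻¹ : SeriesEnd) ((β : SeriesEnd) f) = f := by
  rw [← AlgHom.mul_apply, Units.inv_mul, AlgHom.one_apply]

lemma units_apply_inv (β : SeriesEndˣ) (f : FSeries) :
    (β : SeriesEnd) ((↑β⁻¹ : SeriesEnd) f) = f :=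
  units_inv_apply β⁻¹ f

lemma IsCanonicalAut.map_bracket {β : SeriesEndˣ} (h : IsCanonicalAut β) (f g : FSeries) :
    (β : SeriesEnd) (bracket f g) = bracket ((β : SeriesEnd) f) ((β : SeriesEnd) g) := by
  rw [h.scalesBracket, one_smul]

lemma IsCanonicalAut.one : IsCanonicalAut 1 :=
  ⟨IsFamilyEnd.one, by simpa using IsFamilyEnd.one, fun f g => by simp⟩

lemma IsCanonicalAut.inv {β : SeriesEndˣ} (h : IsCanonicalAut β) : IsCanonicalAut β⁻¹ := by
  refine ⟨h.isFamilyEnd_inv, by simpa using h.isFamilyEnd, fun f g => ?_⟩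
  rw [one_smul, ← units_inv_apply β (bracket _ _), h.map_bracket, units_apply_inv, units_apply_inv]

lemma IsCanonicalAut.mul {α β : SeriesEndˣ} (hα : IsCanonicalAut α) (hβ : IsCanonicalAut β) :
    IsCanonicalAut (α * β) where
  isFamilyEnd := hα.isFamilyEnd.mul hβ.isFamilyEnd
  isFamilyEnd_inv := by
    rw [mul_inv_rev]
    exact hβ.isFamilyEnd_inv.mul hα.isFamilyEnd_inv
  scalesBracket := by
    simpa only [one_mul, Units.val_mul] using hα.scalesBracket.mul hβ.scalesBracket

lemma Cong.inv {α β : SeriesEndˣ} (hα : IsCanonicalAut α) (hβ : IsCanonicalAut β)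
    (h : Cong famWeight k (α : SeriesEnd) β) : Cong famWeight k (↑α⁻¹ : SeriesEnd) ↑β⁻¹ := by
  simpa [mul_assoc] using (h.symm.mul_left hα.isFamilyEnd_inv.toIsFiltered).mul_right
    hβ.isFamilyEnd_inv.toIsFiltered

lemma IsFamilyEnd.of_cong {α : ℕ → SeriesEnd} (hα : ∀ n, IsFamilyEnd (α n))
    (h : ∀ n, Cong famWeight n β (α n)) : IsFamilyEnd β where
  toIsFiltered := (h 0).isFiltered (hα 0).toIsFiltered
  X_two := eq_of_forall_sub_mem_weightIdeal fun n => by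
    simpa [(hα n).X_two] using h n (mem_weightIdeal_zero (X 2))

lemma exists_isCanonicalAut_forall_cong {α : ℕ → SeriesEndˣ} (hα : ∀ n, IsCanonicalAut (α n))
    (h : ∀ n, Cong famWeight n (α (n + 1) : SeriesEnd) (α n)) :
    ∃ β : SeriesEndˣ, IsCanonicalAut β ∧ ∀ n, Cong famWeight n (β : SeriesEnd) (α n) := by
  obtain ⟨β, hlim⟩ := exists_forall_cong (α := fun n => (α n : SeriesEnd)) h
  obtain ⟨γ, hlim'⟩ := exists_forall_cong (α := fun n => (↑(α n)⁻¹ : SeriesEnd))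
    fun n => Cong.inv (hα (n + 1)) (hα n) (h n)
  have hβ : IsFamilyEnd β := .of_cong (fun n => (hα n).isFamilyEnd) hlim
  have hγ : IsFamilyEnd γ := .of_cong (fun n => (hα n).isFamilyEnd_inv) hlim'
  have hβγ : β * γ = 1 := eq_of_forall_cong (w := famWeight) fun k => by
    simpa using (hlim k).mul (hlim' k) (hα k).isFamilyEnd.toIsFiltered hγ.toIsFiltered
  have hγβ : γ * β = 1 := eq_of_forall_cong (w := famWeight) fun k => by
    simpa using (hlim' k).mul (hlim k) (hα k).isFamilyEnd_inv.toIsFiltered hβ.toIsFiltered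
  exact ⟨⟨β, γ, hβγ, hγβ⟩, ⟨hβ, hγ, .of_cong (fun n => (hα n).scalesBracket) hlim⟩, hlim⟩

end CanonicalAutomorphisms

/-! ### Flows -/

section Flow

variable {k n : ℕ} {s t : ℝ} {a b f h : FSeries} {α : SeriesEnd}

open Classical in
/-- The pull-back `exp(L_h)` by the time-one map of the Hamiltonian `h`; it is the identity, by
convention, if `h` has terms of order less than three. -/
def flow (h : FSeries) : SeriesEnd :=
  if hh : h ∈ ordIdeal 3 then expHom (hamDer h) (raisesOrder_hamDer hh) else 1

lemma flow_apply (hh : h ∈ ordIdeal 3) (f : FSeries) : flow h f = expOp ↑(hamDer h) f := by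
  rw [flow, dif_pos hh, expHom_apply]

lemma expLie_eq_flow (hh : h ∈ ordIdeal 3) (f : FSeries) : expLie h f = flow h f := by
  ext d
  rw [flow_apply hh]
  refine finsum_congr fun k => ?_
  rw [dividedPow, LinearMap.smul_apply, map_smul, Module.End.pow_apply, lieD_eq_hamDer]
  rfl

lemma flow_apply_of_bracket_eq_zero (h0 : bracket f h = 0) : flow h f = f := by
  by_cases hh : h ∈ ordIdeal 3
  · rw [flow_apply hh]
    exact expOp_apply_of_apply_eq_zero ((hamDer_apply h f).trans h0)
  · rw [flow, dif_neg hh, AlgHom.one_apply]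

@[simp] lemma flow_zero : flow 0 = 1 := by
  ext1 f
  exact flow_apply_of_bracket_eq_zero (by simp [bracket])

lemma cong_flow_one (hk : 1 ≤ k) (hh : h ∈ ordIdeal (k + 2)) : Cong famWeight k (flow h) 1 :=
  fun n f hf => by
    change flow h f - f ∈ ordIdeal (n + k)
    rw [flow_apply (mem_weightIdeal_of_le hh (by omega))]
    exact expOp_sub_self_mem (raisesOrder_hamDer hh) hf

lemma flow_sub_sub_bracket_mem (hk : 1 ≤ k) (hh : h ∈ ordIdeal (k + 2)) (hf : f ∈ ordIdeal n) :
    flow h f - f - bracket f h ∈ ordIdeal (n + 2 * k) := by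
  rw [flow_apply (mem_weightIdeal_of_le hh (by omega)), ← hamDer_apply]
  exact expOp_sub_self_sub_mem (raisesOrder_hamDer hh) hf

lemma isFamilyEnd_flow (h : FSeries) : IsFamilyEnd (flow h) := by
  refine ⟨?_, flow_apply_of_bracket_eq_zero (bracket_X_two h)⟩
  by_cases hh : h ∈ ordIdeal 3
  · exact (cong_flow_one le_rfl hh).isFiltered IsFamilyEnd.one.toIsFiltered
  · rw [flow, dif_neg hh]
    exact IsFamilyEnd.one.toIsFiltered

lemma flow_add_sub_sub_bracket_mem (hk : 1 ≤ k) (ha : a ∈ ordIdeal 3) (hb : b ∈ ordIdeal (k + 2))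
    (hf : f ∈ ordIdeal n) :
    flow (a + b) f - flow a f - bracket f b ∈ ordIdeal (n + k + 1) := by
  rw [flow_apply (add_mem ha (mem_weightIdeal_of_le hb (by omega))), flow_apply ha, hamDer_add,
    ← hamDer_apply]
  exact expOp_add_operator_sub_mem (raisesOrder_hamDer (k := 1) ha) (raisesOrder_hamDer hb) hk hf

lemma scalesBracket_flow (h : FSeries) : ScalesBracket 1 (flow h) := fun f g => by
  rw [one_smul]
  by_cases hh : h ∈ ordIdeal 3
  · simp only [flow_apply hh]
    exact (expOp_bilinear (raisesOrder_hamDer hh) bracketBilin (hamDer_bracket h)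
      (fun _ _ _ _ => bracket_mem) f g).symm
  · simp [flow, dif_neg hh]

lemma flow_smul_mul_flow_smul (hh : h ∈ ordIdeal 3) (s t : ℝ) :
    flow (s • h) * flow (t • h) = flow ((s + t) • h) := by
  have hcomm : Commute (s • (hamDer h : Module.End ℝ FSeries)) (t • ↑(hamDer h)) :=
    ((Commute.refl _).smul_left s).smul_right t
  have hmem : ∀ r : ℝ, r • h ∈ ordIdeal 3 := fun r => smul_mem_weightIdeal r hh
  have hraise : ∀ r : ℝ, RaisesOrder famWeight 1 (r • (hamDer h : Module.End ℝ FSeries)) :=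
    fun r n f hf => smul_mem_weightIdeal r (raisesOrder_hamDer hh hf)
  ext1 f
  rw [AlgHom.mul_apply, flow_apply (hmem s), flow_apply (hmem t), flow_apply (hmem (s + t)),
    hamDer_smul, hamDer_smul, hamDer_smul]
  change expOp (s • ↑(hamDer h)) (expOp (t • ↑(hamDer h)) f) = expOp ((s + t) • ↑(hamDer h)) f
  rw [add_smul, expOp_add_of_commute (hraise s) (hraise t) hcomm]

lemma flow_mul_flow_neg (h : FSeries) : flow h * flow (-h) = 1 := by
  by_cases hh : h ∈ ordIdeal 3
  · simpa using flow_smul_mul_flow_smul hh 1 (-1)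
  · rw [flow, flow, dif_neg hh, dif_neg (by rwa [neg_mem_iff]), mul_one]

/-- The flow as an automorphism. -/
def flowAut (h : FSeries) : SeriesEndˣ :=
  ⟨flow h, flow (-h), flow_mul_flow_neg h, by simpa using flow_mul_flow_neg (-h)⟩

@[simp] lemma coe_flowAut (h : FSeries) : (flowAut h : SeriesEnd) = flow h := rfl

@[simp] lemma coe_inv_flowAut (h : FSeries) : (↑(flowAut h)⁻¹ : SeriesEnd) = flow (-h) := rfl

lemma isCanonicalAut_flowAut (h : FSeries) : IsCanonicalAut (flowAut h) :=
  ⟨isFamilyEnd_flow h, isFamilyEnd_flow (-h), scalesBracket_flow h⟩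

lemma flow_mul_flow_self (hh : h ∈ ordIdeal 3) : flow h * flow h = flow ((2 : ℝ) • h) := by
  have h2 := flow_smul_mul_flow_smul hh 1 1
  norm_num at h2
  exact h2

/-- Flows are natural with respect to maps that preserve the bracket up to sign. -/
lemma IsFamilyEnd.mul_flow (hα : IsFamilyEnd α) (hs : s * s = 1) (hb : ScalesBracket s α)
    (hh : h ∈ ordIdeal 3) : α * flow h = flow (s • α h) * α := by
  have hh' : s • α h ∈ ordIdeal 3 := smul_mem_weightIdeal s (hα.mem hh)
  ext1 f
  rw [AlgHom.mul_apply, AlgHom.mul_apply, flow_apply hh, flow_apply hh']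
  refine map_expOp (α := α.toLinearMap) (fun _ _ hf => hα.mem hf) (raisesOrder_hamDer hh)
    (raisesOrder_hamDer hh') (fun g => ?_) f
  change α (hamDer h g) = hamDer (s • α h) (α g)
  rw [hamDer_smul, Derivation.smul_apply, hamDer_apply, hamDer_apply, hb, smul_smul, hs, one_smul]

lemma IsCanonicalAut.mul_flow {β : SeriesEndˣ} (hβ : IsCanonicalAut β) (hh : h ∈ ordIdeal 3) :
    (β : SeriesEnd) * flow h = flow ((β : SeriesEnd) h) * β := by
  rw [hβ.isFamilyEnd.mul_flow (one_mul 1) hβ.scalesBracket hh, one_smul]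

lemma cong_flow_mul_flow (hk : 1 ≤ k) (ha : a ∈ ordIdeal 3) (hb : b ∈ ordIdeal (k + 2)) :
    Cong famWeight (k + 1) (flow a * flow b) (flow (a + b)) := fun n f hf => by
  have hb3 : b ∈ ordIdeal 3 := mem_weightIdeal_of_le hb (by omega)
  change flow a (flow b f) - flow (a + b) f ∈ ordIdeal (n + (k + 1))
  rw [flow_apply ha, flow_apply hb3, flow_apply (add_mem ha hb3), hamDer_add]
  exact expOp_expOp_sub_mem (raisesOrder_hamDer (k := 1) ha) (raisesOrder_hamDer hb) hk hf

lemma cong_flow_mul_flow_rev (hk : 1 ≤ k) (ha : a ∈ ordIdeal 3) (hb : b ∈ ordIdeal (k + 2)) :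
    Cong famWeight (k + 1) (flow b * flow a) (flow (a + b)) := by
  have hneg := cong_flow_mul_flow hk (neg_mem ha) (neg_mem hb)
  have hinv := Cong.inv (α := flowAut (-a) * flowAut (-b)) (β := flowAut (-a + -b))
    ((isCanonicalAut_flowAut _).mul (isCanonicalAut_flowAut _)) (isCanonicalAut_flowAut _) hneg
  simpa [mul_inv_rev, neg_add_rev, add_comm] using hinv

end Flow

/-! ### Pull-backs -/

section PullBack

variable {k : ℕ} {s : ℝ} {F G : FormalMap} {α β : SeriesEnd}

lemma hasSubst_of_fixesOrigin (hG : FixesOrigin G) :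
    HasSubst (![G 0, G 1, X 2] : Fin 3 → FSeries) :=
  hasSubst_of_constantCoeff_zero (Fin.forall_fin_succ.2
    ⟨hG 0, Fin.forall_fin_succ.2 ⟨hG 1, Fin.forall_fin_one.2 (constantCoeff_X 2)⟩⟩)

/-- The pull-back `f ↦ f ∘ G_ε` by a family `G` without constant term. -/
def pull (hG : FixesOrigin G) : SeriesEnd :=
  substAlgHom (hasSubst_of_fixesOrigin hG)

lemma pull_X_zero (hG : FixesOrigin G) : pull hG (X 0) = G 0 := substAlgHom_X _ 0
lemma pull_X_one (hG : FixesOrigin G) : pull hG (X 1) = G 1 := substAlgHom_X _ 1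
lemma pull_X_two (hG : FixesOrigin G) : pull hG (X 2) = X 2 := substAlgHom_X _ 2

lemma comp_apply (F : FormalMap) (hG : FixesOrigin G) (i : Fin 2) :
    comp F G i = pull hG (F i) := by
  rw [pull, substAlgHom_apply, comp]

lemma mem_ordIdeal_one_iff {f : FSeries} : f ∈ ordIdeal 1 ↔ constantCoeff f = 0 :=
  mem_weightIdeal_one_iff famWeight_ne_zero

lemma isFamilyEnd_pull (hG : FixesOrigin G) : IsFamilyEnd (pull hG) :=
  isFamilyEnd_of_X (by rw [pull_X_zero]; exact mem_ordIdeal_one_iff.2 (hG 0))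
    (by rw [pull_X_one]; exact mem_ordIdeal_one_iff.2 (hG 1)) (pull_X_two hG)

/-- The family of maps with prescribed pull-back. -/
def toMap (α : SeriesEnd) : FormalMap := ![α (X 0), α (X 1)]

lemma toMap_pull (hG : FixesOrigin G) : toMap (pull hG) = G := by
  rw [toMap, pull_X_zero, pull_X_one]
  exact List.ofFn_inj.1 rfl

lemma toMap_one : toMap 1 = idMap := rfl

lemma IsFamilyEnd.fixesOrigin_toMap (hα : IsFamilyEnd α) : FixesOrigin (toMap α) :=
  Fin.forall_fin_two.2 ⟨mem_ordIdeal_one_iff.1 (hα.mem X_zero_mem),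
    mem_ordIdeal_one_iff.1 (hα.mem X_one_mem)⟩

lemma IsFamilyEnd.pull_toMap (hα : IsFamilyEnd α) : pull hα.fixesOrigin_toMap = α :=
  (isFamilyEnd_pull _).eq_of_X hα (pull_X_zero _) (pull_X_one _)

lemma IsFamilyEnd.toMap_inj (hα : IsFamilyEnd α) (hβ : IsFamilyEnd β) :
    toMap α = toMap β ↔ α = β :=
  ⟨fun h => hα.eq_of_X hβ (congrFun h 0) (congrFun h 1), fun h => h ▸ rfl⟩

lemma comp_toMap (α : SeriesEnd) (hβ : IsFamilyEnd β) :
    comp (toMap α) (toMap β) = toMap (β * α) :=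
  funext (Fin.forall_fin_two.2 ⟨by rw [comp_apply _ hβ.fixesOrigin_toMap, hβ.pull_toMap]; rfl,
    by rw [comp_apply _ hβ.fixesOrigin_toMap, hβ.pull_toMap]; rfl⟩)

lemma bracket_X_zero_X_one : bracket (X 0) (X 1) = 1 := by
  rw [bracket_X_zero, pderiv_X_self]

lemma IsFamilyEnd.bracket_apply (hα : IsFamilyEnd α) (f g : FSeries) :
    bracket (α f) (α g) = bracket (α (X 0)) (α (X 1)) * α (bracket f g) := by
  have hchain : ∀ i : Fin 3, i ≠ 2 → ∀ f, pderiv ℝ i (α f) =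
      α (pderiv ℝ 0 f) * pderiv ℝ i (α (X 0)) + α (pderiv ℝ 1 f) * pderiv ℝ i (α (X 1)) :=
    fun i hi f => by
      rw [pderiv_algHom famWeight_ne_zero hα.toIsFiltered, Fin.sum_univ_three, hα.X_two,
        pderiv_X_of_ne hi.symm, mul_zero, add_zero]
  simp only [bracket, hchain 0 (by decide) f, hchain 1 (by decide) f, hchain 0 (by decide) g,
    hchain 1 (by decide) g, map_sub, map_mul]
  ring

lemma IsFamilyEnd.scalesBracket_of_X (hα : IsFamilyEnd α)
    (h : bracket (α (X 0)) (α (X 1)) = C s) : ScalesBracket s α := fun f g => by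
  rw [hα.bracket_apply, h, smul_eq_C_mul]

lemma scalesBracket_pull (hG : FixesOrigin G) (h : jacDet G = C s) : ScalesBracket s (pull hG) :=
  (isFamilyEnd_pull hG).scalesBracket_of_X (by rw [pull_X_zero, pull_X_one]; exact h)

lemma IsFamilyEnd.isCanonical_toMap (hα : IsFamilyEnd α) (hb : ScalesBracket 1 α) :
    IsCanonical (toMap α) where
  fixesOrigin := hα.fixesOrigin_toMap
  jacDet_eq := by
    have h := hb (X 0) (X 1)
    rwa [bracket_X_zero_X_one, map_one, one_smul] at h

lemma IsCanonical.exists_isCanonicalAut {φ ψ : FormalMap} (hφ : IsCanonical φ)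
    (hψ : FixesOrigin ψ) (hφψ : comp φ ψ = idMap) (hψφ : comp ψ φ = idMap) :
    ∃ β : SeriesEndˣ, IsCanonicalAut β ∧ toMap β = φ ∧ toMap (↑β⁻¹ : SeriesEnd) = ψ := by
  have hφ' := isFamilyEnd_pull hφ.fixesOrigin
  have hψ' := isFamilyEnd_pull hψ
  have hleft : pull hφ.fixesOrigin * pull hψ = 1 := by
    rwa [← (hφ'.mul hψ').toMap_inj IsFamilyEnd.one, ← comp_toMap _ hφ', toMap_pull hφ.fixesOrigin,
      toMap_pull hψ]
  have hright : pull hψ * pull hφ.fixesOrigin = 1 := by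
    rwa [← (hψ'.mul hφ').toMap_inj IsFamilyEnd.one, ← comp_toMap _ hψ', toMap_pull hφ.fixesOrigin,
      toMap_pull hψ]
  exact ⟨⟨pull hφ.fixesOrigin, pull hψ, hleft, hright⟩,
    ⟨hφ', hψ', scalesBracket_pull hφ.fixesOrigin (by rw [hφ.jacDet_eq, map_one])⟩,
    toMap_pull hφ.fixesOrigin, toMap_pull hψ⟩

end PullBack

/-! ### Linear changes of variables -/

section Linear

variable {k : ℕ} {J P Q : Matrix (Fin 2) (Fin 2) ℝ} {a b : ℝ}

/-- The linear map of the plane with matrix `P`. -/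
def linMap (P : Matrix (Fin 2) (Fin 2) ℝ) : FormalMap := fun i => P i 0 • X 0 + P i 1 • X 1

lemma fixesOrigin_linMap (P : Matrix (Fin 2) (Fin 2) ℝ) : FixesOrigin (linMap P) := fun i => by
  simp [linMap, smul_eq_C_mul]

/-- The pull-back by the linear map with matrix `P`. -/
def linEnd (P : Matrix (Fin 2) (Fin 2) ℝ) : SeriesEnd := pull (fixesOrigin_linMap P)

lemma linEnd_X_zero (P : Matrix (Fin 2) (Fin 2) ℝ) :
    linEnd P (X 0) = P 0 0 • X 0 + P 0 1 • X 1 := pull_X_zero _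

lemma linEnd_X_one (P : Matrix (Fin 2) (Fin 2) ℝ) :
    linEnd P (X 1) = P 1 0 • X 0 + P 1 1 • X 1 := pull_X_one _

lemma isFamilyEnd_linEnd (P : Matrix (Fin 2) (Fin 2) ℝ) : IsFamilyEnd (linEnd P) :=
  isFamilyEnd_pull _

lemma linEnd_one : linEnd 1 = 1 :=
  (isFamilyEnd_linEnd 1).eq_of_X IsFamilyEnd.one (by simp [linEnd_X_zero]) (by simp [linEnd_X_one])

lemma linEnd_mul (P Q : Matrix (Fin 2) (Fin 2) ℝ) : linEnd P * linEnd Q = linEnd (Q * P) := by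
  refine ((isFamilyEnd_linEnd P).mul (isFamilyEnd_linEnd Q)).eq_of_X (isFamilyEnd_linEnd _) ?_ ?_
  all_goals
    simp only [AlgHom.mul_apply, linEnd_X_zero, linEnd_X_one, map_add, map_smul, Matrix.mul_apply,
      Fin.sum_univ_two]
    module

lemma scalesBracket_linEnd (P : Matrix (Fin 2) (Fin 2) ℝ) : ScalesBracket P.det (linEnd P) := by
  refine (isFamilyEnd_linEnd P).scalesBracket_of_X ?_
  simp [linEnd_X_zero, linEnd_X_one, bracket, Matrix.det_fin_two, smul_eq_C_mul,
    pderiv_X_of_ne (show (1 : Fin 3) ≠ 0 by decide),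
    pderiv_X_of_ne (show (0 : Fin 3) ≠ 1 by decide)]

lemma exists_isCanonicalAut_eq_linEnd (hP : P.det = 1) :
    ∃ β : SeriesEndˣ, IsCanonicalAut β ∧ (β : SeriesEnd) = linEnd P := by
  have hunit : IsUnit P.det := hP ▸ isUnit_one
  refine ⟨⟨linEnd P, linEnd P⁻¹, ?_, ?_⟩,
    ⟨isFamilyEnd_linEnd P, isFamilyEnd_linEnd P⁻¹, hP ▸ scalesBracket_linEnd P⟩, rfl⟩
  · rw [linEnd_mul, Matrix.nonsing_inv_mul P hunit, linEnd_one]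
  · rw [linEnd_mul, Matrix.mul_nonsing_inv P hunit, linEnd_one]

lemma coeff_linEnd_diagonal (a b : ℝ) (k l m : ℕ) (f : FSeries) :
    coeff (expo k l m) (linEnd (.diagonal ![a, b]) f) = a ^ k * b ^ l * coeff (expo k l m) f := by
  have hX : ∀ i, rescaleAlgHom (![a, b, 1] : Fin 3 → ℝ) (X i : FSeries) =
      (![a, b, 1] : Fin 3 → ℝ) i • X i := fun i => by
    rw [rescaleAlgHom_apply, rescale_eq_subst, subst_X (HasSubst.smul_X _)]; rfl
  have hfam : IsFamilyEnd (rescaleAlgHom (![a, b, 1] : Fin 3 → ℝ)) :=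
    isFamilyEnd_of_X (by rw [hX]; exact smul_mem_weightIdeal _ X_zero_mem)
      (by rw [hX]; exact smul_mem_weightIdeal _ X_one_mem) (by rw [hX]; simp)
  have heq : linEnd (.diagonal ![a, b]) = rescaleAlgHom (![a, b, 1] : Fin 3 → ℝ) :=
    (isFamilyEnd_linEnd _).eq_of_X hfam (by simp [hX, linEnd_X_zero]) (by simp [hX, linEnd_X_one])
  rw [heq, rescaleAlgHom_apply, coeff_rescale, Finsupp.prod_fintype _ _ fun i => pow_zero _]
  simp [Fin.prod_univ_three]

lemma sub_linear_mem {f : FSeries} (hf : f ∈ ordIdeal 1) :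
    f - (coeff (expo 1 0 0) f • X 0 + coeff (expo 0 1 0) f • X 1) ∈ ordIdeal 2 := by
  classical
  rw [mem_ordIdeal_iff] at hf ⊢
  intro k l m hd
  simp only [map_sub, map_add, map_smul, X_zero_eq_monomial, X_one_eq_monomial, coeff_monomial,
    expo_inj]
  obtain rfl : m = 0 := by omega
  obtain ⟨rfl, rfl⟩ | ⟨rfl, rfl⟩ | ⟨rfl, rfl⟩ :
      (k = 0 ∧ l = 0) ∨ (k = 1 ∧ l = 0) ∨ (k = 0 ∧ l = 1) := by omega
  · simp [hf 0 0 0 (by omega)]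
  · simp
  · simp

lemma cong_pull_linEnd {F : FormalMap} (hF : FixesOrigin F) :
    Cong famWeight 1 (pull hF) (linEnd (linearPart F)) := by
  have hlin : ∀ i, F i - (linearPart F i 0 • X 0 + linearPart F i 1 • X 1) ∈ ordIdeal 2 :=
    fun i => by
      have hsub := sub_linear_mem (mem_ordIdeal_one_iff.2 (hF i))
      rw [← single_zero_eq_expo, ← single_one_eq_expo] at hsub
      exact hsub
  refine (isFamilyEnd_pull hF).cong_of_X (isFamilyEnd_linEnd _) ?_ ?_
  · rw [pull_X_zero, linEnd_X_zero]
    exact hlin 0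
  · rw [pull_X_one, linEnd_X_one]
    exact hlin 1

lemma exists_det_eq_one_and_mul_eq (hJ : HasEigenvaluesNegOneOne J) :
    ∃ P : Matrix (Fin 2) (Fin 2) ℝ, P.det = 1 ∧ P * J = .diagonal ![-1, 1] * P := by
  obtain ⟨v, hv⟩ := hJ.1.exists_hasEigenvector
  obtain ⟨w, hw⟩ := hJ.2.exists_hasEigenvector
  let V : Matrix (Fin 2) (Fin 2) ℝ := Matrix.of ![v, w]
  have hindep : LinearIndependent ℝ V.row :=
    Module.End.eigenvectors_linearIndependent' (Matrix.toLin' J) ![-1, 1]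
      (by simp [Function.Injective, Fin.forall_fin_two]; norm_num) _
      (Fin.forall_fin_two.2 ⟨hv, hw⟩)
  have hdet : IsUnit (Vᵀ).det := by
    rw [Matrix.det_transpose, ← Matrix.isUnit_iff_isUnit_det]
    exact Matrix.linearIndependent_rows_iff_isUnit.1 hindep
  have hJV : J * Vᵀ = Vᵀ * .diagonal ![-1, 1] := by
    ext i j
    rw [Matrix.mul_diagonal, Matrix.mul_apply]
    fin_cases j
    · simpa [V, Matrix.mulVec, dotProduct] using congrFun hv.apply_eq_smul i
    · simpa [V, Matrix.mulVec, dotProduct] using congrFun hw.apply_eq_smul i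
  refine ⟨.diagonal ![1, (Vᵀ).det] * (Vᵀ)⁻¹, ?_, ?_⟩
  · rw [Matrix.det_mul, Matrix.det_diagonal, Fin.prod_univ_two]
    simpa [Matrix.det_nonsing_inv] using mul_inv_cancel₀ hdet.ne_zero
  · have hVJ : (Vᵀ)⁻¹ * J = .diagonal ![-1, 1] * (Vᵀ)⁻¹ := by
      rw [← Matrix.mul_nonsing_inv_cancel_right (A := Vᵀ) ((Vᵀ)⁻¹ * J) hdet, Matrix.mul_assoc _ J,
        hJV, ← Matrix.mul_assoc, Matrix.nonsing_inv_mul _ hdet, Matrix.one_mul]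
    rw [Matrix.mul_assoc, hVJ, ← Matrix.mul_assoc, ← Matrix.mul_assoc,
      (Matrix.commute_diagonal _ _).eq]

end Linear

/-! ### The reflection -/

section Reflection

variable {k : ℕ} {f h : FSeries}

/-- The pull-back by the reflection `Diag(-1, 1)`. -/
def reflEnd : SeriesEnd := linEnd (.diagonal ![-1, 1])

lemma isFamilyEnd_reflEnd : IsFamilyEnd reflEnd := isFamilyEnd_linEnd _

lemma reflEnd_X_zero : reflEnd (X 0) = -X 0 := by simp [reflEnd, linEnd_X_zero]

lemma reflEnd_X_one : reflEnd (X 1) = X 1 := by simp [reflEnd, linEnd_X_one]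

lemma toMap_reflEnd : toMap reflEnd = reflection := by
  rw [toMap, reflEnd_X_zero, reflEnd_X_one, reflection]

lemma reflEnd_mul_self : reflEnd * reflEnd = 1 := by
  rw [reflEnd, linEnd_mul, Matrix.diagonal_mul_diagonal, ← linEnd_one, ← Matrix.diagonal_one]
  congr 2
  ext i
  fin_cases i <;> simp

lemma reflEnd_reflEnd (f : FSeries) : reflEnd (reflEnd f) = f := by
  rw [← AlgHom.mul_apply, reflEnd_mul_self, AlgHom.one_apply]

lemma scalesBracket_reflEnd : ScalesBracket (-1) reflEnd := by
  simpa [reflEnd, Matrix.det_diagonal] using scalesBracket_linEnd (.diagonal ![-1, 1])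

lemma coeff_reflEnd (k l m : ℕ) (f : FSeries) :
    coeff (expo k l m) (reflEnd f) = (-1) ^ k * coeff (expo k l m) f := by
  rw [reflEnd, coeff_linEnd_diagonal, one_pow, mul_one]

lemma oddInX_iff_coeff : OddInX h ↔ ∀ k l m, ¬ Odd k → coeff (expo k l m) h = 0 := by
  refine ⟨fun hodd k l m hk => not_imp_comm.1 (hodd (expo k l m)) hk, fun hzero d hd => ?_⟩
  rw [← expo_eta d] at hd
  exact not_imp_comm.1 (hzero _ _ _) hd

lemma oddInX_iff : OddInX h ↔ reflEnd h = -h := by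
  rw [oddInX_iff_coeff]
  refine ⟨fun hzero => series_ext fun k l m => ?_, fun hrefl k l m hk => ?_⟩
  · rw [coeff_reflEnd, map_neg]
    by_cases hk : Odd k
    · rw [hk.neg_one_pow, neg_one_mul]
    · rw [hzero k l m hk, mul_zero, neg_zero]
  · have hcoeff := coeff_reflEnd k l m h
    rw [hrefl, (Nat.not_odd_iff_even.1 hk).neg_one_pow, map_neg] at hcoeff
    linarith

lemma OddInX.add {g : FSeries} (hg : OddInX g) (hh : OddInX h) : OddInX (g + h) := by
  rw [oddInX_iff] at *
  rw [map_add, hg, hh, neg_add]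

lemma OddInX.of_forall_sub_mem {g : FSeries} {h : ℕ → FSeries} (ho : ∀ n, OddInX (h n))
    (hlim : ∀ n, g - h n ∈ ordIdeal n) : OddInX g := by
  refine oddInX_iff_coeff.2 fun k l m hk => ?_
  have hcoeff := mem_ordIdeal_iff.1 (hlim (k + l + 3 * m + 1)) k l m (Nat.lt_succ_self _)
  rwa [map_sub, oddInX_iff_coeff.1 (ho _) k l m hk, sub_zero] at hcoeff

lemma reflEnd_mul_flow (hh : h ∈ ordIdeal 3) : reflEnd * flow h = flow (-reflEnd h) * reflEnd := by
  simpa using isFamilyEnd_reflEnd.mul_flow (by norm_num) scalesBracket_reflEnd hh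

lemma OddInX.reflEnd_mul_flow (ho : OddInX h) (hh : h ∈ ordIdeal 3) :
    reflEnd * flow h = flow h * reflEnd := by
  rw [ReversingMaps.reflEnd_mul_flow hh, oddInX_iff.1 ho, neg_neg]

/-- Conjugacy to a reflected flow in terms of pull-backs, which compose in the opposite order. -/
lemma conjToReflectedFlow_iff {F : FormalMap} (hF : FixesOrigin F) (hh : h ∈ ordIdeal 3) :
    ConjToReflectedFlow F h ↔
      ∃ β : SeriesEndˣ, IsCanonicalAut β ∧ pull hF * β = β * (flow h * reflEnd) := by
  have htimeOne : timeOne h = toMap (flow h) := by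
    rw [timeOne, toMap, expLie_eq_flow hh, expLie_eq_flow hh]
  have hconj : ∀ β : SeriesEndˣ, IsCanonicalAut β → comp (toMap (↑β⁻¹ : SeriesEnd))
      (comp reflection (comp (timeOne h) (toMap β))) = toMap (β * (flow h * reflEnd) * ↑β⁻¹) :=
    fun β hβ => by
      have hβflow := hβ.isFamilyEnd.mul (isFamilyEnd_flow h)
      rw [htimeOne, ← toMap_reflEnd, comp_toMap _ hβ.isFamilyEnd, comp_toMap _ hβflow,
        comp_toMap _ (hβflow.mul isFamilyEnd_reflEnd), mul_assoc (β : SeriesEnd)]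
  constructor
  · rintro ⟨φ, ψ, hφ, hψ, hφψ, hψφ, rfl⟩
    obtain ⟨β, hβ, rfl, rfl⟩ := hφ.exists_isCanonicalAut hψ.fixesOrigin hφψ hψφ
    refine ⟨β, hβ, ?_⟩
    have hfam := (hβ.isFamilyEnd.mul ((isFamilyEnd_flow h).mul isFamilyEnd_reflEnd)).mul
      hβ.isFamilyEnd_inv
    simp only [hconj β hβ, hfam.pull_toMap]
    rw [mul_assoc, Units.inv_mul, mul_one]
  · rintro ⟨β, hβ, heq⟩
    refine ⟨toMap β, toMap (↑β⁻¹ : SeriesEnd), hβ.isFamilyEnd.isCanonical_toMap hβ.scalesBracket,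
      hβ.isFamilyEnd_inv.isCanonical_toMap hβ.inv.scalesBracket, ?_, ?_, ?_⟩
    · rw [comp_toMap _ hβ.isFamilyEnd_inv, Units.inv_mul, toMap_one]
    · rw [comp_toMap _ hβ.isFamilyEnd, Units.mul_inv, toMap_one]
    · rw [hconj β hβ, ← heq, mul_assoc, Units.mul_inv, mul_one, toMap_pull]

end Reflection

/-! ### Generating Hamiltonians -/

section GeneratingHamiltonian

variable {k : ℕ} {a b u v : FSeries} {γ : SeriesEnd}

/-- The series `g` with `∂_y g = u` whose restriction to `y = 0` satisfies `∂_x g = -v`; it is a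
Hamiltonian of the vector field `(u, v)` if that field is divergence free. -/
def potential (u v : FSeries) : FSeries := ofCoeffs fun i j m =>
  match j, i with
  | j + 1, i => coeff (expo i j m) u / (j + 1)
  | 0, i + 1 => -coeff (expo i 0 m) v / (i + 1)
  | 0, 0 => 0

lemma pderiv_one_potential (u v : FSeries) : pderiv ℝ 1 (potential u v) = u := by
  refine series_ext fun k l m => ?_
  rw [coeff_pderiv_one, potential, coeff_ofCoeffs]
  have : (l : ℝ) + 1 ≠ 0 := by positivity
  field_simp

lemma potential_mem (hu : u ∈ ordIdeal (k + 1)) (hv : v ∈ ordIdeal (k + 1)) :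
    potential u v ∈ ordIdeal (k + 2) := by
  rw [mem_ordIdeal_iff] at hu hv ⊢
  intro i j m hd
  rw [potential, coeff_ofCoeffs]
  rcases j with _ | j
  · rcases i with _ | i
    · rfl
    · simp only [hv i 0 m (by omega), neg_zero, zero_div]
  · simp only [hu i j m (by omega), zero_div]

lemma pderiv_zero_potential_add_mem (h : pderiv ℝ 0 u + pderiv ℝ 1 v ∈ ordIdeal (k + 1)) :
    pderiv ℝ 0 (potential u v) + v ∈ ordIdeal (k + 2) := by
  refine mem_ordIdeal_iff.2 fun i j m hd => ?_
  rcases j with _ | j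
  · rw [map_add, coeff_pderiv_zero, potential, coeff_ofCoeffs]
    have : (i : ℝ) + 1 ≠ 0 := by positivity
    simp only
    field_simp
    ring
  · have hy : pderiv ℝ 1 (pderiv ℝ 0 (potential u v) + v) ∈ ordIdeal (k + 1) := by
      rwa [map_add, ← pderiv_comm, pderiv_one_potential]
    have hcoeff := mem_ordIdeal_iff.1 hy i j m (by omega)
    rw [coeff_pderiv_one] at hcoeff
    exact (mul_eq_zero.1 hcoeff).resolve_right (by positivity)

lemma oddInX_potential (hu : reflEnd u = -u) (hv : reflEnd v = v) : OddInX (potential u v) := by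
  refine oddInX_iff_coeff.2 fun i j m hi => ?_
  rw [potential, coeff_ofCoeffs]
  rcases j with _ | j
  · rcases i with _ | i
    · rfl
    · have hrefl := coeff_reflEnd i 0 m v
      rw [hv, (not_not.1 (mt Nat.odd_add_one.2 hi)).neg_one_pow] at hrefl
      have hzero : coeff (expo i 0 m) v = 0 := by linarith
      simp only [hzero, neg_zero, zero_div]
  · simp only [oddInX_iff_coeff.1 (oddInX_iff.2 hu) i j m hi, zero_div]

/-- The Hamiltonian whose time-one map agrees to leading order with `γ`, if `γ` is canonical and
close to the identity. -/
def generator (γ : SeriesEnd) : FSeries := potential (γ (X 0) - X 0) (γ (X 1) - X 1)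

lemma oddInX_generator (h : reflEnd * γ = γ * reflEnd) : OddInX (generator γ) := by
  have h' : ∀ f, reflEnd (γ f) = γ (reflEnd f) := DFunLike.congr_fun h
  refine oddInX_potential ?_ ?_
  · rw [map_sub, h', reflEnd_X_zero, map_neg, neg_sub_neg, neg_sub]
  · rw [map_sub, h', reflEnd_X_one]

lemma generator_mem (hc : Cong famWeight k γ 1) : generator γ ∈ ordIdeal (k + 2) :=
  potential_mem (mem_weightIdeal_of_le (hc X_zero_mem) (by omega))
    (mem_weightIdeal_of_le (hc X_one_mem) (by omega))

/-- The Jacobian condition reads `div (u, v) = -{u, v}` for `γ = id + (u, v)`, and the right-hand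
side has higher order. -/
lemma divergence_mem (hk : 1 ≤ k) (hb : ScalesBracket 1 γ) (hc : Cong famWeight k γ 1) :
    pderiv ℝ 0 (γ (X 0) - X 0) + pderiv ℝ 1 (γ (X 1) - X 1) ∈ ordIdeal (k + 1) := by
  have hdiv : pderiv ℝ 0 (γ (X 0) - X 0) + pderiv ℝ 1 (γ (X 1) - X 1) =
      -bracket (γ (X 0) - X 0) (γ (X 1) - X 1) := by
    have hjac := hb (X 0) (X 1)
    rw [bracket_X_zero_X_one, map_one, one_smul] at hjac
    simp only [bracket, map_sub, pderiv_X_self, pderiv_X_of_ne (show (1 : Fin 3) ≠ 0 by decide),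
      pderiv_X_of_ne (show (0 : Fin 3) ≠ 1 by decide)] at hjac ⊢
    linear_combination hjac
  rw [hdiv]
  exact neg_mem (mem_weightIdeal_of_le (bracket_mem (hc X_zero_mem) (hc X_one_mem)) (by omega))

lemma cong_flow_generator (hk : 1 ≤ k) (hγ : IsFamilyEnd γ) (hb : ScalesBracket 1 γ)
    (hc : Cong famWeight k γ 1) : Cong famWeight (k + 1) γ (flow (generator γ)) := by
  have hg := generator_mem hc
  refine hγ.cong_of_X (isFamilyEnd_flow _) ?_ ?_
  · have hflow := flow_sub_sub_bracket_mem hk hg X_zero_mem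
    rw [bracket_X_zero, generator, pderiv_one_potential, ← generator, sub_sub_sub_cancel_right]
      at hflow
    rw [← neg_sub]
    exact neg_mem (mem_weightIdeal_of_le hflow (by omega))
  · have hflow := flow_sub_sub_bracket_mem hk hg X_one_mem
    have hsplit : γ (X 1) - flow (generator γ) (X 1) =
        (pderiv ℝ 0 (generator γ) + (γ (X 1) - X 1)) -
          (flow (generator γ) (X 1) - X 1 - bracket (X 1) (generator γ)) := by
      rw [bracket_X_one]; ring
    rw [hsplit]
    exact sub_mem (mem_weightIdeal_of_le
      (pderiv_zero_potential_add_mem (divergence_mem hk hb hc)) (by omega))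
      (mem_weightIdeal_of_le hflow (by omega))

lemma cong_flow (hk : 1 ≤ k) (hb : b ∈ ordIdeal 3) (hab : a - b ∈ ordIdeal (k + 2)) :
    Cong famWeight k (flow a) (flow b) := by
  have hmul := cong_flow_mul_flow hk hb hab
  rw [add_sub_cancel] at hmul
  have hone := (cong_flow_one hk hab).mul_left (isFamilyEnd_flow b).toIsFiltered
  rw [mul_one] at hone
  exact (hmul.mono (Nat.le_succ k)).symm.trans hone

end GeneratingHamiltonian

/-! ### The Takens normal form -/

section Takens

variable {k : ℕ} {h : FSeries} {α : SeriesEnd}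

lemma exists_seq_of_step {S : Type*} {P : ℕ → S → Prop} {Q : ℕ → S → S → Prop} {s₀ : S}
    (h0 : P 0 s₀) (step : ∀ n s, P n s → ∃ s', P (n + 1) s' ∧ Q n s s') :
    ∃ u : ℕ → S, ∀ n, P n (u n) ∧ Q n (u n) (u (n + 1)) := by
  choose f hf using step
  let v : ∀ n, {s // P n s} := fun n =>
    Nat.rec ⟨s₀, h0⟩ (fun n s => ⟨f n s.1 s.2, (hf n s.1 s.2).1⟩) n
  exact ⟨fun n => (v n).1, fun n => ⟨(v n).2, (hf n _ (v n).2).2⟩⟩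

lemma exists_cong_flow_add_mul_reflEnd (hk : 1 ≤ k) (hα : IsFamilyEnd α)
    (hb : ScalesBracket (-1) α) (hh : h ∈ ordIdeal 3)
    (hc : Cong famWeight k α (flow h * reflEnd)) :
    ∃ g ∈ ordIdeal (k + 2), Cong famWeight (k + 1) α (flow (h + g) * reflEnd) := by
  have hR := isFamilyEnd_reflEnd.toIsFiltered
  have hinv : flow (-h) * flow h = 1 := by simpa using flow_mul_flow_neg (-h)
  let γ : SeriesEnd := flow (-h) * α * reflEnd
  have hγb : ScalesBracket 1 γ := by
    simpa using ((scalesBracket_flow (-h)).mul hb).mul scalesBracket_reflEnd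
  have hγc : Cong famWeight k γ 1 := by
    have hcong := (hc.mul_left (isFamilyEnd_flow (-h)).toIsFiltered).mul_right hR
    rwa [← mul_assoc, hinv, one_mul, reflEnd_mul_self] at hcong
  have hαγ : α = flow h * γ * reflEnd := by
    calc α = (flow h * flow (-h)) * α * (reflEnd * reflEnd) := by
          rw [flow_mul_flow_neg, reflEnd_mul_self, one_mul, mul_one]
      _ = flow h * γ * reflEnd := by simp only [γ, mul_assoc]
  have hγ : Cong famWeight (k + 1) γ (flow (generator γ)) :=
    cong_flow_generator hk (((isFamilyEnd_flow _).mul hα).mul isFamilyEnd_reflEnd) hγb hγc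
  refine ⟨generator γ, generator_mem hγc, ?_⟩
  nth_rewrite 1 [hαγ]
  exact ((hγ.mul_left (isFamilyEnd_flow h).toIsFiltered).trans
    (cong_flow_mul_flow hk hh (generator_mem hγc))).mul_right hR

/-- Conjugation by the flow of an even Hamiltonian `χ` changes the Hamiltonian by `2 χ` to leading
order, hence the even part of the Hamiltonian can be removed. -/
lemma exists_takens_step (hk : 1 ≤ k) (hα : IsFamilyEnd α) (hb : ScalesBracket (-1) α)
    (hh : h ∈ ordIdeal 3) (hc : Cong famWeight k α (flow h * reflEnd)) :
    ∃ χ ∈ ordIdeal (k + 2), ∃ o ∈ ordIdeal (k + 2), OddInX o ∧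
      Cong famWeight (k + 1) (α * flow χ) (flow χ * (flow (h + o) * reflEnd)) := by
  obtain ⟨g, hg, hgc⟩ := exists_cong_flow_add_mul_reflEnd hk hα hb hh hc
  have hR := isFamilyEnd_reflEnd.toIsFiltered
  have hRg : reflEnd g ∈ ordIdeal (k + 2) := hR.mem hg
  let χ : FSeries := (4⁻¹ : ℝ) • (g + reflEnd g)
  let o : FSeries := (2⁻¹ : ℝ) • (g - reflEnd g)
  have hχ : χ ∈ ordIdeal (k + 2) := smul_mem_weightIdeal _ (add_mem hg hRg)
  have ho : o ∈ ordIdeal (k + 2) := smul_mem_weightIdeal _ (sub_mem hg hRg)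
  have hRχ : reflEnd χ = χ := by
    simp only [χ, map_smul, map_add, reflEnd_reflEnd, add_comm]
  have hodd : OddInX o := by
    simp only [oddInX_iff, o, map_smul, map_sub, reflEnd_reflEnd, ← smul_neg, neg_sub]
  have hsum : h + g + -χ = h + o + χ := by simp only [χ, o]; module
  refine ⟨χ, hχ, o, ho, hodd, ?_⟩
  have h3 : ∀ {f : FSeries}, f ∈ ordIdeal (k + 2) → f ∈ ordIdeal 3 := fun hf =>
    mem_weightIdeal_of_le hf (by omega)
  have hleft := hgc.mul_right (isFamilyEnd_flow χ).toIsFiltered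
  rw [mul_assoc, reflEnd_mul_flow (h3 hχ), hRχ, ← mul_assoc] at hleft
  have hmid := cong_flow_mul_flow hk (add_mem hh (h3 hg)) (neg_mem hχ)
  rw [hsum] at hmid
  have hright := cong_flow_mul_flow_rev hk (add_mem hh (h3 ho)) hχ
  rw [← mul_assoc]
  exact hleft.trans ((hmid.trans hright.symm).mul_right hR)

lemma exists_takens_step_conj (hk : 1 ≤ k) (hα : IsFamilyEnd α) (hb : ScalesBracket (-1) α)
    {β : SeriesEndˣ} (hβ : IsCanonicalAut β) (hh : h ∈ ordIdeal 3)
    (hc : Cong famWeight k (α * (β : SeriesEnd)) ((β : SeriesEnd) * (flow h * reflEnd))) :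
    ∃ β' : SeriesEndˣ, ∃ o ∈ ordIdeal (k + 2), IsCanonicalAut β' ∧ OddInX o ∧
      Cong famWeight (k + 1) (α * (β' : SeriesEnd)) ((β' : SeriesEnd) * (flow (h + o) * reflEnd)) ∧
      Cong famWeight k (β' : SeriesEnd) β := by
  have hconj :
      Cong famWeight k ((↑β⁻¹ : SeriesEnd) * (α * (β : SeriesEnd))) (flow h * reflEnd) := by
    simpa only [Units.inv_mul_cancel_left] using hc.mul_left hβ.isFamilyEnd_inv.toIsFiltered
  obtain ⟨χ, hχ, o, ho, hodd, hstep⟩ := exists_takens_step hk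
    (hβ.isFamilyEnd_inv.mul (hα.mul hβ.isFamilyEnd))
    (by simpa using hβ.inv.scalesBracket.mul (hb.mul hβ.scalesBracket)) hh hconj
  refine ⟨β * flowAut χ, o, ho, hβ.mul (isCanonicalAut_flowAut χ), hodd, ?_, ?_⟩
  · simpa only [mul_assoc, Units.mul_inv_cancel_left, Units.val_mul, coe_flowAut] using
      hstep.mul_left hβ.isFamilyEnd.toIsFiltered
  · simpa only [mul_one, Units.val_mul, coe_flowAut] using
      (cong_flow_one hk hχ).mul_left hβ.isFamilyEnd.toIsFiltered

lemma exists_takens (hα : IsFamilyEnd α) (hb : ScalesBracket (-1) α) {β₀ : SeriesEndˣ}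
    (hβ₀ : IsCanonicalAut β₀)
    (hc : Cong famWeight 1 (α * (β₀ : SeriesEnd)) ((β₀ : SeriesEnd) * reflEnd)) :
    ∃ β : SeriesEndˣ, ∃ h ∈ ordIdeal 3, IsCanonicalAut β ∧ OddInX h ∧
      α * (β : SeriesEnd) = (β : SeriesEnd) * (flow h * reflEnd) := by
  obtain ⟨u, hu⟩ := exists_seq_of_step
    (P := fun n (s : SeriesEndˣ × FSeries) => IsCanonicalAut s.1 ∧ OddInX s.2 ∧ s.2 ∈ ordIdeal 3 ∧
      Cong famWeight (n + 1) (α * (s.1 : SeriesEnd)) ((s.1 : SeriesEnd) * (flow s.2 * reflEnd)))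
    (Q := fun n s s' => Cong famWeight (n + 1) (s'.1 : SeriesEnd) s.1 ∧
      s'.2 - s.2 ∈ ordIdeal (n + 3))
    (s₀ := (β₀, 0)) ⟨hβ₀, oddInX_iff.2 (by simp), zero_mem _, by simpa using hc⟩
    (by
      rintro n ⟨β, h⟩ ⟨hβ, hodd, hh, hc⟩
      obtain ⟨β', o, ho, hβ', hodd', hc', hββ'⟩ :=
        exists_takens_step_conj (Nat.le_add_left 1 n) hα hb hβ hh hc
      exact ⟨(β', h + o), ⟨hβ', hodd.add hodd',
        add_mem hh (mem_weightIdeal_of_le ho (by omega)), hc'⟩, hββ', by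
          simpa only [add_sub_cancel_left] using ho⟩)
  obtain ⟨β, hβ, hβlim⟩ := exists_isCanonicalAut_forall_cong (fun n => (hu n).1.1)
    (fun n => (hu n).2.1.mono (Nat.le_succ n))
  obtain ⟨h, hlim⟩ := exists_forall_sub_mem_weightIdeal (f := fun n => (u n).2)
    (fun n => mem_weightIdeal_of_le (hu n).2.2 (Nat.le_add_right n 3))
  have hh : h ∈ ordIdeal 3 := by
    simpa only [sub_add_cancel] using add_mem (hlim 3) (hu 3).1.2.2.1
  refine ⟨β, h, hh, hβ, OddInX.of_forall_sub_mem (fun n => (hu n).1.2.1) hlim,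
    eq_of_forall_cong (w := famWeight) fun n => ?_⟩
  have hβn := (hβlim (n + 3)).mono (show n + 1 ≤ n + 3 by omega)
  have hflow : Cong famWeight (n + 1) (flow h * reflEnd) (flow (u (n + 3)).2 * reflEnd) :=
    (cong_flow (Nat.le_add_left 1 n) (hu (n + 3)).1.2.2.1 (hlim (n + 3))).mul_right
      isFamilyEnd_reflEnd.toIsFiltered
  exact (((hβn.mul_left hα.toIsFiltered).trans ((hu (n + 3)).1.2.2.2.mono (by omega))).trans
    (hβn.mul hflow (hu (n + 3)).1.1.isFamilyEnd.toIsFiltered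
      ((isFamilyEnd_flow h).mul isFamilyEnd_reflEnd).toIsFiltered).symm).mono (Nat.le_succ n)

lemma exists_cong_mul_reflEnd {F : FormalMap} (hF : FixesOrigin F)
    (hJ : HasEigenvaluesNegOneOne (linearPart F)) :
    ∃ β : SeriesEndˣ, IsCanonicalAut β ∧
      Cong famWeight 1 (pull hF * (β : SeriesEnd)) ((β : SeriesEnd) * reflEnd) := by
  obtain ⟨P, hP, hPJ⟩ := exists_det_eq_one_and_mul_eq hJ
  obtain ⟨β, hβ, hβP⟩ := exists_isCanonicalAut_eq_linEnd hP
  refine ⟨β, hβ, ?_⟩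
  have hlin := (cong_pull_linEnd hF).mul_right hβ.isFamilyEnd.toIsFiltered
  rwa [hβP, linEnd_mul, hPJ, ← linEnd_mul, ← reflEnd, ← hβP] at hlin

lemma exists_isTakensHamiltonian {F : FormalMap} (hF : IsFormalReversingFamily F) :
    ∃ h, IsTakensHamiltonian F h := by
  obtain ⟨β₀, hβ₀, hc⟩ := exists_cong_mul_reflEnd hF.fixesOrigin hF.eigenvalues
  obtain ⟨β, h, hh, hβ, hodd, heq⟩ := exists_takens (isFamilyEnd_pull hF.fixesOrigin)
    (scalesBracket_pull hF.fixesOrigin (by rw [hF.jacDet_eq, map_neg, map_one])) hβ₀ hc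
  exact ⟨h, hodd, orderAtLeastThree_iff.2 hh,
    (conjToReflectedFlow_iff hF.fixesOrigin hh).2 ⟨β, hβ, heq⟩⟩

end Takens

/-! ### Symmetric canonical changes of variables -/

section SymmetricAutomorphisms

/-- Canonical automorphisms that commute with the reflection. -/
structure IsSymmetricAut (δ : SeriesEndˣ) : Prop extends IsCanonicalAut δ where
  comm : reflEnd * (δ : SeriesEnd) = δ * reflEnd

variable {α β δ : SeriesEndˣ} {h : FSeries}

lemma IsSymmetricAut.one : IsSymmetricAut 1 := ⟨IsCanonicalAut.one, by simp⟩

lemma IsSymmetricAut.mul (hα : IsSymmetricAut α) (hβ : IsSymmetricAut β) :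
    IsSymmetricAut (α * β) :=
  ⟨hα.toIsCanonicalAut.mul hβ.toIsCanonicalAut, by
    rw [Units.val_mul, ← mul_assoc, hα.comm, mul_assoc, hβ.comm, mul_assoc]⟩

lemma IsSymmetricAut.oddInX (hδ : IsSymmetricAut δ) (ho : OddInX h) :
    OddInX ((δ : SeriesEnd) h) := by
  rw [oddInX_iff] at *
  rw [← AlgHom.mul_apply, hδ.comm, AlgHom.mul_apply, ho, map_neg]

lemma OddInX.isSymmetricAut_flowAut (ho : OddInX h) (hh : h ∈ ordIdeal 3) :
    IsSymmetricAut (flowAut h) :=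
  ⟨isCanonicalAut_flowAut h, ho.reflEnd_mul_flow hh⟩

lemma exists_isSymmetricAut_forall_cong {α : ℕ → SeriesEndˣ} (hα : ∀ n, IsSymmetricAut (α n))
    (h : ∀ n, Cong famWeight n (α (n + 1) : SeriesEnd) (α n)) :
    ∃ β : SeriesEndˣ, IsSymmetricAut β ∧ ∀ n, Cong famWeight n (β : SeriesEnd) (α n) := by
  obtain ⟨β, hβ, hlim⟩ := exists_isCanonicalAut_forall_cong (fun n => (hα n).toIsCanonicalAut) h
  have hR := isFamilyEnd_reflEnd.toIsFiltered
  refine ⟨β, ⟨hβ, eq_of_forall_cong (w := famWeight) fun n => ?_⟩, hlim⟩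
  have hleft := (hlim n).mul_left hR
  rw [(hα n).comm] at hleft
  exact hleft.trans ((hlim n).mul_right hR).symm

lemma IsSymmetricAut.mul_flow_mul_reflEnd (hδ : IsSymmetricAut δ) (hh : h ∈ ordIdeal 3) :
    (δ : SeriesEnd) * (flow h * reflEnd) = flow ((δ : SeriesEnd) h) * reflEnd * δ := by
  rw [← mul_assoc, hδ.toIsCanonicalAut.mul_flow hh, mul_assoc, mul_assoc, hδ.comm]

lemma exists_isSymmetricAut_coeff {b : ℝ} (hb : b ≠ 0) :
    ∃ δ : SeriesEndˣ, IsSymmetricAut δ ∧ ∀ k l m f,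
      coeff (expo k l m) ((δ : SeriesEnd) f) = b ^ k * b⁻¹ ^ l * coeff (expo k l m) f := by
  obtain ⟨δ, hδ, hδb⟩ := exists_isCanonicalAut_eq_linEnd
    (P := .diagonal ![b, b⁻¹]) (by simp [Matrix.det_diagonal, hb])
  refine ⟨δ, ⟨hδ, ?_⟩, fun k l m f => by rw [hδb, coeff_linEnd_diagonal]⟩
  rw [hδb, reflEnd, linEnd_mul, linEnd_mul, (Matrix.commute_diagonal _ _).eq]

end SymmetricAutomorphisms

/-! ### The homological equation -/

section HomologicalEquation

/-- The leading part `x y² + a x³` of the normal form. -/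
def leadingHam (a : ℝ) : FSeries := monomial (expo 1 2 0) 1 + monomial (expo 3 0 0) a

lemma coeff_leadingHam (a : ℝ) (k l m : ℕ) : coeff (expo k l m) (leadingHam a) =
    (if k = 1 ∧ l = 2 ∧ m = 0 then 1 else 0) + if k = 3 ∧ l = 0 ∧ m = 0 then a else 0 := by
  classical
  simp only [leadingHam, map_add, coeff_monomial, expo_inj]

lemma leadingHam_mem (a : ℝ) : leadingHam a ∈ ordIdeal 3 :=
  add_mem (monomial_expo_mem 1 2 0 1) (monomial_expo_mem 3 0 0 a)

lemma oddInX_leadingHam (a : ℝ) : OddInX (leadingHam a) := by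
  rw [oddInX_iff_coeff]
  intro k l m hk
  rw [coeff_leadingHam, if_neg, if_neg, add_zero]
  all_goals rintro ⟨rfl, -⟩; exact hk (by decide)

lemma pderiv_zero_monomial (k l m : ℕ) (c : ℝ) :
    pderiv ℝ 0 (monomial (expo k l m) c : FSeries) = monomial (expo (k - 1) l m) (c * k) := by
  classical
  refine series_ext fun i j n => ?_
  simp only [coeff_pderiv_zero, coeff_monomial, expo_inj]
  rcases k with _ | k
  · simp
  · simp only [Nat.add_left_inj, Nat.add_sub_cancel]
    split_ifs with h
    · rw [h.1, Nat.cast_succ]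
    · rw [zero_mul]

lemma pderiv_one_monomial (k l m : ℕ) (c : ℝ) :
    pderiv ℝ 1 (monomial (expo k l m) c : FSeries) = monomial (expo k (l - 1) m) (c * l) := by
  classical
  refine series_ext fun i j n => ?_
  simp only [coeff_pderiv_one, coeff_monomial, expo_inj]
  rcases l with _ | l
  · simp
  · simp only [Nat.add_left_inj, Nat.add_sub_cancel]
    split_ifs with h
    · rw [h.2.1, Nat.cast_succ]
    · rw [zero_mul]

lemma bracket_leadingHam (a : ℝ) (χ : FSeries) : bracket (leadingHam a) χ =
    (monomial (expo 0 2 0) 1 + monomial (expo 2 0 0) (3 * a)) * pderiv ℝ 1 χ -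
      monomial (expo 1 1 0) 2 * pderiv ℝ 0 χ := by
  have h0 : pderiv ℝ 0 (leadingHam a) =
      monomial (expo 0 2 0) 1 + monomial (expo 2 0 0) (3 * a) := by
    rw [leadingHam, map_add, pderiv_zero_monomial, pderiv_zero_monomial]
    norm_num [mul_comm]
  have h1 : pderiv ℝ 1 (leadingHam a) = monomial (expo 1 1 0) 2 := by
    rw [leadingHam, map_add, pderiv_one_monomial, pderiv_one_monomial]
    norm_num
  rw [bracket, h0, h1]

lemma coeff_bracket_leadingHam (a : ℝ) (χ : FSeries) (k l m : ℕ) :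
    coeff (expo k (l + 1) m) (bracket (leadingHam a) χ) =
      ((l : ℝ) - 2 * k) * coeff (expo k l m) χ +
        if 2 ≤ k then 3 * a * (l + 2) * coeff (expo (k - 2) (l + 2) m) χ else 0 := by
  have hyy : coeff (expo k (l + 1) m) (monomial (expo 0 2 0) 1 * pderiv ℝ 1 χ) =
      l * coeff (expo k l m) χ := by
    rw [coeff_monomial_mul_expo]
    rcases l with _ | l
    · simp
    · simp [coeff_pderiv_one, mul_comm]
  have hxy : coeff (expo k (l + 1) m) (monomial (expo 1 1 0) 2 * pderiv ℝ 0 χ) =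
      2 * k * coeff (expo k l m) χ := by
    rw [coeff_monomial_mul_expo]
    rcases k with _ | k
    · simp
    · simp [coeff_pderiv_zero]; ring
  have hxx : coeff (expo k (l + 1) m) (monomial (expo 2 0 0) (3 * a) * pderiv ℝ 1 χ) =
      if 2 ≤ k then 3 * a * (l + 2) * coeff (expo (k - 2) (l + 2) m) χ else 0 := by
    simp only [coeff_monomial_mul_expo, coeff_pderiv_one, Nat.zero_le, and_true, Nat.sub_zero]
    push_cast
    ring_nf
  rw [bracket_leadingHam, add_mul, map_sub, map_add, hyy, hxy, hxx]
  ring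

/-- The coefficients of a solution of the homological equation `{x y² + a x³, χ} = -t` modulo
resonant terms. At the resonances `l = 2 k` the denominator is `0`, and so is the coefficient. -/
def homSolCoeff (a : ℝ) (t : FSeries) (k l m : ℕ) : ℝ :=
  (coeff (expo k (l + 1) m) t +
    if 2 ≤ k then 3 * a * (l + 2) * homSolCoeff a t (k - 2) (l + 2) m else 0) / (2 * k - l)
termination_by k

/-- A solution of the homological equation modulo resonant terms. -/
def homSol (a : ℝ) (t : FSeries) : FSeries := ofCoeffs (homSolCoeff a t)

variable {a : ℝ} {t : FSeries}

lemma homSolCoeff_eq_zero (p : ℕ → ℕ → ℕ → Prop)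
    (hp : ∀ k l m, p (k + 2) l m → p k (l + 2) m)
    (ht : ∀ k l m, l ≠ 2 * k → p k l m → coeff (expo k (l + 1) m) t = 0) (k l m : ℕ)
    (h : p k l m) : homSolCoeff a t k l m = 0 := by
  induction k using Nat.strong_induction_on generalizing l with
  | _ k ih =>
    rw [homSolCoeff]
    by_cases hkl : l = 2 * k
    · simp [hkl]
    · rw [ht _ _ _ hkl h, zero_add, div_eq_zero_iff]
      left
      split_ifs with hk
      · obtain ⟨k, rfl⟩ := Nat.exists_eq_add_of_le' hk
        rw [Nat.add_sub_cancel, ih k (by omega) _ (hp _ _ _ h), mul_zero]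
      · rfl

lemma homSol_mem {n : ℕ}
    (ht : ∀ k l m, l ≠ 2 * k → k + (l + 1) + 3 * m < n + 1 → coeff (expo k (l + 1) m) t = 0) :
    homSol a t ∈ ordIdeal n :=
  mem_ordIdeal_iff.2 <| homSolCoeff_eq_zero (fun k l m => k + l + 3 * m < n)
    (fun k l m h => by omega) fun k l m hkl h => ht _ _ _ hkl (by omega)

lemma oddInX_homSol (ht : OddInX t) : OddInX (homSol a t) := by
  rw [oddInX_iff_coeff] at ht ⊢
  refine homSolCoeff_eq_zero (fun k _ _ => ¬ Odd k) (fun k _ _ h => ?_)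
    (fun k l m _ h => ht _ _ _ h)
  rwa [Nat.odd_add, iff_true_right even_two] at h

lemma coeff_bracket_homSol {k l : ℕ} (hkl : l ≠ 2 * k) (m : ℕ) :
    coeff (expo k (l + 1) m) (bracket (leadingHam a) (homSol a t)) =
      -coeff (expo k (l + 1) m) t := by
  have hne : (2 * (k : ℕ) - l : ℝ) ≠ 0 := by
    rw [sub_ne_zero]; exact_mod_cast hkl.symm
  rw [coeff_bracket_leadingHam, homSol, coeff_ofCoeffs, coeff_ofCoeffs, homSolCoeff]
  split_ifs <;> field_simp <;> ring

end HomologicalEquation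

/-! ### Simplification of odd Hamiltonians -/

section Simplification

variable {a : ℝ} {n : ℕ} {g : FSeries}

/-- Besides the leading part `x y² + a x³`, the Hamiltonian `g` contains only terms of order at
least four, and in order less than `n` these are multiples of `x^k ε^m` and `x^k y^(2k+1) ε^m` with
odd `k`. -/
structure IsSimplifiedBelow (a : ℝ) (n : ℕ) (g : FSeries) : Prop where
  odd : OddInX g
  sub_mem : g - leadingHam a ∈ ordIdeal 4
  coeff_eq_zero : ∀ k l m, l ≠ 2 * k → k + (l + 1) + 3 * m < n →
    coeff (expo k (l + 1) m) (g - leadingHam a) = 0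

/-- The simplified Hamiltonians: besides the leading part `x y² + a x³`, only monomials
`x^k ε^m` and `x^k y^(2k+1) ε^m` with odd `k`, of order at least four. -/
structure IsSimplified (a : ℝ) (g : FSeries) : Prop where
  odd : OddInX g
  sub_mem : g - leadingHam a ∈ ordIdeal 4
  coeff_eq_zero : ∀ k l m, l ≠ 2 * k → coeff (expo k (l + 1) m) (g - leadingHam a) = 0

lemma mem_of_sub_leadingHam_mem (h : g - leadingHam a ∈ ordIdeal 4) : g ∈ ordIdeal 3 := by
  simpa only [sub_add_cancel] using
    add_mem (mem_weightIdeal_of_le h (by omega)) (leadingHam_mem a)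

lemma IsSimplified.mem (h : IsSimplified a g) : g ∈ ordIdeal 3 :=
  mem_of_sub_leadingHam_mem h.sub_mem

lemma oddInX_sub_leadingHam_iff : OddInX (g - leadingHam a) ↔ OddInX g := by
  have hL := oddInX_iff.1 (oddInX_leadingHam a)
  rw [oddInX_iff, oddInX_iff, map_sub, hL]
  constructor <;> intro h <;> linear_combination h

lemma flow_sub_sub_bracket_leadingHam_mem {k : ℕ} {χ : FSeries} (hk : 1 ≤ k)
    (hg : g - leadingHam a ∈ ordIdeal 4) (hχ : χ ∈ ordIdeal (k + 2)) :
    flow χ g - g - bracket (leadingHam a) χ ∈ ordIdeal (k + 4) := by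
  have hflow := flow_sub_sub_bracket_mem hk hχ (mem_of_sub_leadingHam_mem hg)
  have hlead := bracket_mem hg hχ
  rw [bracket_sub_left] at hlead
  rw [← sub_add_sub_cancel _ (bracket g χ)]
  exact add_mem (mem_weightIdeal_of_le hflow (by omega)) (mem_weightIdeal_of_le hlead (by omega))

/-- The flow of a solution `χ` of the homological equation changes the terms of lowest
non-simplified order by `{x y² + a x³, χ}`, which cancels the non-resonant ones. -/
lemma IsSimplifiedBelow.exists_flow (hg : IsSimplifiedBelow a (n + 4) g) :
    ∃ χ ∈ ordIdeal (n + 3), OddInX χ ∧ IsSimplifiedBelow a (n + 5) (flow χ g) := by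
  let χ : FSeries := homSol a (g - leadingHam a)
  have hχ : χ ∈ ordIdeal (n + 3) := homSol_mem hg.coeff_eq_zero
  have hχo : OddInX χ := oddInX_homSol (oddInX_sub_leadingHam_iff.2 hg.odd)
  have hχ3 : χ ∈ ordIdeal 3 := mem_weightIdeal_of_le hχ (by omega)
  have herr := flow_sub_sub_bracket_leadingHam_mem (Nat.le_add_left 1 n) hg.sub_mem hχ
  have hL : bracket (leadingHam a) χ ∈ ordIdeal 4 :=
    mem_weightIdeal_of_le (bracket_mem (leadingHam_mem a) hχ) (by omega)
  have hdec : flow χ g - leadingHam a = g - leadingHam a + bracket (leadingHam a) χ +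
      (flow χ g - g - bracket (leadingHam a) χ) := by ring
  refine ⟨χ, hχ, hχo, (hχo.isSymmetricAut_flowAut hχ3).oddInX hg.odd, ?_, fun k l m hkl hw => ?_⟩
  · rw [hdec]
    exact add_mem (add_mem hg.sub_mem hL) (mem_weightIdeal_of_le herr (by omega))
  · rw [hdec, map_add, map_add, coeff_bracket_homSol hkl, add_neg_cancel, zero_add,
      mem_ordIdeal_iff.1 herr _ _ _ (by omega)]

lemma exists_isSimplified (ho : OddInX g) (hg : g - leadingHam a ∈ ordIdeal 4) :
    ∃ δ : SeriesEndˣ, IsSymmetricAut δ ∧ IsSimplified a ((δ : SeriesEnd) g) := by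
  obtain ⟨u, hu⟩ := exists_seq_of_step
    (P := fun n (δ : SeriesEndˣ) => IsSymmetricAut δ ∧
      IsSimplifiedBelow a (n + 4) ((δ : SeriesEnd) g))
    (Q := fun n δ δ' => Cong famWeight n (δ' : SeriesEnd) δ) (s₀ := 1)
    ⟨IsSymmetricAut.one, ho, hg, fun k l m _ hw => mem_ordIdeal_iff.1 hg _ _ _ hw⟩
    (by
      rintro n δ ⟨hδ, hs⟩
      obtain ⟨χ, hχ, hχo, hs'⟩ := hs.exists_flow
      have hflow : Cong famWeight n (flow χ) 1 :=
        (cong_flow_one (Nat.le_add_left 1 n) hχ).mono (Nat.le_succ n)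
      exact ⟨flowAut χ * δ, ⟨(hχo.isSymmetricAut_flowAut
        (mem_weightIdeal_of_le hχ (by omega))).mul hδ, hs'⟩,
        by simpa only [one_mul, Units.val_mul, coe_flowAut] using
          hflow.mul_right hδ.isFamilyEnd.toIsFiltered⟩)
  obtain ⟨δ, hδ, hlim⟩ := exists_isSymmetricAut_forall_cong (fun n => (hu n).1.1)
    (fun n => (hu n).2)
  have hδu : ∀ n, (δ : SeriesEnd) g - (u n : SeriesEnd) g ∈ ordIdeal n :=
    fun n => by simpa using hlim n (mem_weightIdeal_zero g)
  refine ⟨δ, hδ, hδ.oddInX ho, ?_, fun k l m hkl => ?_⟩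
  · rw [← sub_add_sub_cancel]
    exact add_mem (hδu 4) (hu 4).1.2.sub_mem
  · set N := k + (l + 1) + 3 * m + 1
    rw [← sub_add_sub_cancel _ ((u N : SeriesEnd) g), map_add,
      mem_ordIdeal_iff.1 (hδu N) k (l + 1) m (by omega), zero_add]
    exact (hu N).1.2.coeff_eq_zero k l m hkl (by omega)

lemma sub_leadingHam_mem (ho : OddInX g) (hg : g ∈ ordIdeal 3) (h1 : coeff (expo 1 2 0) g = 1) :
    g - leadingHam (coeff (expo 3 0 0) g) ∈ ordIdeal 4 := by
  rw [mem_ordIdeal_iff] at hg ⊢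
  intro k l m hw
  by_cases hk : Odd k
  · rw [map_sub, coeff_leadingHam]
    obtain ⟨j, rfl⟩ := hk
    by_cases hw3 : 2 * j + 1 + l + 3 * m < 3
    · rw [hg _ _ _ hw3, if_neg (by omega), if_neg (by omega), add_zero, sub_zero]
    · obtain rfl : m = 0 := by omega
      obtain ⟨rfl, rfl⟩ | ⟨rfl, rfl⟩ : (j = 0 ∧ l = 2) ∨ (j = 1 ∧ l = 0) := by omega
      · simp [h1]
      · simp
  · exact oddInX_iff_coeff.1 (oddInX_sub_leadingHam_iff.2 ho) _ _ _ hk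

end Simplification

/-! ### The form of the simplified Hamiltonians -/

section NormalHam

/-- The exponent of the monomial `u^k ε^m` in two variables. -/
def expoTwo (k m : ℕ) : Fin 2 →₀ ℕ := Finsupp.equivFunOnFinite.symm ![k, m]

@[simp] lemma expoTwo_apply_zero (k m : ℕ) : expoTwo k m 0 = k := rfl
@[simp] lemma expoTwo_apply_one (k m : ℕ) : expoTwo k m 1 = m := rfl

lemma expoTwo_eta (d : Fin 2 →₀ ℕ) : expoTwo (d 0) (d 1) = d := by
  ext i; fin_cases i <;> rfl

lemma monomial_expo_pow (i j n k : ℕ) (c : ℝ) :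
    (monomial (expo i j n) c : FSeries) ^ k = monomial (expo (k * i) (k * j) (k * n)) (c ^ k) := by
  rw [monomial_pow]
  congr 2
  ext s; fin_cases s <;> rfl

lemma coeff_subst_monomial {i : ℕ} (hi : i ≠ 0) (j : ℕ) (A : MvPowerSeries (Fin 2) ℝ)
    (k l m : ℕ) :
    coeff (expo k l m) (subst (![monomial (expo i j 0) 1, X 2] : Fin 2 → FSeries) A) =
      if i ∣ k ∧ l = k / i * j then coeff (expoTwo (k / i) m) A else 0 := by
  classical
  have hs : HasSubst (![monomial (expo i j 0) 1, X 2] : Fin 2 → FSeries) := by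
    refine hasSubst_of_constantCoeff_zero fun s => ?_
    fin_cases s
    · exact mem_ordIdeal_one_iff.1
        (mem_weightIdeal_of_le (monomial_expo_mem i j 0 1) (by omega))
    · exact constantCoeff_X _
  rw [coeff_subst hs]
  have hterm : ∀ d : Fin 2 →₀ ℕ, coeff d A • coeff (expo k l m)
      (d.prod fun s e => (![monomial (expo i j 0) 1, X 2] : Fin 2 → FSeries) s ^ e) =
      if k = d 0 * i ∧ l = d 0 * j ∧ m = d 1 then coeff d A else 0 := by
    intro d
    rw [Finsupp.prod_fintype _ _ (fun i => pow_zero _), Fin.prod_univ_two]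
    simp only [Matrix.cons_val_zero, Matrix.cons_val_one]
    rw [X_pow_eq, single_two_eq_expo, monomial_expo_pow, monomial_mul_monomial, expo_add_expo]
    simp [coeff_monomial, expo_inj]
  rw [finsum_congr hterm, finsum_eq_single _ (expoTwo (k / i) m)]
  · simp only [expoTwo_apply_zero, expoTwo_apply_one, and_true]
    congr 1
    rw [eq_iff_iff, Nat.dvd_iff_div_mul_eq, eq_comm]
  · intro d hd
    rw [if_neg]
    rintro ⟨rfl, -, rfl⟩
    exact hd (by rw [Nat.mul_div_cancel _ (Nat.pos_of_ne_zero hi), expoTwo_eta])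

variable {a a' : ℝ} {A B A' B' : MvPowerSeries (Fin 2) ℝ}

lemma normalHam_sub_leadingHam (a : ℝ) (A B : MvPowerSeries (Fin 2) ℝ) :
    normalHam a A B - leadingHam a =
      subst (![monomial (expo 1 0 0) 1, X 2] : Fin 2 → FSeries) A +
        monomial (expo 0 1 0) 1 *
          subst (![monomial (expo 1 2 0) 1, X 2] : Fin 2 → FSeries) B := by
  have hxyy : (X 0 * X 1 ^ 2 : FSeries) = monomial (expo 1 2 0) 1 := by
    rw [X_zero_eq_monomial, X_one_eq_monomial, monomial_expo_pow, monomial_mul_monomial,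
      expo_add_expo, one_pow, one_mul]
  have hxxx : (C a * X 0 ^ 3 : FSeries) = monomial (expo 3 0 0) a := by
    rw [X_pow_eq, single_zero_eq_expo, ← smul_eq_C_mul, ← map_smul, smul_eq_mul, mul_one]
  rw [normalHam, leadingHam, hxyy, hxxx, ← X_zero_eq_monomial, ← X_one_eq_monomial]
  ring

lemma coeff_normalHam_zero (a : ℝ) (A B : MvPowerSeries (Fin 2) ℝ) (k m : ℕ) :
    coeff (expo k 0 m) (normalHam a A B - leadingHam a) = coeff (expoTwo k m) A := by
  rw [normalHam_sub_leadingHam, map_add, coeff_subst_monomial one_ne_zero,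
    coeff_monomial_mul_expo]
  simp

lemma coeff_normalHam_succ (a : ℝ) (A B : MvPowerSeries (Fin 2) ℝ) (k l m : ℕ) :
    coeff (expo k (l + 1) m) (normalHam a A B - leadingHam a) =
      if l = 2 * k then coeff (expoTwo k m) B else 0 := by
  rw [normalHam_sub_leadingHam, map_add, coeff_subst_monomial one_ne_zero,
    coeff_monomial_mul_expo, coeff_subst_monomial one_ne_zero]
  simp [mul_comm]

lemma isSimplified_normalHam (hA : AdmissibleA A) (hB : AdmissibleB B) :
    IsSimplified a (normalHam a A B) := by
  have hA0 : ∀ k m, ¬ (Odd k ∧ 4 ≤ k + 3 * m) → coeff (expoTwo k m) A = 0 := fun k m h =>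
    of_not_not fun h0 => h (hA _ h0)
  have hB0 : ∀ k m, ¬ Odd k → coeff (expoTwo k m) B = 0 := fun k m h =>
    of_not_not fun h0 => h (hB _ h0)
  refine ⟨(oddInX_sub_leadingHam_iff (a := a)).1 (oddInX_iff_coeff.2 fun k l m hk => ?_),
    mem_ordIdeal_iff.2 fun k l m hw => ?_,
    fun k l m hkl => by rw [coeff_normalHam_succ, if_neg hkl]⟩
  · rcases l with _ | l
    · rw [coeff_normalHam_zero, hA0 _ _ fun h => hk h.1]
    · rw [coeff_normalHam_succ, hB0 _ _ hk, ite_self]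
  · rcases l with _ | l
    · rw [coeff_normalHam_zero, hA0 _ _ fun h => by omega]
    · rw [coeff_normalHam_succ]
      split_ifs with hkl
      · exact hB0 _ _ fun ⟨j, hj⟩ => by omega
      · rfl

lemma IsSimplified.exists_eq_normalHam {g : FSeries} (h : IsSimplified a g) :
    ∃ A B, AdmissibleA A ∧ AdmissibleB B ∧ g = normalHam a A B := by
  have hodd := oddInX_iff_coeff.1 ((oddInX_sub_leadingHam_iff (a := a)).2 h.odd)
  let A : MvPowerSeries (Fin 2) ℝ := fun d => coeff (expo (d 0) 0 (d 1)) (g - leadingHam a)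
  let B : MvPowerSeries (Fin 2) ℝ := fun d =>
    coeff (expo (d 0) (2 * d 0 + 1) (d 1)) (g - leadingHam a)
  refine ⟨A, B, fun d hd => ⟨?_, ?_⟩, fun d hd => ?_, ?_⟩
  · exact by_contra fun hk => hd (hodd _ _ _ hk)
  · exact by_contra fun hw => hd (mem_ordIdeal_iff.1 h.sub_mem _ _ _ (by omega))
  · exact by_contra fun hk => hd (hodd _ _ _ hk)
  · rw [← sub_left_inj (a := leadingHam a)]
    refine series_ext fun k l m => ?_
    rcases l with _ | l
    · rw [coeff_normalHam_zero]; rfl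
    · rw [coeff_normalHam_succ]
      split_ifs with hkl
      · rw [hkl]; rfl
      · exact h.coeff_eq_zero k l m hkl

lemma IsSimplified.coeff_expo_three {g : FSeries} (h : IsSimplified a g) :
    coeff (expo 3 0 0) g = a := by
  have h3 := mem_ordIdeal_iff.1 h.sub_mem 3 0 0 (by omega)
  rw [map_sub, coeff_leadingHam] at h3
  simpa [sub_eq_zero] using h3

lemma normalHam_injective (hA : AdmissibleA A) (hB : AdmissibleB B) (hA' : AdmissibleA A')
    (hB' : AdmissibleB B') (h : normalHam a A B = normalHam a' A' B') :
    a = a' ∧ A = A' ∧ B = B' := by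
  obtain rfl : a = a' := by
    rw [← (isSimplified_normalHam (a := a) hA hB).coeff_expo_three, h,
      (isSimplified_normalHam hA' hB').coeff_expo_three]
  refine ⟨rfl, ?_, ?_⟩
  · ext d
    rw [← expoTwo_eta d, ← coeff_normalHam_zero a A B, h, coeff_normalHam_zero]
  · ext d
    have hd := coeff_normalHam_succ a A B (d 0) (2 * d 0) (d 1)
    rw [h, coeff_normalHam_succ, if_pos rfl, if_pos rfl, expoTwo_eta] at hd
    exact hd.symm

end NormalHam

/-! ### Conjugacies between reflected flows -/

section Conjugacy

variable {n : ℕ} {a b f h h' : FSeries} {δ : SeriesEndˣ}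

/-- Removal of the terms that depend only on the parameter; these do not affect the flow. -/
def dropConst : FSeries →ₗ[ℝ] FSeries where
  toFun f := ofCoeffs fun k l m => if k = 0 ∧ l = 0 then 0 else coeff (expo k l m) f
  map_add' f g := series_ext fun k l m => by
    simp only [map_add, coeff_ofCoeffs]; split_ifs <;> simp
  map_smul' c f := series_ext fun k l m => by simp

lemma coeff_dropConst (f : FSeries) (k l m : ℕ) : coeff (expo k l m) (dropConst f) =
    if k = 0 ∧ l = 0 then 0 else coeff (expo k l m) f := by
  simp [dropConst]

lemma dropConst_mem (hf : f ∈ ordIdeal n) : dropConst f ∈ ordIdeal n := by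
  rw [mem_ordIdeal_iff] at hf ⊢
  intro k l m hw
  rw [coeff_dropConst, hf _ _ _ hw, ite_self]

lemma pderiv_zero_dropConst (f : FSeries) : pderiv ℝ 0 (dropConst f) = pderiv ℝ 0 f :=
  series_ext fun k l m => by
    rw [coeff_pderiv_zero, coeff_pderiv_zero, coeff_dropConst, if_neg (by omega)]

lemma pderiv_one_dropConst (f : FSeries) : pderiv ℝ 1 (dropConst f) = pderiv ℝ 1 f :=
  series_ext fun k l m => by
    rw [coeff_pderiv_one, coeff_pderiv_one, coeff_dropConst, if_neg (by omega)]

lemma hamDer_dropConst (f : FSeries) : hamDer (dropConst f) = hamDer f := by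
  rw [hamDer, hamDer, pderiv_zero_dropConst, pderiv_one_dropConst]

lemma OddInX.dropConst_eq (h : OddInX f) : dropConst f = f := by
  refine series_ext fun k l m => ?_
  rw [coeff_dropConst]
  split_ifs with h0
  · rw [oddInX_iff_coeff.1 h]
    rw [h0.1]
    decide
  · rfl

lemma dropConst_mem_succ (h0 : pderiv ℝ 0 f ∈ ordIdeal n) (h1 : pderiv ℝ 1 f ∈ ordIdeal n) :
    dropConst f ∈ ordIdeal (n + 1) := by
  rw [mem_ordIdeal_iff] at h0 h1 ⊢
  intro k l m hw
  rw [coeff_dropConst]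
  rcases k with _ | k
  · rcases l with _ | l
    · exact if_pos ⟨rfl, rfl⟩
    · have hcoeff := h1 0 l m (by omega)
      rw [coeff_pderiv_one] at hcoeff
      rw [if_neg (by omega)]
      exact (mul_eq_zero.1 hcoeff).resolve_right (by positivity)
  · have hcoeff := h0 k l m (by omega)
    rw [coeff_pderiv_zero] at hcoeff
    rw [if_neg (by omega)]
    exact (mul_eq_zero.1 hcoeff).resolve_right (by positivity)

lemma flow_eq_of_hamDer_eq (ha : a ∈ ordIdeal 3) (hb : b ∈ ordIdeal 3)
    (h : hamDer a = hamDer b) : flow a = flow b := by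
  ext1 f
  rw [flow_apply ha, flow_apply hb, h]

lemma dropConst_eq_of_flow_eq (ha : a ∈ ordIdeal 3) (hb : b ∈ ordIdeal 3)
    (h : flow a = flow b) : dropConst a = dropConst b := by
  have hmem : ∀ k, dropConst (a - b) ∈ ordIdeal (k + 3) := by
    intro k
    induction k with
    | zero => exact dropConst_mem (sub_mem ha hb)
    | succ k ih =>
      have hflow : flow (b + dropConst (a - b)) = flow b := by
        rw [← h]
        refine flow_eq_of_hamDer_eq (add_mem hb (mem_weightIdeal_of_le ih (by omega))) ha ?_
        rw [hamDer_add, hamDer_dropConst, ← hamDer_add, add_sub_cancel]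
      have h0 := flow_add_sub_sub_bracket_mem (k := k + 1) (by omega) hb ih X_zero_mem
      have h1 := flow_add_sub_sub_bracket_mem (k := k + 1) (by omega) hb ih X_one_mem
      rw [hflow, sub_self, zero_sub, neg_mem_iff, bracket_X_zero, pderiv_one_dropConst] at h0
      rw [hflow, sub_self, zero_sub, neg_mem_iff, bracket_X_one, neg_mem_iff,
        pderiv_zero_dropConst] at h1
      exact mem_weightIdeal_of_le (dropConst_mem_succ h1 h0) (by omega)
  refine eq_of_forall_sub_mem_weightIdeal (w := famWeight) fun n => ?_
  rw [← map_sub]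
  exact mem_weightIdeal_of_le (hmem n) (by omega)

lemma OddInX.flow_mul_reflEnd_sq (ho : OddInX h) (hh : h ∈ ordIdeal 3) :
    flow h * reflEnd * (flow h * reflEnd) = flow ((2 : ℝ) • h) := by
  rw [mul_assoc, ← mul_assoc reflEnd, ho.reflEnd_mul_flow hh, mul_assoc (flow h),
    reflEnd_mul_self, mul_one, flow_mul_flow_self hh]

/-- The square of a reflected flow is the flow of twice the Hamiltonian, which determines the
Hamiltonian up to a function of the parameter. -/
lemma IsCanonicalAut.dropConst_eq_of_conj (hδ : IsCanonicalAut δ) (hh : h ∈ ordIdeal 3)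
    (hh' : h' ∈ ordIdeal 3) (ho : OddInX h) (ho' : OddInX h')
    (hconj : (δ : SeriesEnd) * (flow h * reflEnd) = flow h' * reflEnd * δ) :
    dropConst ((δ : SeriesEnd) h) = h' := by
  have hsq : (δ : SeriesEnd) * flow ((2 : ℝ) • h) = flow ((2 : ℝ) • h') * δ := by
    rw [← ho.flow_mul_reflEnd_sq hh, ← ho'.flow_mul_reflEnd_sq hh', ← mul_assoc, hconj, mul_assoc,
      hconj]
    simp only [mul_assoc]
  rw [hδ.mul_flow (smul_mem_weightIdeal 2 hh), Units.mul_left_inj, map_smul] at hsq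
  have hdrop := dropConst_eq_of_flow_eq (smul_mem_weightIdeal 2 (hδ.isFamilyEnd.mem hh))
    (smul_mem_weightIdeal 2 hh') hsq
  rw [map_smul, map_smul, ho'.dropConst_eq] at hdrop
  exact smul_right_injective _ (two_ne_zero (α := ℝ)) hdrop

lemma IsCanonicalAut.isSymmetricAut_of_conj (hδ : IsCanonicalAut δ) (hh : h ∈ ordIdeal 3)
    (hh' : h' ∈ ordIdeal 3) (ho : OddInX h) (ho' : OddInX h')
    (hconj : (δ : SeriesEnd) * (flow h * reflEnd) = flow h' * reflEnd * δ) :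
    IsSymmetricAut δ ∧ (δ : SeriesEnd) h = h' := by
  have hdrop := hδ.dropConst_eq_of_conj hh hh' ho ho' hconj
  have hflow : flow ((δ : SeriesEnd) h) = flowAut h' :=
    flow_eq_of_hamDer_eq (hδ.isFamilyEnd.mem hh) hh' (by rw [← hdrop, hamDer_dropConst])
  have hcomm : reflEnd * (δ : SeriesEnd) = δ * reflEnd := by
    rw [← mul_assoc, hδ.mul_flow hh, hflow, ← coe_flowAut, mul_assoc, mul_assoc,
      Units.mul_right_inj] at hconj
    exact hconj.symm
  have hsymm : IsSymmetricAut δ := ⟨hδ, hcomm⟩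
  exact ⟨hsymm, by rw [← hdrop, (hsymm.oddInX ho).dropConst_eq]⟩

lemma IsSymmetricAut.inv (hδ : IsSymmetricAut δ) : IsSymmetricAut δ⁻¹ where
  toIsCanonicalAut := hδ.toIsCanonicalAut.inv
  comm := by
    rw [Units.eq_inv_mul_iff_mul_eq, ← mul_assoc, ← hδ.comm, mul_assoc, Units.mul_inv, mul_one]

end Conjugacy

/-! ### Uniqueness of the simplified Hamiltonian -/

section LinearPart

variable {a a' : ℝ} {g g' : FSeries} {δ : SeriesEndˣ}

lemma constantCoeff_jacDet (F : FormalMap) : constantCoeff (jacDet F) = (linearPart F).det := by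
  have hzero (i : Fin 2) : constantCoeff (pderiv ℝ 0 (F i)) = linearPart F i 0 := by
    rw [← coeff_zero_eq_constantCoeff_apply, ← expo_zero, coeff_pderiv_zero, zero_add,
      ← single_zero_eq_expo]
    simp [linearPart]
  have hone (i : Fin 2) : constantCoeff (pderiv ℝ 1 (F i)) = linearPart F i 1 := by
    rw [← coeff_zero_eq_constantCoeff_apply, ← expo_zero, coeff_pderiv_one, zero_add,
      ← single_one_eq_expo]
    simp [linearPart]
  simp only [jacDet, map_sub, map_mul, hzero, hone, Matrix.det_fin_two]

lemma IsSymmetricAut.exists_cong_linEnd_diagonal (hδ : IsSymmetricAut δ) :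
    ∃ p : ℝ, p ≠ 0 ∧ Cong famWeight 1 (δ : SeriesEnd) (linEnd (.diagonal ![p, p⁻¹])) := by
  let P := linearPart (toMap δ)
  have hcong : Cong famWeight 1 (δ : SeriesEnd) (linEnd P) := by
    simpa only [hδ.isFamilyEnd.pull_toMap] using cong_pull_linEnd hδ.isFamilyEnd.fixesOrigin_toMap
  have h01 : P 0 1 = 0 := by
    have hodd : OddInX ((δ : SeriesEnd) (X 0)) := hδ.oddInX (oddInX_iff.2 reflEnd_X_zero)
    have hcoeff := oddInX_iff_coeff.1 hodd 0 1 0 (by decide)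
    rwa [← single_one_eq_expo] at hcoeff
  have h10 : P 1 0 = 0 := by
    have heven : reflEnd ((δ : SeriesEnd) (X 1)) = (δ : SeriesEnd) (X 1) := by
      rw [← AlgHom.mul_apply, hδ.comm, AlgHom.mul_apply, reflEnd_X_one]
    have hcoeff := coeff_reflEnd 1 0 0 ((δ : SeriesEnd) (X 1))
    rw [heven, ← single_zero_eq_expo] at hcoeff
    change coeff (Finsupp.single 0 1) ((δ : SeriesEnd) (X 1)) = 0
    linarith
  have hdet : P 0 0 * P 1 1 = 1 := by
    have hdet := constantCoeff_jacDet (toMap δ)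
    rw [(hδ.isFamilyEnd.isCanonical_toMap hδ.scalesBracket).jacDet_eq, map_one,
      Matrix.det_fin_two] at hdet
    change 1 = P 0 0 * P 1 1 - P 0 1 * P 1 0 at hdet
    rw [hdet, h01, zero_mul, sub_zero]
  refine ⟨P 0 0, left_ne_zero_of_mul_eq_one hdet, ?_⟩
  convert hcong
  ext i j
  fin_cases i <;> fin_cases j <;> simp [h01, h10, (eq_inv_of_mul_eq_one_right hdet)]

lemma IsSimplified.coeff_expo_one_two (hg : IsSimplified a g) : coeff (expo 1 2 0) g = 1 := by
  have hcoeff := mem_ordIdeal_iff.1 hg.sub_mem 1 2 0 (by omega)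
  rw [map_sub, coeff_leadingHam] at hcoeff
  simpa [sub_eq_zero] using hcoeff

lemma IsSymmetricAut.cong_one_of_isSimplified (hδ : IsSymmetricAut δ) (hg : IsSimplified a g)
    (hg' : IsSimplified a' ((δ : SeriesEnd) g)) : Cong famWeight 1 (δ : SeriesEnd) 1 := by
  obtain ⟨p, hp, hcong⟩ := hδ.exists_cong_linEnd_diagonal
  have hcoeff := mem_ordIdeal_iff.1 (hcong hg.mem) 1 2 0 (by omega)
  rw [map_sub, coeff_linEnd_diagonal, hg.coeff_expo_one_two, hg'.coeff_expo_one_two] at hcoeff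
  have hp1 : p = 1 := by
    field_simp at hcoeff
    linarith
  have hdiag : Matrix.diagonal ![p, p⁻¹] = 1 := by
    rw [hp1, inv_one, ← Matrix.diagonal_one]
    congr 1
    ext i
    fin_cases i <;> rfl
  rwa [hdiag, linEnd_one] at hcong

end LinearPart

section Resonance

variable {a : ℝ} {k n : ℕ} {g p q : FSeries}

lemma coeff_pow_resonant (hg : g - leadingHam a ∈ ordIdeal 4) {s i l m : ℕ}
    (hw : i + l + 3 * m = 3 * s) (his : i ≤ s) :
    coeff (expo i l m) (g ^ s) = if i = s ∧ l = 2 * s ∧ m = 0 then 1 else 0 := by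
  induction s generalizing i l m with
  | zero =>
    obtain ⟨rfl, rfl, rfl⟩ : i = 0 ∧ l = 0 ∧ m = 0 := by omega
    rw [pow_zero, expo_zero, coeff_zero_one, if_pos (by simp)]
  | succ s ih =>
    have hrest := mul_mem_weightIdeal hg (pow_mem_weightIdeal (mem_of_sub_leadingHam_mem hg) s)
    have hsplit : g ^ (s + 1) = monomial (expo 1 2 0) 1 * g ^ s +
        monomial (expo 3 0 0) a * g ^ s + (g - leadingHam a) * g ^ s := by
      rw [leadingHam]; ring
    have hcubic : (if 3 ≤ i ∧ 0 ≤ l ∧ 0 ≤ m then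
        a * coeff (expo (i - 3) (l - 0) (m - 0)) (g ^ s) else 0) = 0 := by
      split_ifs with h
      · rw [ih (by omega) (by omega), if_neg (by omega), mul_zero]
      · rfl
    rw [hsplit, map_add, mem_ordIdeal_iff.1 hrest i l m (by omega), add_zero, map_add,
      coeff_monomial_mul_expo, coeff_monomial_mul_expo, one_mul, hcubic, add_zero]
    split_ifs with h h' h'
    · rw [ih (by omega) (by omega), if_pos (by omega)]
    · rw [ih (by omega) (by omega), if_neg (by omega)]
    · omega
    · rfl

/-- The combination of the products `g^s ε^m` with `s + m = n` that, when `g` has the leading part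
`x y² + a x³`, has the same coefficients at `x^s y^(2s) ε^m` as `q`. -/
def resonantPart (g q : FSeries) (n : ℕ) : FSeries :=
  ∑ p ∈ antidiagonal n,
    monomial (expo 0 0 p.2) (coeff (expo p.1 (2 * p.1) p.2) q) * g ^ p.1

lemma resonantPart_mem (hg : g ∈ ordIdeal 3) (hq : q ∈ ordIdeal k) :
    resonantPart g q (k / 3) ∈ ordIdeal k := by
  refine sum_mem fun ⟨s, m⟩ hp => ?_
  have hsm : s + m = k / 3 := mem_antidiagonal.1 hp
  by_cases h : 3 * (k / 3) = k
  · exact mem_weightIdeal_of_le (mul_mem_weightIdeal (monomial_expo_mem 0 0 m _)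
      (pow_mem_weightIdeal hg s)) (by omega)
  · rw [mem_ordIdeal_iff.1 hq s (2 * s) m (by omega), map_zero, zero_mul]
    exact zero_mem _

lemma reflEnd_monomial_two (m : ℕ) (c : ℝ) :
    reflEnd (monomial (expo 0 0 m) c) = monomial (expo 0 0 m) c := by
  classical
  refine series_ext fun i j n => ?_
  rw [coeff_reflEnd]
  simp only [coeff_monomial, expo_inj]
  split_ifs with h
  · rw [h.1, pow_zero, one_mul]
  · rw [mul_zero]

lemma oddInX_resonantPart (hg : OddInX g) (hq : OddInX q) (n : ℕ) :
    OddInX (resonantPart g q n) := by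
  rw [oddInX_iff, resonantPart, map_sum, ← Finset.sum_neg_distrib]
  refine Finset.sum_congr rfl fun p _ => ?_
  by_cases hp : Odd p.1
  · rw [map_mul, map_pow, reflEnd_monomial_two, oddInX_iff.1 hg, hp.neg_pow, mul_neg]
  · rw [oddInX_iff_coeff.1 hq _ _ _ hp, map_zero, zero_mul, map_zero, neg_zero]

lemma bracket_resonantPart (g q : FSeries) (n : ℕ) : bracket (resonantPart g q n) g = 0 := by
  rw [← hamDer_apply, resonantPart, map_sum]
  refine Finset.sum_eq_zero fun p _ => ?_
  have hparam (c : ℝ) : hamDer g (monomial (expo 0 0 p.2) c) = 0 := by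
    simp [hamDer_apply, bracket, pderiv_zero_monomial, pderiv_one_monomial]
  have hpow : hamDer g (g ^ p.1) = 0 := by
    rw [Derivation.leibniz_pow, hamDer_apply, bracket_self, smul_zero, smul_zero]
  rw [Derivation.leibniz, hparam, hpow, smul_zero, smul_zero, add_zero]

lemma coeff_resonantPart (hg : g - leadingHam a ∈ ordIdeal 4) (q : FSeries) (i m : ℕ) :
    coeff (expo i (2 * i) m) (resonantPart g q (i + m)) = coeff (expo i (2 * i) m) q := by
  rw [resonantPart, map_sum, Finset.sum_eq_single (i, m)]
  · rw [coeff_monomial_mul_expo, if_pos ⟨Nat.zero_le _, Nat.zero_le _, le_rfl⟩,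
      coeff_pow_resonant hg (by simp only; omega) (by simp), if_pos (by simp), mul_one]
  · rintro ⟨s, n⟩ hp hne
    have hsn : s + n = i + m := mem_antidiagonal.1 hp
    have hns : i = s → n ≠ m := by rintro rfl rfl; exact hne rfl
    rw [coeff_monomial_mul_expo]
    split_ifs with h
    · simp only at h ⊢
      rw [coeff_pow_resonant hg (by omega) (by omega), if_neg (by omega), mul_zero]
    · rfl
  · exact fun h => absurd (mem_antidiagonal.2 (show (i, m).1 + (i, m).2 = i + m from rfl)) h

/-- Off the resonances `l = 2k`, the operator `{L, ·}` is triangular with non-zero diagonal. -/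
lemma mem_succ_of_bracket_leadingHam (hp : p ∈ ordIdeal n)
    (hres : ∀ i m, 3 * (i + m) = n → coeff (expo i (2 * i) m) p = 0)
    (hbr : ∀ i l m, l ≠ 2 * i → i + l + 3 * m = n →
      coeff (expo i (l + 1) m) (bracket (leadingHam a) p) = 0) : p ∈ ordIdeal (n + 1) := by
  have hcoeff : ∀ i l m, i + l + 3 * m = n → coeff (expo i l m) p = 0 := by
    intro i
    induction i using Nat.strong_induction_on with
    | _ i ih =>
      intro l m hw
      rcases eq_or_ne l (2 * i) with rfl | hl
      · exact hres i m (by omega)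
      · have hlow : (if 2 ≤ i then 3 * a * (l + 2) * coeff (expo (i - 2) (l + 2) m) p else 0) =
            0 := by
          split_ifs with h
          · rw [ih (i - 2) (by omega) (l + 2) m (by omega), mul_zero]
          · rfl
        have hdiag := hbr i l m hl hw
        rw [coeff_bracket_leadingHam, hlow, add_zero] at hdiag
        exact (mul_eq_zero.1 hdiag).resolve_left (sub_ne_zero.2 (by exact_mod_cast hl))
  rw [mem_ordIdeal_iff] at hp ⊢
  intro i l m hw
  rcases Nat.lt_succ_iff_lt_or_eq.1 hw with hlt | heq
  · exact hp _ _ _ hlt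
  · exact hcoeff _ _ _ heq

end Resonance

section Rigidity

variable {a a' : ℝ} {k : ℕ} {g q : FSeries} {γ : SeriesEnd} {δ : SeriesEndˣ}

lemma map_sub_sub_bracket_generator_mem (hk : 1 ≤ k) (hγ : IsFamilyEnd γ)
    (hb : ScalesBracket 1 γ) (hc : Cong famWeight k γ 1) (hg : g - leadingHam a ∈ ordIdeal 4) :
    γ g - g - bracket (leadingHam a) (generator γ) ∈ ordIdeal (k + 4) := by
  have hflow := flow_sub_sub_bracket_leadingHam_mem hk hg (generator_mem hc)
  have hgen := cong_flow_generator hk hγ hb hc (mem_of_sub_leadingHam_mem hg)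
  have hsum := add_mem (mem_weightIdeal_of_le (m := k + 4) hgen (by omega)) hflow
  convert hsum using 1
  ring

lemma bracket_leadingHam_resonantPart_mem (hg : g - leadingHam a ∈ ordIdeal 4)
    (hq : q ∈ ordIdeal k) :
    bracket (leadingHam a) (resonantPart g q (k / 3)) ∈ ordIdeal (k + 2) := by
  have hmem := bracket_mem hg (resonantPart_mem (mem_of_sub_leadingHam_mem hg) hq)
  rw [bracket_sub_left, bracket_antisymm g, bracket_resonantPart, neg_zero, zero_sub,
    neg_mem_iff] at hmem
  exact mem_weightIdeal_of_le hmem (by omega)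

lemma map_sub_sub_bracket_sub_resonantPart_mem (hk : 1 ≤ k) (hγ : IsFamilyEnd γ)
    (hb : ScalesBracket 1 γ) (hc : Cong famWeight k γ 1) (hg : g - leadingHam a ∈ ordIdeal 4) :
    γ g - g - bracket (leadingHam a)
      (generator γ - resonantPart g (generator γ) ((k + 2) / 3)) ∈ ordIdeal (k + 4) := by
  rw [bracket_sub_right, ← sub_add]
  exact add_mem (map_sub_sub_bracket_generator_mem hk hγ hb hc hg)
    (bracket_leadingHam_resonantPart_mem hg (generator_mem hc))

lemma IsSymmetricAut.generator_sub_resonantPart_mem (hδ : IsSymmetricAut δ) (hk : 1 ≤ k)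
    (hc : Cong famWeight k (δ : SeriesEnd) 1) (hg : IsSimplified a g)
    (hg' : IsSimplified a ((δ : SeriesEnd) g)) :
    generator δ - resonantPart g (generator δ) ((k + 2) / 3) ∈ ordIdeal (k + 3) := by
  have hq := generator_mem hc
  refine mem_succ_of_bracket_leadingHam (a := a) (sub_mem hq (resonantPart_mem hg.mem hq)) ?_ ?_
  · intro i m him
    rw [map_sub, show (k + 2) / 3 = i + m by omega, coeff_resonantPart hg.sub_mem, sub_self]
  · intro i l m hl hw
    have hmem := map_sub_sub_bracket_sub_resonantPart_mem hk hδ.isFamilyEnd hδ.scalesBracket hc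
      hg.sub_mem
    have hcoeff := mem_ordIdeal_iff.1 hmem i (l + 1) m (by omega)
    have hdiff : (δ : SeriesEnd) g - g =
        ((δ : SeriesEnd) g - leadingHam a) - (g - leadingHam a) := by ring
    rwa [map_sub, hdiff, map_sub, hg.coeff_eq_zero i l m hl, hg'.coeff_eq_zero i l m hl, sub_zero,
      zero_sub, neg_eq_zero] at hcoeff

lemma IsSymmetricAut.map_sub_mem (hδ : IsSymmetricAut δ) (hk : 1 ≤ k)
    (hc : Cong famWeight k (δ : SeriesEnd) 1) (hg : IsSimplified a g)
    (hg' : IsSimplified a ((δ : SeriesEnd) g)) : (δ : SeriesEnd) g - g ∈ ordIdeal (k + 4) := by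
  have hbr := bracket_mem (leadingHam_mem a) (hδ.generator_sub_resonantPart_mem hk hc hg hg')
  have hmem := map_sub_sub_bracket_sub_resonantPart_mem hk hδ.isFamilyEnd hδ.scalesBracket hc
    hg.sub_mem
  rw [← sub_add_cancel ((δ : SeriesEnd) g - g)]
  exact add_mem hmem (mem_weightIdeal_of_le hbr (by omega))

/-- The flow of the resonant part of the generator preserves `g`, so that it can be split off. -/
lemma IsSymmetricAut.exists_cong_succ (hδ : IsSymmetricAut δ) (hk : 1 ≤ k)
    (hc : Cong famWeight k (δ : SeriesEnd) 1) (hg : IsSimplified a g)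
    (hg' : IsSimplified a ((δ : SeriesEnd) g)) :
    ∃ δ' : SeriesEndˣ, IsSymmetricAut δ' ∧ Cong famWeight (k + 1) (δ' : SeriesEnd) 1 ∧
      (δ' : SeriesEnd) g = (δ : SeriesEnd) g := by
  let q := generator δ
  let f := resonantPart g q ((k + 2) / 3)
  have hq : q ∈ ordIdeal (k + 2) := generator_mem hc
  have hf : -f ∈ ordIdeal (k + 2) := neg_mem (resonantPart_mem hg.mem hq)
  have hodd : OddInX (-f) := by
    rw [oddInX_iff, map_neg,
      oddInX_iff.1 (oddInX_resonantPart hg.odd (oddInX_generator hδ.comm) _)]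
  have hfix : flow (-f) g = g := by
    apply flow_apply_of_bracket_eq_zero
    rw [bracket_antisymm, ← hamDer_apply, map_neg, hamDer_apply, bracket_resonantPart, neg_zero,
      neg_zero]
  refine ⟨δ * flowAut (-f), hδ.mul (hodd.isSymmetricAut_flowAut
    (mem_weightIdeal_of_le hf (by omega))), ?_, ?_⟩
  · have hpert := (cong_flow_generator hk hδ.isFamilyEnd hδ.scalesBracket hc).mul_right
      (isFamilyEnd_flow (-f)).toIsFiltered
    have hmul := cong_flow_mul_flow hk (mem_weightIdeal_of_le hq (by omega)) hf
    have hone : Cong famWeight (k + 1) (flow (q + -f)) 1 := cong_flow_one (by omega) (by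
      simpa only [sub_eq_add_neg] using hδ.generator_sub_resonantPart_mem hk hc hg hg')
    exact (hpert.trans hmul).trans hone
  · rw [Units.val_mul, AlgHom.mul_apply, coe_flowAut, hfix]

lemma IsSymmetricAut.eq_of_isSimplified (hδ : IsSymmetricAut δ) (hg : IsSimplified a g)
    (hg' : IsSimplified a' ((δ : SeriesEnd) g)) : (δ : SeriesEnd) g = g := by
  have hone := hδ.cong_one_of_isSimplified hg hg'
  obtain rfl : a = a' := by
    have hcoeff := mem_ordIdeal_iff.1 (hone hg.mem) 3 0 0 (by omega)
    rw [map_sub, AlgHom.one_apply, hg.coeff_expo_three, hg'.coeff_expo_three] at hcoeff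
    linarith
  have hstep (k : ℕ) : ∃ δ' : SeriesEndˣ, IsSymmetricAut δ' ∧
      Cong famWeight (k + 1) (δ' : SeriesEnd) 1 ∧ (δ' : SeriesEnd) g = (δ : SeriesEnd) g := by
    induction k with
    | zero => exact ⟨δ, hδ, hone, rfl⟩
    | succ k ih =>
      obtain ⟨δ₁, hδ₁, hc, heq⟩ := ih
      rw [← heq] at hg' ⊢
      exact hδ₁.exists_cong_succ (Nat.le_add_left 1 k) hc hg hg'
  refine eq_of_forall_sub_mem_weightIdeal (w := famWeight) fun n => ?_
  obtain ⟨δ₁, hδ₁, hc, heq⟩ := hstep n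
  rw [← heq] at hg' ⊢
  exact mem_weightIdeal_of_le (hδ₁.map_sub_mem (Nat.le_add_left 1 n) hc hg hg') (by omega)

end Rigidity

/-! ### The normal form of a formal family -/

section NormalForm

variable {F : FormalMap} {h h' : FSeries} {δ : SeriesEndˣ}

lemma exists_isSymmetricAut_isSimplified (ho : OddInX h) (hh : h ∈ ordIdeal 3)
    (hb : coeff (expo 1 2 0) h ≠ 0) :
    ∃ a : ℝ, ∃ δ : SeriesEndˣ, IsSymmetricAut δ ∧ IsSimplified a ((δ : SeriesEnd) h) := by
  obtain ⟨δ₁, hδ₁, hcoeff⟩ := exists_isSymmetricAut_coeff hb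
  have hone : coeff (expo 1 2 0) ((δ₁ : SeriesEnd) h) = 1 := by
    rw [hcoeff]
    field_simp
  obtain ⟨δ₂, hδ₂, hs⟩ := exists_isSimplified (hδ₁.oddInX ho)
    (sub_leadingHam_mem (hδ₁.oddInX ho) (hδ₁.isFamilyEnd.mem hh) hone)
  exact ⟨_, δ₂ * δ₁, hδ₂.mul hδ₁, hs⟩

lemma IsSymmetricAut.conjToReflectedFlow (hδ : IsSymmetricAut δ) (hF : FixesOrigin F)
    (hh : h ∈ ordIdeal 3) (hc : ConjToReflectedFlow F h) :
    ConjToReflectedFlow F ((δ : SeriesEnd) h) := by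
  obtain ⟨β, hβ, heq⟩ := (conjToReflectedFlow_iff hF hh).1 hc
  refine (conjToReflectedFlow_iff hF (hδ.isFamilyEnd.mem hh)).2
    ⟨β * δ⁻¹, hβ.mul hδ.toIsCanonicalAut.inv, ?_⟩
  rw [Units.val_mul, ← mul_assoc, heq, Units.mul_inv_eq_iff_eq_mul, mul_assoc, mul_assoc,
    Units.mul_right_inj, Units.eq_inv_mul_iff_mul_eq, hδ.mul_flow_mul_reflEnd hh]

lemma IsTakensHamiltonian.exists_isSymmetricAut_eq (hF : FixesOrigin F)
    (hh : IsTakensHamiltonian F h) (hh' : IsTakensHamiltonian F h') :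
    ∃ δ : SeriesEndˣ, IsSymmetricAut δ ∧ (δ : SeriesEnd) h = h' := by
  obtain ⟨ho, hh3, hc⟩ := hh
  obtain ⟨ho', hh3', hc'⟩ := hh'
  rw [orderAtLeastThree_iff] at hh3 hh3'
  obtain ⟨β, hβ, heq⟩ := (conjToReflectedFlow_iff hF hh3).1 hc
  obtain ⟨β', hβ', heq'⟩ := (conjToReflectedFlow_iff hF hh3').1 hc'
  refine ⟨β'⁻¹ * β, (hβ'.inv.mul hβ).isSymmetricAut_of_conj hh3 hh3' ho ho' ?_⟩
  calc ((β'⁻¹ * β : SeriesEndˣ) : SeriesEnd) * (flow h * reflEnd)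
      = (↑β'⁻¹ : SeriesEnd) * (pull hF * β) := by rw [Units.val_mul, heq, mul_assoc]
    _ = (↑β'⁻¹ : SeriesEnd) * (pull hF * β') * ((↑β'⁻¹ : SeriesEnd) * β) := by
        simp only [mul_assoc, Units.mul_inv_cancel_left]
    _ = flow h' * reflEnd * ((β'⁻¹ * β : SeriesEndˣ) : SeriesEnd) := by
        rw [heq', Units.inv_mul_cancel_left, Units.val_mul]

lemma IsTakensHamiltonian.existsUnique_normalHam (hF : FixesOrigin F)
    (hh : IsTakensHamiltonian F h) (hb : coeff (expo 1 2 0) h ≠ 0) :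
    ∃! p : ℝ × MvPowerSeries (Fin 2) ℝ × MvPowerSeries (Fin 2) ℝ,
      AdmissibleA p.2.1 ∧ AdmissibleB p.2.2 ∧
        ConjToReflectedFlow F (normalHam p.1 p.2.1 p.2.2) := by
  have hh3 := orderAtLeastThree_iff.1 hh.2.1
  obtain ⟨a, δ, hδ, hs⟩ := exists_isSymmetricAut_isSimplified hh.1 hh3 hb
  obtain ⟨A, B, hA, hB, hnormal⟩ := hs.exists_eq_normalHam
  refine ⟨(a, A, B), ⟨hA, hB, hnormal ▸ hδ.conjToReflectedFlow hF hh3 hh.2.2⟩, ?_⟩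
  rintro ⟨a', A', B'⟩ ⟨hA', hB', hc'⟩
  have hs' := isSimplified_normalHam (a := a') hA' hB'
  obtain ⟨η, hη, heq⟩ := hh.exists_isSymmetricAut_eq hF
    ⟨hs'.odd, orderAtLeastThree_iff.2 hs'.mem, hc'⟩
  have hmap : ((η * δ⁻¹ : SeriesEndˣ) : SeriesEnd) ((δ : SeriesEnd) h) = normalHam a' A' B' := by
    rw [Units.val_mul, AlgHom.mul_apply, units_inv_apply, heq]
  have hfix := (hη.mul hδ.inv).eq_of_isSimplified hs (hmap ▸ hs')
  obtain ⟨rfl, rfl, rfl⟩ := normalHam_injective hA' hB' hA hB (by rw [← hmap, hfix, hnormal])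
  rfl

end NormalForm

/-! ### Taylor series of smooth families -/

section PderivClosure

variable {σ R : Type*} [CommRing R] [NoZeroDivisors R] [CharZero R]

lemma eq_zero_of_pderiv_mem_closure {S : Set (MvPowerSeries σ R)}
    (h0 : ∀ f ∈ S, constantCoeff f = 0)
    (h : ∀ f ∈ S, ∀ i, pderiv R i f ∈ AddSubgroup.closure S) : ∀ f ∈ S, f = 0 := by
  have h0' : ∀ f ∈ AddSubgroup.closure S, constantCoeff f = 0 := fun f hf =>
    (AddSubgroup.closure_le (constantCoeff (σ := σ) (R := R)).toAddMonoidHom.ker).2 h0 hf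
  have h' : ∀ f ∈ AddSubgroup.closure S, ∀ i, pderiv R i f ∈ AddSubgroup.closure S :=
    fun f hf i => (AddSubgroup.closure_le ((AddSubgroup.closure S).comap
      (pderiv R i : MvPowerSeries σ R →ₗ[R] MvPowerSeries σ R).toAddMonoidHom)).2
        (fun f hf => h f hf i) hf
  have hcoeff : ∀ n : ℕ, ∀ d : σ →₀ ℕ, d.degree = n → ∀ f ∈ AddSubgroup.closure S,
      coeff d f = 0 := by
    intro n
    induction n with
    | zero =>
      rintro d hd f hf
      rw [(Finsupp.degree_eq_zero_iff d).1 hd, coeff_zero_eq_constantCoeff_apply, h0' f hf]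
    | succ n ih =>
      intro d hd f hf
      obtain ⟨i, hi⟩ : ∃ i, d i ≠ 0 := by
        by_contra! hzero
        simp [show d = 0 from Finsupp.ext hzero] at hd
      obtain ⟨e, rfl⟩ : ∃ e, d = e + Finsupp.single i 1 :=
        ⟨d - Finsupp.single i 1, (tsub_add_cancel_of_le (by simpa [Nat.one_le_iff_ne_zero])).symm⟩
      have he : coeff e (pderiv R i f) = 0 := ih e (by simpa using hd) _ (h' f hf i)
      rw [coeff_pderiv] at he
      exact (mul_eq_zero.1 he).resolve_right (by exact_mod_cast Nat.succ_ne_zero (e i))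
  exact fun f hf => MvPowerSeries.ext fun d => hcoeff _ d rfl f (AddSubgroup.subset_closure hf)

end PderivClosure

section PartialDerivatives

open scoped ContDiff Topology

variable {f g : (Fin 3 → ℝ) → ℝ} {p : Fin 3 → ℝ}

lemma contDiffAt_partialD (hf : ContDiffAt ℝ ∞ f p) (i : Fin 3) :
    ContDiffAt ℝ ∞ (partialD i f) p :=
  (hf.fderiv_right (m := ∞) le_rfl).clm_apply contDiffAt_const

lemma contDiffAt_iterate_partialD (hf : ContDiffAt ℝ ∞ f p) (i : Fin 3) (k : ℕ) :
    ContDiffAt ℝ ∞ ((partialD i)^[k] f) p := by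
  induction k with
  | zero => exact hf
  | succ k ih =>
    rw [Function.iterate_succ_apply']
    exact contDiffAt_partialD ih i

lemma partialD_congr (h : f =ᶠ[𝓝 p] g) (i : Fin 3) : partialD i f =ᶠ[𝓝 p] partialD i g := by
  filter_upwards [h.fderiv (𝕜 := ℝ)] with x hx
  rw [partialD, partialD, hx]

lemma iterate_partialD_congr (h : f =ᶠ[𝓝 p] g) (i : Fin 3) (k : ℕ) :
    (partialD i)^[k] f =ᶠ[𝓝 p] (partialD i)^[k] g := by
  induction k with
  | zero => exact h
  | succ k ih =>
    rw [Function.iterate_succ_apply', Function.iterate_succ_apply']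
    exact partialD_congr ih i

lemma eventually_differentiableAt {E : Type*} [NormedAddCommGroup E] [NormedSpace ℝ E]
    {G : (Fin 3 → ℝ) → E} (hG : ContDiffAt ℝ ∞ G p) : ∀ᶠ x in 𝓝 p, DifferentiableAt ℝ G x := by
  have hG1 : ContDiffAt ℝ 1 G p := hG.of_le (by exact_mod_cast le_top)
  filter_upwards [hG1.eventually (by simp)] with x hx
  exact hx.differentiableAt (by simp)

lemma partialD_comm (hf : ContDiffAt ℝ ∞ f p) (i j : Fin 3) :
    partialD i (partialD j f) =ᶠ[𝓝 p] partialD j (partialD i f) := by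
  have hf2 : ContDiffAt ℝ 2 f p := hf.of_le
    (show ((2 : ℕ∞) : WithTop ℕ∞) ≤ ((⊤ : ℕ∞) : WithTop ℕ∞) from WithTop.coe_le_coe.2 le_top)
  filter_upwards [hf2.eventually (by simp)] with x hx
  have hd : DifferentiableAt ℝ (fderiv ℝ f) x :=
    (hx.fderiv_right (m := 1) (by norm_num)).differentiableAt (by simp)
  have hsecond (i j : Fin 3) : partialD i (partialD j f) x =
      fderiv ℝ (fderiv ℝ f) x (Pi.single i 1) (Pi.single j 1) := by
    have hj := hd.hasFDerivAt.clm_apply (hasFDerivAt_const (Pi.single j (1 : ℝ)) x)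
    rw [partialD, show partialD j f = fun y => fderiv ℝ f y (Pi.single j 1) from rfl, hj.fderiv]
    simp
  rw [hsecond, hsecond]
  exact hx.isSymmSndFDerivAt (by simp) _ _

lemma iterate_partialD_comm (hf : ContDiffAt ℝ ∞ f p) (i j : Fin 3) (k : ℕ) :
    (partialD i)^[k] (partialD j f) =ᶠ[𝓝 p] partialD j ((partialD i)^[k] f) := by
  induction k with
  | zero => rfl
  | succ k ih =>
    rw [Function.iterate_succ_apply', Function.iterate_succ_apply']
    exact (partialD_congr ih i).trans (partialD_comm (contDiffAt_iterate_partialD hf i k) i j)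

lemma partialD_add (hf : ContDiffAt ℝ ∞ f p) (hg : ContDiffAt ℝ ∞ g p) (i : Fin 3) :
    partialD i (f + g) =ᶠ[𝓝 p] partialD i f + partialD i g := by
  filter_upwards [eventually_differentiableAt hf, eventually_differentiableAt hg] with x hfx hgx
  simp [partialD, fderiv_add hfx hgx]

lemma partialD_mul (hf : ContDiffAt ℝ ∞ f p) (hg : ContDiffAt ℝ ∞ g p) (i : Fin 3) :
    partialD i (f * g) =ᶠ[𝓝 p] f * partialD i g + g * partialD i f := by
  filter_upwards [eventually_differentiableAt hf, eventually_differentiableAt hg] with x hfx hgx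
  simp [partialD, fderiv_mul hfx hgx]

lemma partialD_const (i : Fin 3) (c : ℝ) : partialD i (fun _ => c) = fun _ => 0 := by
  funext x
  simp [partialD]

end PartialDerivatives

section TaylorSeries

open scoped ContDiff Topology

variable {f g : (Fin 3 → ℝ) → ℝ}

lemma coeff_taylorSeries (f : (Fin 3 → ℝ) → ℝ) (k l m : ℕ) :
    coeff (expo k l m) (taylorSeries f) =
      ((partialD 0)^[k] ((partialD 1)^[l] ((partialD 2)^[m] f))) 0 /
        (k.factorial * l.factorial * m.factorial : ℝ) := rfl

lemma constantCoeff_taylorSeries (f : (Fin 3 → ℝ) → ℝ) :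
    constantCoeff (taylorSeries f) = f 0 := by
  rw [← coeff_zero_eq_constantCoeff_apply, ← expo_zero, coeff_taylorSeries]
  simp

lemma taylorSeries_congr (h : f =ᶠ[𝓝 0] g) : taylorSeries f = taylorSeries g := by
  refine series_ext fun k l m => ?_
  rw [coeff_taylorSeries, coeff_taylorSeries, (iterate_partialD_congr (iterate_partialD_congr
    (iterate_partialD_congr h 2 m) 1 l) 0 k).eq_of_nhds]

lemma coeff_pderiv_two (f : FSeries) (k l m : ℕ) :
    coeff (expo k l m) (pderiv ℝ 2 f) = coeff (expo k l (m + 1)) f * (m + 1) := by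
  rw [coeff_pderiv, single_two_eq_expo, expo_add_expo, expo_apply_two, add_zero, add_zero]

lemma pderiv_taylorSeries (hf : ContDiffAt ℝ ∞ f 0) (i : Fin 3) :
    pderiv ℝ i (taylorSeries f) = taylorSeries (partialD i f) := by
  refine series_ext fun k l m => ?_
  have hcomm (j : Fin 3) := iterate_partialD_comm hf 2 j m
  fin_cases i
  · have hzero := (iterate_partialD_congr ((iterate_partialD_congr (hcomm 0) 1 l).trans
      (iterate_partialD_comm (contDiffAt_iterate_partialD hf 2 m) 1 0 l)) 0 k).eq_of_nhds
    rw [Fin.zero_eta, coeff_pderiv_zero, coeff_taylorSeries, coeff_taylorSeries, hzero,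
      Function.iterate_succ_apply, Nat.factorial_succ]
    push_cast
    field_simp
  · have hone := (iterate_partialD_congr (iterate_partialD_congr (hcomm 1) 1 l) 0 k).eq_of_nhds
    rw [Fin.mk_one, coeff_pderiv_one, coeff_taylorSeries, coeff_taylorSeries, hone,
      Function.iterate_succ_apply, Nat.factorial_succ]
    push_cast
    field_simp
  · change coeff (expo k l m) (pderiv ℝ 2 _) = coeff (expo k l m) (taylorSeries (partialD 2 f))
    rw [coeff_pderiv_two, coeff_taylorSeries, coeff_taylorSeries,
      Function.iterate_succ_apply, Nat.factorial_succ]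
    push_cast
    field_simp

lemma taylorSeries_add (hf : ContDiffAt ℝ ∞ f 0) (hg : ContDiffAt ℝ ∞ g 0) :
    taylorSeries (f + g) = taylorSeries f + taylorSeries g := by
  let S : Set FSeries := {s | ∃ f g, ContDiffAt ℝ ∞ f 0 ∧ ContDiffAt ℝ ∞ g 0 ∧
    taylorSeries (f + g) - (taylorSeries f + taylorSeries g) = s}
  refine sub_eq_zero.1 (eq_zero_of_pderiv_mem_closure (S := S) ?_ ?_ _ ⟨f, g, hf, hg, rfl⟩)
  · rintro _ ⟨f, g, -, -, rfl⟩
    simp [constantCoeff_taylorSeries]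
  · rintro _ ⟨f, g, hf, hg, rfl⟩ i
    refine AddSubgroup.subset_closure
      ⟨_, _, contDiffAt_partialD hf i, contDiffAt_partialD hg i, ?_⟩
    have hadd : ContDiffAt ℝ ∞ (f + g) 0 := hf.add hg
    rw [map_sub, map_add, pderiv_taylorSeries hadd, pderiv_taylorSeries hf,
      pderiv_taylorSeries hg, taylorSeries_congr (partialD_add hf hg i)]

lemma taylorSeries_sub (hf : ContDiffAt ℝ ∞ f 0) (hg : ContDiffAt ℝ ∞ g 0) :
    taylorSeries (f - g) = taylorSeries f - taylorSeries g := by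
  have hsub : ContDiffAt ℝ ∞ (f - g) 0 := hf.sub hg
  rw [eq_sub_iff_add_eq, ← taylorSeries_add hsub hg, sub_add_cancel]

lemma taylorSeries_mul (hf : ContDiffAt ℝ ∞ f 0) (hg : ContDiffAt ℝ ∞ g 0) :
    taylorSeries (f * g) = taylorSeries f * taylorSeries g := by
  let S : Set FSeries := {s | ∃ f g, ContDiffAt ℝ ∞ f 0 ∧ ContDiffAt ℝ ∞ g 0 ∧
    taylorSeries (f * g) - taylorSeries f * taylorSeries g = s}
  refine sub_eq_zero.1 (eq_zero_of_pderiv_mem_closure (S := S) ?_ ?_ _ ⟨f, g, hf, hg, rfl⟩)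
  · rintro _ ⟨f, g, -, -, rfl⟩
    simp [constantCoeff_taylorSeries]
  · rintro _ ⟨f, g, hf, hg, rfl⟩ i
    have hf' := contDiffAt_partialD hf i
    have hg' := contDiffAt_partialD hg i
    have hmul : ContDiffAt ℝ ∞ (f * g) 0 := hf.mul hg
    have hfg' : ContDiffAt ℝ ∞ (f * partialD i g) 0 := hf.mul hg'
    have hgf' : ContDiffAt ℝ ∞ (g * partialD i f) 0 := hg.mul hf'
    have hleibniz : pderiv ℝ i (taylorSeries (f * g) - taylorSeries f * taylorSeries g) =
        (taylorSeries (f * partialD i g) - taylorSeries f * taylorSeries (partialD i g)) +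
          (taylorSeries (g * partialD i f) - taylorSeries g * taylorSeries (partialD i f)) := by
      rw [map_sub, Derivation.leibniz, pderiv_taylorSeries hmul, pderiv_taylorSeries hf,
        pderiv_taylorSeries hg, taylorSeries_congr (partialD_mul hf hg i),
        taylorSeries_add hfg' hgf', smul_eq_mul, smul_eq_mul]
      ring
    rw [hleibniz]
    exact add_mem (AddSubgroup.subset_closure ⟨_, _, hf, hg', rfl⟩)
      (AddSubgroup.subset_closure ⟨_, _, hg, hf', rfl⟩)

lemma taylorSeries_const (c : ℝ) : taylorSeries (fun _ => c) = C c := by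
  let S : Set FSeries := {s | ∃ c, taylorSeries (fun _ => c) - C c = s}
  refine sub_eq_zero.1 (eq_zero_of_pderiv_mem_closure (S := S) ?_ ?_ _ ⟨c, rfl⟩)
  · rintro _ ⟨c, rfl⟩
    simp [constantCoeff_taylorSeries]
  · rintro _ ⟨c, rfl⟩ i
    refine AddSubgroup.subset_closure ⟨0, ?_⟩
    rw [map_sub, pderiv_taylorSeries contDiffAt_const, partialD_const, pderiv_C, map_zero]

end TaylorSeries

section TaylorMap

open scoped ContDiff Topology

variable {G : (Fin 3 → ℝ) → Fin 2 → ℝ} {p : Fin 3 → ℝ}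

lemma jacobian_apply (hG : DifferentiableAt ℝ G p) (i j : Fin 2) :
    jacobian G p i j = partialD j.castSucc (fun x => G x i) p := by
  rw [jacobian, Matrix.of_apply, partialD, (hasFDerivAt_pi'.1 hG.hasFDerivAt i).fderiv]
  rfl

lemma linearPart_taylorMap (hG : DifferentiableAt ℝ G 0) :
    linearPart (taylorMap G) = jacobian G 0 := by
  ext i j
  rw [jacobian_apply hG, linearPart, Matrix.of_apply, taylorMap]
  fin_cases j
  · rw [Fin.zero_eta, Fin.castSucc_zero, single_zero_eq_expo, coeff_taylorSeries]
    simp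
  · rw [Fin.mk_one, Fin.castSucc_one, single_one_eq_expo, coeff_taylorSeries]
    simp

lemma jacDet_taylorMap (hG : ContDiffAt ℝ ∞ G 0) :
    jacDet (taylorMap G) = taylorSeries fun p => (jacobian G p).det := by
  have hcomp : ∀ i, ContDiffAt ℝ ∞ (fun p => G p i) 0 := contDiffAt_pi.1 hG
  have hpartial (i : Fin 2) (j : Fin 3) := contDiffAt_partialD (hcomp i) j
  have hdet : (fun p => (jacobian G p).det) =ᶠ[𝓝 0]
      partialD 0 (fun p => G p 0) * partialD 1 (fun p => G p 1) -
        partialD 1 (fun p => G p 0) * partialD 0 (fun p => G p 1) := by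
    filter_upwards [eventually_differentiableAt hG] with p hp
    simp [Matrix.det_fin_two, jacobian_apply hp]
  have hmul (i j : Fin 2) (k l : Fin 3) : ContDiffAt ℝ ∞
      (partialD k (fun p => G p i) * partialD l (fun p => G p j)) 0 :=
    (hpartial i k).mul (hpartial j l)
  rw [taylorSeries_congr hdet, taylorSeries_sub (hmul 0 1 0 1) (hmul 0 1 1 0),
    taylorSeries_mul (hpartial 0 0) (hpartial 1 1), taylorSeries_mul (hpartial 0 1) (hpartial 1 0)]
  simp only [jacDet, taylorMap, pderiv_taylorSeries (hcomp _)]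

lemma IsReversingFamilyOn.isFormalReversingFamily {r : WithTop ℕ∞} {U : Set (Fin 3 → ℝ)}
    (hG : IsReversingFamilyOn r U G) (hr : ∞ ≤ r) : IsFormalReversingFamily (taylorMap G) := by
  have hU : U ∈ 𝓝 0 := hG.isOpen.mem_nhds hG.zero_mem
  have hG0 : ContDiffAt ℝ ∞ G 0 := (hG.contDiffOn.contDiffAt hU).of_le hr
  refine ⟨?_, fun i => ?_, ?_⟩
  · have hdet : (fun p => (jacobian G p).det) =ᶠ[𝓝 0] fun _ => -1 :=
      Filter.mem_of_superset hU hG.det_jacobian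
    rw [jacDet_taylorMap hG0, taylorSeries_congr hdet, taylorSeries_const, map_neg, map_one]
  · rw [taylorMap, constantCoeff_taylorSeries, hG.map_zero, Pi.zero_apply]
  · rw [linearPart_taylorMap (eventually_differentiableAt hG0).self_of_nhds]
    exact hG.eigenvalues

end TaylorMap

end

end ReversingMaps

open ReversingMaps in
open scoped ContDiff in
theorem theorem5 (F : FormalMap)
    (hF : IsFormalReversingFamily F ∨
      ∃ (r : WithTop ℕ∞) (U : Set (Fin 3 → ℝ)) (G : (Fin 3 → ℝ) → Fin 2 → ℝ),
        (r = ∞ ∨ r = ω) ∧ IsReversingFamilyOn r U G ∧ F = taylorMap G)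
    (hb : NondegenerateLeadingOrder F) :
    ∃! p : ℝ × MvPowerSeries (Fin 2) ℝ × MvPowerSeries (Fin 2) ℝ,
      AdmissibleA p.2.1 ∧ AdmissibleB p.2.2 ∧
        ConjToReflectedFlow F (normalHam p.1 p.2.1 p.2.2) := by
  have hformal : IsFormalReversingFamily F := by
    rcases hF with hF | ⟨r, U, G, hr, hG, rfl⟩
    · exact hF
    · exact hG.isFormalReversingFamily (by rcases hr with rfl | rfl <;> simp)
  obtain ⟨h, hh⟩ := exists_isTakensHamiltonian hformal
  exact hh.existsUnique_normalHam hformal.fixesOrigin (hb h hh)
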